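/- Let $r\ge 1$, $J=\mathrm{diag}(\mathbb 1_r,-\mathbb 1_r)$, $S_0=\sum_{k=1}^r(-1)^{k+1}(E_{k,\bar k}+E_{\bar k,k})$ with $\bar k=2r+1-k$, and $so(2r)=\{X\in\mathbb C^{2r\times 2r}: X+S_0X^TS_0^{-1}=0\}$. Let $Q:\mathbb R\to so(2r)$ be continuous, absolutely integrable and block-off-diagonal (with $r\times r$ blocks), and $U(x,\lambda)=Q(x)-\lambda J$. A hat denotes the matrix inverse, $X^*$ the entrywise complex conjugate, $X^\dagger=(X^*)^T$, $\mathbb C_\pm=\{\pm\mathrm{Im}\,\lambda>0\}$. Scattering data. The Jost solutions $\psi,\phi$ of $i\,\partial_x\psi+U\psi=0$ are fixed by $\psi e^{i\lambda Jx}\to\mathbb 1$ $(x\to\infty)$, $\phi e^{i\lambda Jx}\to\mathbb 1$ $(x\to-\infty)$, $\lambda\in\mathbb R$; $\psi=(\psi^-,\psi^+)$, $\phi=(\phi^+,\phi^-)$, $\hat\psi=\binom{\hat\psi^+}{\hat\psi^-}$, $\hat\phi=\binom{\hat\phi^-}{\hat\phi^+}$, where the halves with superscript $\pm$ are extended to $\overline{\mathbb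 C_\pm}$ by the same equations and the corresponding halves of the same normalizations. The scattering matrix is defined by $\phi=\psi T$, and $$T=\begin{pmatrix}a^+&-b^-\\ b^+&a^-\end{pmatrix},\qquad \hat T=\begin{pmatrix}c^-&d^-\\-d^+&c^+\end{pmatrix}\qquad(\lambda\in\mathbb R),$$ with $a^\pm=\hat\psi^\pm\phi^\pm$, $c^\pm=\hat\phi^\pm\psi^\pm$ on $\overline{\mathbb C_\pm}$. Put $\rho^\pm=b^\pm\hat a^\pm$, $\tau^\pm=\hat a^\pm b^\mp$, $$S^+=\begin{pmatrix}\mathbb 1&d^-\hat c^+\\0&\mathbb 1\end{pmatrix},\ S^-=\begin{pmatrix}\mathbb 1&0\\-d^+\hat c^-&\mathbb 1\end{pmatrix},\ T^+=\begin{pmatrix}\mathbb 1&-b^-\hat a^-\\0&\mathbb 1\end{pmatrix},\ T^-=\begin{pmatrix}\mathbb 1&0\\b^+\hat a^+&\mathbb 1\end{pmatrix},$$ $$D^+=\mathrm{diag}(a^+,\hat c^+),\qquad D^-=\mathrm{diag}(\hat c^-,a^-)$$ (so $T=T^-D^+\hat S^+=T^+D^-\hat S^-$). The eigenvalues $\lambda_j^\pm$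 are the points of $\mathbb C_\pm$ at which $a^\pm$ is degenerate. Such an eigenvalue is called simple if $\hat a^\pm$ and $\hat c^\pm$ have simple poles there; if $\hat a^\pm_j,\hat c^\pm_j$ are the residues, $\rho_j^\pm,\tau_j^\pm$ are defined by $\phi^\pm\hat a_j^\pm=\pm\psi^\pm\rho_j^\pm$, $\psi^\pm\hat c_j^\pm=\pm\phi^\pm\tau_j^\pm$ at $\lambda=\lambda_j^\pm$, for all $x$. Reductions. For an invertible $2r\times 2r$ matrix $C$ write $C(X)=C^{-1}XC$; $C$ is of class A if $C(J)=J$, of class B if $C(J)=-J$. For a map $\kappa:\mathbb C\to\mathbb C$ consider the conditions (for all $x\in\mathbb R$, $\lambda\in\mathbb C$) a) $C(U^\dagger(\kappa(\lambda)))=U(\lambda)$; b) $C(U^T(\kappa(\lambda)))=-U(\lambda)$; c) $C(U^*(\kappa(\lambda)))=-U(\lambda)$; d) $C(U(\kappa(\lambda)))=U(\lambda)$. In what follows the relations for $T$ hold for all $\lambda\in\mathbb R$; those for $S^\pm$ and $T^\pm$ for all $\lambda\in\mathbb R$ with $\det a^\pm(\lambda)\ne0$; a relation with $D^\pm(\lambda)$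 on its right-hand side holds for all $\lambda\in\overline{\mathbb C_\pm}$ with $\det a^\pm(\lambda)\neq0$. (A) If $C$ is of class A, then $X\mapsto C(X)$ maps block-upper-triangular (block-lower-triangular, block-diagonal) matrices to matrices of the same type, and likewise for the block-triangular ones with unit diagonal blocks. Moreover each of the conditions a)–d) implies, respectively: a) $\kappa(\lambda)=\lambda^*$, $C(T^\dagger(\lambda^*))=\hat T(\lambda)$, $C((S^+)^\dagger(\lambda^*))=\hat S^-(\lambda)$, $C((T^-)^\dagger(\lambda^*))=\hat T^+(\lambda)$, $C((D^+)^\dagger(\lambda^*))=\hat D^-(\lambda)$; b) $\kappa(\lambda)=-\lambda$, $C(T^T(-\lambda))=\hat T(\lambda)$, $C((S^+)^T(-\lambda))=\hat S^-(\lambda)$, $C((T^-)^T(-\lambda))=\hat T^+(\lambda)$, $C((D^+)^T(-\lambda))=\hat D^-(\lambda)$; c) $\kappa(\lambda)=-\lambda^*$, $C(T^*(-\lambda^*))=T(\lambda)$, $C((S^\pm)^*(-\lambda^*))=S^\pm(\lambda)$, $C((T^\pm)^*(-\lambda^*))=T^\pm(\lambda)$, $C((D^\pm)^*(-\lambda^*))=D^\pm(\lambda)$;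 d) $\kappa(\lambda)=\lambda$, $C(T(\lambda))=T(\lambda)$, $C(S^\pm(\lambda))=S^\pm(\lambda)$, $C(T^\pm(\lambda))=T^\pm(\lambda)$, $C(D^\pm(\lambda))=D^\pm(\lambda)$. (B) If $C$ is of class B, then $X\mapsto C(X)$ exchanges block-upper- and block-lower-triangular matrices (also those with unit diagonal blocks) and preserves block-diagonal ones. Moreover each of the conditions a)–d) implies, respectively: a) $\kappa(\lambda)=-\lambda^*$, $C(T^\dagger(-\lambda^*))=\hat T(\lambda)$, $C((S^\pm)^\dagger(-\lambda^*))=\hat S^\pm(\lambda)$, $C((T^\pm)^\dagger(-\lambda^*))=\hat T^\pm(\lambda)$, $C((D^\pm)^\dagger(-\lambda^*))=\hat D^\pm(\lambda)$; b) $\kappa(\lambda)=\lambda$, $C(T^T(\lambda))=\hat T(\lambda)$, $C((S^\pm)^T(\lambda))=\hat S^\pm(\lambda)$, $C((T^\pm)^T(\lambda))=\hat T^\pm(\lambda)$, $C((D^\pm)^T(\lambda))=\hat D^\pm(\lambda)$; c) $\kappa(\lambda)=\lambda^*$, $C(T^*(\lambda^*))=T(\lambda)$, $C((S^+)^*(\lambda^*))=S^-(\lambda)$,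 $C((T^-)^*(\lambda^*))=T^+(\lambda)$, $C((D^+)^*(\lambda^*))=D^-(\lambda)$; d) $\kappa(\lambda)=-\lambda$, $C(T(-\lambda))=T(\lambda)$, $C(S^+(-\lambda))=S^-(\lambda)$, $C(T^-(-\lambda))=T^+(\lambda)$, $C(D^+(-\lambda))=D^-(\lambda)$. (C) Let condition a) hold with $C=\mathrm{diag}(B_+,B_-)$, where $B_\pm$ are diagonal and $B_\pm^2=\mathbb 1$. Then for all $\lambda\in\mathbb R$ with $\det a^\pm(\lambda)\neq0$ $$\rho^-(\lambda)=(B_-\rho^+(\lambda)B_+)^\dagger,\qquad \tau^-(\lambda)=(B_+\tau^+(\lambda)B_-)^\dagger;$$ the eigenvalues in $\mathbb C_-$ are exactly the complex conjugates of those in $\mathbb C_+$, $\lambda_j^-=(\lambda_j^+)^*$; and if $\lambda_j^+$ is simple with constants $\rho_j^+,\tau_j^+$, then $\lambda_j^-$ is simple, and its constants are exactly $\rho_j^-=(B_-\rho_j^+B_+)^\dagger$, $\tau_j^-=(B_+\tau_j^+B_-)^\dagger$. -/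

import Mathlib

open scoped Matrix ComplexConjugate

noncomputable section

namespace LaxScattering

/-- `2r × 2r` complex matrices in `r × r` block form. The index `k ≤ r` of `1, …, 2r` is `inl (k-1)`, the
index `r + k` is `inr (k-1)`; so `2r+1-k` is `inr (Fin.rev (k-1))`. -/
abbrev BMat (r : ℕ) := Matrix (Fin r ⊕ Fin r) (Fin r ⊕ Fin r) ℂ

/-- `r` columns of height `2r`. -/
abbrev Cols (r : ℕ) := Matrix (Fin r ⊕ Fin r) (Fin r) ℂ

/-- `r` rows of length `2r`. -/
abbrev Rows (r : ℕ) := Matrix (Fin r) (Fin r ⊕ Fin r) ℂ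

/-- `r × r` blocks. -/
abbrev Blk (r : ℕ) := Matrix (Fin r) (Fin r) ℂ

/-! ### The algebra `so(2r)` and the Lax potential -/

/-- `J = diag(1, -1)`. -/
def J (r : ℕ) : BMat r := Matrix.fromBlocks 1 0 0 (-1)

/-- The block `s₀ = ∑ₖ (-1)^{k+1} E_{k, r+1-k}` (here `k` starts from `0`). -/
def s0 (r : ℕ) : Blk r := Matrix.of fun i j => if j = Fin.rev i then (-1) ^ (i : ℕ) else 0

/-- `S₀ = ∑ₖ (-1)^{k+1} (E_{k, 2r+1-k} + E_{2r+1-k, k})`. -/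
def S0 (r : ℕ) : BMat r := Matrix.fromBlocks 0 (s0 r) (s0 r)ᵀ 0

/-- Membership in `so(2r)`: `X + S₀ Xᵀ S₀⁻¹ = 0`. -/
def IsSo {r : ℕ} (X : BMat r) : Prop := X + S0 r * Xᵀ * (S0 r)⁻¹ = 0

/-- Potentials of **DIII** type: continuous, absolutely integrable, block-off-diagonal,
with values in `so(2r)`. -/
structure IsPotential {r : ℕ} (Q : ℝ → BMat r) : Prop where
  continuous : Continuous Q
  integrable : ∀ i j, MeasureTheory.Integrable (fun x => Q x i j)
  block₁₁ : ∀ x, (Q x).toBlocks₁₁ = 0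
  block₂₂ : ∀ x, (Q x).toBlocks₂₂ = 0
  so : ∀ x, IsSo (Q x)

/-- `U(x, λ) = Q(x) - λ J`. -/
def laxU {r : ℕ} (Q : ℝ → BMat r) (z : ℂ) (x : ℝ) : BMat r := Q x - z • J r

/-! ### Jost solutions

The full Jost solutions exist for real `λ`; each of their halves (`r` columns, or `r` rows of the
inverse) exists on a closed half-plane. -/

/-- `Y` solves `i Y' + (Q - λ J) Y = 0` and `e^{i s λ x} Y(x) → E` along the filter `l`
(`l = -∞` or `+∞`). -/
def IsJostCols {r : ℕ} (Q : ℝ → BMat r) (l : Filter ℝ) (s : ℂ) (E : Cols r) (z : ℂ)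
    (Y : ℝ → Cols r) : Prop :=
  (∀ x i j, HasDerivAt (fun y => Y y i j) ((Complex.I • (laxU Q z x * Y x)) i j) x) ∧
  Filter.Tendsto (fun x : ℝ => Complex.exp (Complex.I * s * z * x) • Y x) l (nhds E)

/-- `Z` solves `i Z' - Z (Q - λ J) = 0` and `e^{-i s λ x} Z(x) → E` along the filter `l`. -/
def IsJostRows {r : ℕ} (Q : ℝ → BMat r) (l : Filter ℝ) (s : ℂ) (E : Rows r) (z : ℂ)
    (Z : ℝ → Rows r) : Prop :=
  (∀ x i j, HasDerivAt (fun y => Z y i j) (((-Complex.I) • (Z x * laxU Q z x)) i j) x) ∧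
  Filter.Tendsto (fun x : ℝ => Complex.exp (-(Complex.I * s * z * x)) • Z x) l (nhds E)

open Classical in
/-- The solution singled out by `IsJostCols` (zero where there is none). -/
def jostCols {r : ℕ} (Q : ℝ → BMat r) (l : Filter ℝ) (s : ℂ) (E : Cols r) (z : ℂ) :
    ℝ → Cols r :=
  if h : ∃ Y, IsJostCols Q l s E z Y then h.choose else 0

open Classical in
/-- The solution singled out by `IsJostRows` (zero where there is none). -/
def jostRows {r : ℕ} (Q : ℝ → BMat r) (l : Filter ℝ) (s : ℂ) (E : Rows r) (z : ℂ) :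
    ℝ → Rows r :=
  if h : ∃ Z, IsJostRows Q l s E z Z then h.choose else 0

section
variable {r : ℕ} (Q : ℝ → BMat r) (z : ℂ)

/-- `φ⁺`, the first `r` columns of `φ`; `Im λ ≥ 0`. -/
def phiP : ℝ → Cols r := jostCols Q Filter.atBot 1 (Matrix.fromRows 1 0) z

/-- `φ⁻`, the last `r` columns of `φ`; `Im λ ≤ 0`. -/
def phiM : ℝ → Cols r := jostCols Q Filter.atBot (-1) (Matrix.fromRows 0 1) z

/-- `ψ⁻`, the first `r` columns of `ψ`; `Im λ ≤ 0`. -/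
def psiM : ℝ → Cols r := jostCols Q Filter.atTop 1 (Matrix.fromRows 1 0) z

/-- `ψ⁺`, the last `r` columns of `ψ`; `Im λ ≥ 0`. -/
def psiP : ℝ → Cols r := jostCols Q Filter.atTop (-1) (Matrix.fromRows 0 1) z

/-- `φ̂⁻`, the first `r` rows of the inverse of `φ`; `Im λ ≤ 0`. -/
def phiInvM : ℝ → Rows r := jostRows Q Filter.atBot 1 (Matrix.fromCols 1 0) z

/-- `φ̂⁺`, the last `r` rows of the inverse of `φ`; `Im λ ≥ 0`. -/
def phiInvP : ℝ → Rows r := jostRows Q Filter.atBot (-1) (Matrix.fromCols 0 1) z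

/-- `ψ̂⁺`, the first `r` rows of the inverse of `ψ`; `Im λ ≥ 0`. -/
def psiInvP : ℝ → Rows r := jostRows Q Filter.atTop 1 (Matrix.fromCols 1 0) z

/-- `ψ̂⁻`, the last `r` rows of the inverse of `ψ`; `Im λ ≤ 0`. -/
def psiInvM : ℝ → Rows r := jostRows Q Filter.atTop (-1) (Matrix.fromCols 0 1) z

/-- The Jost solution `φ = (φ⁺, φ⁻)`, `λ` real: `φ e^{iλJx} → 1` for `x → -∞`. -/
def phi (x : ℝ) : BMat r := Matrix.fromCols (phiP Q z x) (phiM Q z x)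

/-- The Jost solution `ψ = (ψ⁻, ψ⁺)`, `λ` real: `ψ e^{iλJx} → 1` for `x → +∞`. -/
def psi (x : ℝ) : BMat r := Matrix.fromCols (psiM Q z x) (psiP Q z x)

/-! ### Scattering matrix

The pairings below do not depend on the point `x`, which is taken to be `0`. -/

/-- `a⁺ = ⟨ψ̂⁺ | φ⁺⟩`, `Im λ ≥ 0`. -/
def aP : Blk r := psiInvP Q z 0 * phiP Q z 0

/-- `a⁻ = ⟨ψ̂⁻ | φ⁻⟩`, `Im λ ≤ 0`. -/
def aM : Blk r := psiInvM Q z 0 * phiM Q z 0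

/-- `b⁺`, `λ` real. -/
def bP : Blk r := psiInvM Q z 0 * phiP Q z 0

/-- `b⁻`, `λ` real. -/
def bM : Blk r := -(psiInvP Q z 0 * phiM Q z 0)

/-- `c⁺ = ⟨φ̂⁺ | ψ⁺⟩`, `Im λ ≥ 0`. -/
def cP : Blk r := phiInvP Q z 0 * psiP Q z 0

/-- `c⁻ = ⟨φ̂⁻ | ψ⁻⟩`, `Im λ ≤ 0`. -/
def cM : Blk r := phiInvM Q z 0 * psiM Q z 0

/-- `d⁺`, `λ` real. -/
def dP : Blk r := -(phiInvP Q z 0 * psiM Q z 0)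

/-- `d⁻`, `λ` real. -/
def dM : Blk r := phiInvM Q z 0 * psiP Q z 0

/-- The scattering matrix `T = ψ̂ φ = (a⁺, -b⁻; b⁺, a⁻)`, `λ` real. -/
def scatT : BMat r := Matrix.fromBlocks (aP Q z) (-bM Q z) (bP Q z) (aM Q z)

/-- `ρ⁺ = b⁺ (a⁺)⁻¹`. -/
def rhoP : Blk r := bP Q z * (aP Q z)⁻¹

/-- `ρ⁻ = b⁻ (a⁻)⁻¹`. -/
def rhoM : Blk r := bM Q z * (aM Q z)⁻¹

/-- `τ⁺ = (a⁺)⁻¹ b⁻`. -/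
def tauP : Blk r := (aP Q z)⁻¹ * bM Q z

/-- `τ⁻ = (a⁻)⁻¹ b⁺`. -/
def tauM : Blk r := (aM Q z)⁻¹ * bP Q z

/-! ### Generalized Gauss factors: `T = T⁻ D⁺ (S⁺)⁻¹ = T⁺ D⁻ (S⁻)⁻¹` -/

/-- `S⁺`. -/
def gaussSP : BMat r := Matrix.fromBlocks 1 (dM Q z * (cP Q z)⁻¹) 0 1

/-- `S⁻`. -/
def gaussSM : BMat r := Matrix.fromBlocks 1 0 (-(dP Q z * (cM Q z)⁻¹)) 1

/-- `T⁺`. -/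
def gaussTP : BMat r := Matrix.fromBlocks 1 (-(bM Q z * (aM Q z)⁻¹)) 0 1

/-- `T⁻`. -/
def gaussTM : BMat r := Matrix.fromBlocks 1 0 (bP Q z * (aP Q z)⁻¹) 1

/-- `D⁺`, `Im λ ≥ 0`. -/
def gaussDP : BMat r := Matrix.fromBlocks (aP Q z) 0 0 (cP Q z)⁻¹

/-- `D⁻`, `Im λ ≤ 0`. -/
def gaussDM : BMat r := Matrix.fromBlocks (cM Q z)⁻¹ 0 0 (aM Q z)

/-- A real point at which the Gauss factors exist, i.e. `a⁺` and `a⁻` are nondegenerate. -/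
def RealRegular : Prop := z.im = 0 ∧ (aP Q z).det ≠ 0 ∧ (aM Q z).det ≠ 0

/-- A point of the closed upper half-plane at which `D⁺` exists. -/
def UpperRegular : Prop := 0 ≤ z.im ∧ (aP Q z).det ≠ 0

/-- A point of the closed lower half-plane at which `D⁻` exists. -/
def LowerRegular : Prop := z.im ≤ 0 ∧ (aM Q z).det ≠ 0

end

/-! ### Discrete spectrum -/

/-- The eigenvalues `λ_j⁺`: points of the open upper half-plane where `a⁺` degenerates. -/
def specP {r : ℕ} (Q : ℝ → BMat r) : Set ℂ := {z | 0 < z.im ∧ (aP Q z).det = 0}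

/-- The eigenvalues `λ_j⁻`: points of the open lower half-plane where `a⁻` degenerates. -/
def specM {r : ℕ} (Q : ℝ → BMat r) : Set ℂ := {z | z.im < 0 ∧ (aM Q z).det = 0}

/-- `a` degenerates at `z`, is invertible near `z`, and its inverse has there a simple pole
with residue `R`. -/
def InvSimplePole {r : ℕ} (a : ℂ → Blk r) (z : ℂ) (R : Blk r) : Prop :=
  (a z).det = 0 ∧ (∀ᶠ w in nhdsWithin z {z}ᶜ, (a w).det ≠ 0) ∧
  Filter.Tendsto (fun w => (w - z) • (a w)⁻¹) (nhdsWithin z {z}ᶜ) (nhds R)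

/-- `z` is a simple eigenvalue `λ_j⁺` with data `ρ_j⁺ = ρ`, `τ_j⁺ = τ`:
`φ⁺ â_j⁺ = ψ⁺ ρ_j⁺` and `ψ⁺ ĉ_j⁺ = φ⁺ τ_j⁺` at `z`, with `â_j⁺`, `ĉ_j⁺` the residues of the
inverses of `a⁺`, `c⁺`. -/
def IsDiscreteDatumP {r : ℕ} (Q : ℝ → BMat r) (z : ℂ) (ρ τ : Blk r) : Prop :=
  0 < z.im ∧ ∃ Ra Rc : Blk r, InvSimplePole (aP Q) z Ra ∧ InvSimplePole (cP Q) z Rc ∧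
    (∀ x, phiP Q z x * Ra = psiP Q z x * ρ) ∧ (∀ x, psiP Q z x * Rc = phiP Q z x * τ)

/-- `z` is a simple eigenvalue `λ_j⁻` with data `ρ_j⁻ = ρ`, `τ_j⁻ = τ`:
`φ⁻ â_j⁻ = -ψ⁻ ρ_j⁻` and `ψ⁻ ĉ_j⁻ = -φ⁻ τ_j⁻` at `z`. -/
def IsDiscreteDatumM {r : ℕ} (Q : ℝ → BMat r) (z : ℂ) (ρ τ : Blk r) : Prop :=
  z.im < 0 ∧ ∃ Ra Rc : Blk r, InvSimplePole (aM Q) z Ra ∧ InvSimplePole (cM Q) z Rc ∧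
    (∀ x, phiM Q z x * Ra = -(psiM Q z x * ρ)) ∧ (∀ x, psiM Q z x * Rc = -(phiM Q z x * τ))

/-! ### Reductions -/

/-- The automorphism `X ↦ C⁻¹ X C`. -/
def aut {r : ℕ} (C X : BMat r) : BMat r := C⁻¹ * X * C

/-- The entrywise complex conjugate `X*`. -/
def cc {r : ℕ} (X : BMat r) : BMat r := X.map (starRingEnd ℂ)

/-- Class A: `C` is invertible and `C(J) = J`. -/
def ClassA {r : ℕ} (C : BMat r) : Prop := IsUnit C.det ∧ aut C (J r) = J r

/-- Class B: `C` is invertible and `C(J) = -J`. -/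
def ClassB {r : ℕ} (C : BMat r) : Prop := IsUnit C.det ∧ aut C (J r) = -J r

section
variable {r : ℕ} (Q : ℝ → BMat r) (C : BMat r) (κ : ℂ → ℂ)

/-- `C(U†(κ(λ))) = U(λ)`. -/
def Reduction1 : Prop := ∀ x z, aut C (laxU Q (κ z) x)ᴴ = laxU Q z x

/-- `C(Uᵀ(κ(λ))) = -U(λ)`. -/
def Reduction2 : Prop := ∀ x z, aut C (laxU Q (κ z) x)ᵀ = -laxU Q z x

/-- `C(U*(κ(λ))) = -U(λ)`. -/
def Reduction3 : Prop := ∀ x z, aut C (cc (laxU Q (κ z) x)) = -laxU Q z x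

/-- `C(U(κ(λ))) = U(λ)`. -/
def Reduction4 : Prop := ∀ x z, aut C (laxU Q (κ z) x) = laxU Q z x

end

/-- Block-upper-triangular. -/
def BlockUpper {r : ℕ} (X : BMat r) : Prop := X.toBlocks₂₁ = 0

/-- Block-lower-triangular. -/
def BlockLower {r : ℕ} (X : BMat r) : Prop := X.toBlocks₁₂ = 0

/-- Block-diagonal. -/
def BlockDiag {r : ℕ} (X : BMat r) : Prop := BlockUpper X ∧ BlockLower X

/-- Both diagonal blocks are `1`. -/
def UnitDiag {r : ℕ} (X : BMat r) : Prop := X.toBlocks₁₁ = 1 ∧ X.toBlocks₂₂ = 1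

end LaxScattering

end

noncomputable section

namespace LaxScattering

/-! ### A Volterra equation on the half-line -/

section Volterra

open MeasureTheory Set Filter Topology

/-! A reduction is a symmetry of the potential. `Q` is block-off-diagonal, hence odd under `X ↦ J X
J`, while `J` is even and `C` maps it to `ε • J` with `ε = ±1`. Comparing odd and even parts
(`reduction_split`) separates each of the conditions a)–d) into a formula for `κ` and an identity
that writes `Q` as `gauge C` of `negConj (negTranspose Q)`, `negTranspose Q`, `negConj Q` or `Q`
itself. It remains to see how the scattering data of a continuous integrable potential change under
three elementary operations: transposition, complex conjugation and gauge by `C`.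

Each half of a Jost solution is determined by its equation and its half of the normalization. A
transformed half that solves the transformed equation with the right limit is therefore the
corresponding half for the new potential. Transposition exchanges columns with rows of the inverse
and `λ` with `-λ`; conjugation sends `λ` to `-conj λ`; a gauge multiplies by `C` and a constant
block, and for class B it also changes the sign of `λ` and exchanges the halves `+` and `-`. The
Gauss factors follow by block algebra. Transposition exchanges `a` with `c`; this is compensated by
the block identities contained in the formula for the inverse of `T`, and by the fact that `a` and
`c` degenerate at the same points (`det_aP_eq_zero_iff`, `det_aM_eq_zero_iff`).

The analytic foundation is existence and uniqueness of the halves on the closed half-planes, real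
axis included. Once the exponential is removed, a half satisfies a Volterra equation on a half-line
with a bounded kernel, and in a norm weighted by `exp (2 ∫ q)` the integral operator contracts by `1
/ 2` (`exists_volterra_fixedPoint`, `IsNormalizedSolution.unique`). The end `+∞` is reached by
reflection and the rows by transposition.

For the discrete data, `completeness` resolves the identity through `φ⁺` and `ψ⁺` away from the
spectrum. Its residue at an eigenvalue (`residue_identity`) turns the relations between columns that
define the constants into relations between rows (`residue_rows`). Their adjoints are the defining
relations at the conjugate point (`IsDiscreteDatumP.dagger`); injectivity of the Jost columns makes
the constants unique. -/

theorem hasDerivAt_integral_Iic {E : Type*} [NormedAddCommGroup E] [NormedSpace ℝ E]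
    [CompleteSpace E] {f : ℝ → E} (hf : Continuous f)
    (hi : ∀ x, IntegrableOn f (Iic x)) (x : ℝ) :
    HasDerivAt (fun x => ∫ y in Iic x, f y) (f x) x := by
  have h : (fun x => ∫ y in Iic x, f y)
      = fun x => (∫ y in Iic 0, f y) + ∫ y in (0 : ℝ)..x, f y := by
    funext x
    rw [← intervalIntegral.integral_Iic_sub_Iic (hi 0) (hi x)]
    abel
  rw [h]
  exact (hf.integral_hasStrictDerivAt 0 x).hasDerivAt.const_add _

/-- The weight `exp (2 ∫_{-∞}^x q)`. -/
def weight (q : ℝ → ℝ) (x : ℝ) : ℝ := Real.exp (2 * ∫ y in Iic x, q y)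

/-! ### The weight that makes the Volterra operator a contraction. -/

section Weight

variable {q : ℝ → ℝ}

theorem hasDerivAt_weight (hq : Continuous q) (hi : Integrable q) (x : ℝ) :
    HasDerivAt (weight q) (2 * (q x * weight q x)) x := by
  have h := ((hasDerivAt_integral_Iic hq (fun x => hi.integrableOn) x).const_mul 2).exp
  refine HasDerivAt.congr_deriv h ?_
  simp only [weight]
  ring

theorem continuous_weight (hq : Continuous q) (hi : Integrable q) : Continuous (weight q) :=
  continuous_iff_continuousAt.2 fun x => (hasDerivAt_weight hq hi x).continuousAt

theorem one_le_weight (h0 : ∀ x, 0 ≤ q x) (x : ℝ) : 1 ≤ weight q x :=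
  Real.one_le_exp (mul_nonneg zero_le_two (integral_nonneg h0))

theorem weight_pos (x : ℝ) : 0 < weight q x := Real.exp_pos _

theorem weight_le (h0 : ∀ x, 0 ≤ q x) (hi : Integrable q) (x : ℝ) :
    weight q x ≤ Real.exp (2 * ∫ y, q y) := by
  exact Real.exp_le_exp.2 (mul_le_mul_of_nonneg_left
    (setIntegral_le_integral hi (Eventually.of_forall h0)) zero_le_two)

theorem integrable_mul_weight (hq : Continuous q) (h0 : ∀ x, 0 ≤ q x) (hi : Integrable q) :
    Integrable fun x => q x * weight q x := by
  refine hi.mul_bdd (c := Real.exp (2 * ∫ y, q y))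
    (continuous_weight hq hi).aestronglyMeasurable (Eventually.of_forall fun x => ?_)
  rw [Real.norm_of_nonneg (weight_pos x).le]
  exact weight_le h0 hi x

/-- The integrand is half the derivative of the weight, which tends to `1` at `-∞`. The factor `2`
in the exponent of `weight` is the source of the contraction constant `1 / 2`. -/
theorem integral_mul_weight_le (hq : Continuous q) (h0 : ∀ x, 0 ≤ q x) (hi : Integrable q)
    (x : ℝ) : ∫ y in Iic x, q y * weight q y ≤ weight q x / 2 := by
  have hlim : Tendsto (weight q) atBot (𝓝 1) := by
    have h1 : Tendsto (fun x => ∫ y in Iic x, q y) atBot (𝓝 0) := by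
      exact tendsto_integral_Iic_zero tendsto_id
    have := (Real.continuous_exp.tendsto (2 * 0)).comp (h1.const_mul 2)
    rw [mul_zero, Real.exp_zero] at this
    exact this
  have h := integral_Iic_of_hasDerivAt_of_tendsto' (a := x)
    (fun y _ => hasDerivAt_weight hq hi y)
    ((integrable_mul_weight hq h0 hi).const_mul 2).integrableOn hlim
  rw [integral_const_mul] at h
  linarith

end Weight

/-! ### The Volterra operator: bounds, differentiation, fixed point. -/

theorem norm_cexp_two_mul (z : ℂ) (t : ℝ) :
    ‖Complex.exp (2 * Complex.I * z * t)‖ = Real.exp (-2 * z.im * t) := by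
  rw [Complex.norm_exp]
  congr 1
  simp

theorem norm_cexp_two_mul_le_one {z : ℂ} (hz : 0 ≤ z.im) {t : ℝ} (ht : 0 ≤ t) :
    ‖Complex.exp (2 * Complex.I * z * t)‖ ≤ 1 := by
  rw [norm_cexp_two_mul, Real.exp_le_one_iff]
  nlinarith [mul_nonneg hz ht]

variable {E : Type*} [NormedAddCommGroup E] [NormedSpace ℂ E]

/-- The kernel `(1 - D) + e^{2izt} D`. -/
def green (D : E →L[ℂ] E) (z : ℂ) (t : ℝ) : E →L[ℂ] E :=
  (1 - D) + Complex.exp (2 * Complex.I * z * t) • D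

/-- A bound for the kernel `green D z t`, `t ≥ 0`, `Im z ≥ 0`, times `‖A x‖`. -/
def kernelBound (A : ℝ → E →L[ℂ] E) (D : E →L[ℂ] E) (x : ℝ) : ℝ := (‖1 - D‖ + ‖D‖) * ‖A x‖

/-- `∫_{-∞}^x green D z (x - y) (A y (X y)) dy`. -/
def volterra (A : ℝ → E →L[ℂ] E) (D : E →L[ℂ] E) (z : ℂ) (X : ℝ → E) (x : ℝ) : E :=
  ∫ y in Iic x, green D z (x - y) (A y (X y))

variable {A : ℝ → E →L[ℂ] E} {D : E →L[ℂ] E} {z : ℂ} {X : ℝ → E}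

theorem kernelBound_nonneg (x : ℝ) : 0 ≤ kernelBound A D x := by
  unfold kernelBound
  positivity

theorem continuous_kernelBound (hA : Continuous A) : Continuous (kernelBound A D) :=
  continuous_const.mul hA.norm

theorem integrable_kernelBound (hi : Integrable A) : Integrable (kernelBound A D) :=
  hi.norm.const_mul _

theorem norm_green_le (hz : 0 ≤ z.im) {t : ℝ} (ht : 0 ≤ t) :
    ‖green D z t‖ ≤ ‖1 - D‖ + ‖D‖ := by
  refine (norm_add_le _ _).trans (add_le_add le_rfl ?_)
  rw [norm_smul]
  exact mul_le_of_le_one_left (norm_nonneg _) (norm_cexp_two_mul_le_one hz ht)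

theorem norm_green_apply_le (hz : 0 ≤ z.im) {x y : ℝ} (h : y ≤ x) (v : E) :
    ‖green D z (x - y) (A y v)‖ ≤ kernelBound A D y * ‖v‖ := by
  have h1 := (green D z (x - y)).le_opNorm (A y v)
  have h2 := (A y).le_opNorm v
  have h3 := norm_green_le (D := D) hz (sub_nonneg.2 h)
  calc _ ≤ ‖green D z (x - y)‖ * ‖A y v‖ := h1
    _ ≤ (‖1 - D‖ + ‖D‖) * (‖A y‖ * ‖v‖) := by gcongr
    _ = _ := by rw [kernelBound]; ring

theorem continuous_green : Continuous (green D z) := by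
  unfold green
  fun_prop

theorem continuous_green_apply (hA : Continuous A) (hX : Continuous X) (x : ℝ) :
    Continuous fun y => green D z (x - y) (A y (X y)) :=
  (continuous_green.comp (continuous_const.sub continuous_id)).clm_apply (hA.clm_apply hX)

theorem integrableOn_of_bound (hi : Integrable A) {x c d : ℝ}
    (hb : ∀ y ≤ x, ‖X y‖ ≤ c) {f : ℝ → E} (hf : Continuous f)
    (hfb : ∀ y ≤ x, ‖f y‖ ≤ d * (‖A y‖ * ‖X y‖)) (hd : 0 ≤ d) :
    IntegrableOn f (Iic x) := by
  refine Integrable.mono' (g := fun y => d * c * ‖A y‖) (hi.norm.const_mul _).integrableOn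
    hf.aestronglyMeasurable ?_
  filter_upwards [ae_restrict_mem measurableSet_Iic] with y hy
  refine (hfb y hy).trans ?_
  have := hb y hy
  calc _ ≤ d * (‖A y‖ * c) := by gcongr
    _ = _ := by ring

theorem integrableOn_green (hA : Continuous A) (hi : Integrable A) (hz : 0 ≤ z.im)
    (hX : Continuous X) {x c : ℝ} (hb : ∀ y ≤ x, ‖X y‖ ≤ c) :
    IntegrableOn (fun y => green D z (x - y) (A y (X y))) (Iic x) := by
  refine integrableOn_of_bound (d := ‖1 - D‖ + ‖D‖) hi hb (continuous_green_apply hA hX x)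
    (fun y hy => ?_) (by positivity)
  have := norm_green_apply_le (A := A) (D := D) hz hy (X y)
  rw [kernelBound] at this
  linarith

/-- In the norm `sup ‖X‖ / weight` the operator has norm at most `1 / 2`. The weight does not depend
on `z`, so the bound is uniform on the closed upper half-plane. -/
theorem norm_volterra_le (hA : Continuous A) (hi : Integrable A) (hz : 0 ≤ z.im)
    {x c : ℝ} (hb : ∀ y ≤ x, ‖X y‖ ≤ c * weight (kernelBound A D) y) :
    ‖volterra A D z X x‖ ≤ c / 2 * weight (kernelBound A D) x := by
  set q := kernelBound A D
  have hc : 0 ≤ c := by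
    have h := (norm_nonneg _).trans (hb x le_rfl)
    exact nonneg_of_mul_nonneg_left h (weight_pos x)
  have hw := integrable_mul_weight (continuous_kernelBound (D := D) hA) kernelBound_nonneg
    (integrable_kernelBound hi)
  calc ‖volterra A D z X x‖ ≤ ∫ y in Iic x, c * (q y * weight q y) := by
        refine norm_integral_le_of_norm_le (hw.const_mul c).integrableOn ?_
        filter_upwards [ae_restrict_mem measurableSet_Iic] with y hy
        refine (norm_green_apply_le hz hy (X y)).trans ?_
        have h1 := hb y hy
        have h2 : 0 ≤ q y := kernelBound_nonneg y
        calc _ ≤ q y * (c * weight q y) := by gcongr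
          _ = _ := by ring
    _ = c * ∫ y in Iic x, q y * weight q y := integral_const_mul _ _
    _ ≤ c * (weight q x / 2) := by
        gcongr
        exact integral_mul_weight_le (continuous_kernelBound hA) kernelBound_nonneg
          (integrable_kernelBound hi) x
    _ = _ := by ring

theorem continuous_cexp_smul (hA : Continuous A) (hX : Continuous X) :
    Continuous fun y : ℝ => Complex.exp (-(2 * Complex.I * z * y)) • D (A y (X y)) :=
  (by fun_prop : Continuous fun y : ℝ => Complex.exp (-(2 * Complex.I * z * y))).smul
    (D.continuous.comp (hA.clm_apply hX))

/-- The modulus of the exponential is `exp (2 * z.im * y)`, which for `y ≤ x` is largest at `y = x`.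
-/
theorem integrableOn_cexp_smul (hA : Continuous A) (hi : Integrable A) (hz : 0 ≤ z.im)
    (hX : Continuous X) {x c : ℝ} (hb : ∀ y ≤ x, ‖X y‖ ≤ c) :
    IntegrableOn (fun y : ℝ => Complex.exp (-(2 * Complex.I * z * y)) • D (A y (X y)))
      (Iic x) := by
  refine integrableOn_of_bound (d := Real.exp (2 * z.im * x) * ‖D‖) hi hb
    (continuous_cexp_smul hA hX) (fun y hy => ?_) (by positivity)
  have h1 : ‖Complex.exp (-(2 * Complex.I * z * y))‖ ≤ Real.exp (2 * z.im * x) := by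
    have := norm_cexp_two_mul z (-y)
    rw [show -(2 * Complex.I * z * (y : ℂ)) = 2 * Complex.I * z * ((-y : ℝ) : ℂ) by
      push_cast; ring, this]
    refine Real.exp_le_exp.2 ?_
    have : z.im * y ≤ z.im * x := mul_le_mul_of_nonneg_left hy hz
    linarith
  have h2 := D.le_opNorm (A y (X y))
  have h3 := (A y).le_opNorm (X y)
  rw [norm_smul]
  calc _ ≤ Real.exp (2 * z.im * x) * (‖D‖ * (‖A y‖ * ‖X y‖)) := by gcongr; exact h2.trans (by gcongr)
    _ = _ := by ring

theorem integrableOn_sub_apply (hA : Continuous A) (hi : Integrable A)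
    (hX : Continuous X) {x c : ℝ} (hb : ∀ y ≤ x, ‖X y‖ ≤ c) :
    IntegrableOn (fun y : ℝ => (1 - D) (A y (X y))) (Iic x) := by
  refine integrableOn_of_bound (d := ‖1 - D‖) hi hb
    ((1 - D).continuous.comp (hA.clm_apply hX)) (fun y hy => ?_) (by positivity)
  exact ((1 - D).le_opNorm _).trans (by gcongr; exact (A y).le_opNorm _)

/-- The dependence of the kernel on `x` is pulled out of the integral, so that only the fundamental
theorem of calculus is needed to differentiate. -/
theorem volterra_eq (hA : Continuous A) (hi : Integrable A) (hz : 0 ≤ z.im)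
    (hX : Continuous X) {x c : ℝ} (hb : ∀ y ≤ x, ‖X y‖ ≤ c) :
    volterra A D z X x = (∫ y in Iic x, (1 - D) (A y (X y))) +
      Complex.exp (2 * Complex.I * z * x) •
        ∫ y in Iic x, Complex.exp (-(2 * Complex.I * z * y)) • D (A y (X y)) := by
  have hs := (integrableOn_cexp_smul (D := D) hA hi hz hX hb).smul
    (Complex.exp (2 * Complex.I * z * x))
  simp only [Pi.smul_def] at hs
  rw [← integral_smul, ← integral_add (integrableOn_sub_apply hA hi hX hb) hs, volterra]
  congr 1
  funext y
  simp only [green, Complex.ofReal_sub, mul_sub, Complex.exp_sub, add_apply,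
    smul_apply, smul_smul, Complex.exp_neg, div_eq_mul_inv]

theorem apply_volterra [CompleteSpace E] (hD : D * D = D) (hA : Continuous A) (hi : Integrable A)
    (hz : 0 ≤ z.im) (hX : Continuous X) {x c : ℝ} (hb : ∀ y ≤ x, ‖X y‖ ≤ c) :
    D (volterra A D z X x) = Complex.exp (2 * Complex.I * z * x) •
        ∫ y in Iic x, Complex.exp (-(2 * Complex.I * z * y)) • D (A y (X y)) := by
  have hDD : ∀ v, D (D v) = D v := fun v => congrArg (fun T : E →L[ℂ] E => T v) hD
  rw [volterra_eq hA hi hz hX hb, map_add, map_smul,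
    ← D.integral_comp_comm (integrableOn_sub_apply hA hi hX hb),
    ← D.integral_comp_comm (integrableOn_cexp_smul hA hi hz hX hb)]
  simp [hDD]

/-- The upper limit of integration contributes `A x (X x)`, because the kernel is the identity at `t
= 0`. The exponential factor contributes `2iz` times the second summand of `volterra_eq`, which is
the image under `D` of the whole since `D` is idempotent. -/
theorem hasDerivAt_volterra [CompleteSpace E] (hD : D * D = D) (hA : Continuous A)
    (hi : Integrable A) (hz : 0 ≤ z.im) (hX : Continuous X) {c : ℝ} (hb : ∀ y, ‖X y‖ ≤ c)
    (x : ℝ) :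
    HasDerivAt (volterra A D z X)
      (A x (X x) + (2 * Complex.I * z) • D (volterra A D z X x)) x := by
  have h1 := hasDerivAt_integral_Iic (f := fun y => (1 - D) (A y (X y)))
    ((1 - D).continuous.comp (hA.clm_apply hX))
    (fun x => integrableOn_sub_apply hA hi hX (fun y _ => hb y)) x
  have h2 := hasDerivAt_integral_Iic
    (f := fun y : ℝ => Complex.exp (-(2 * Complex.I * z * y)) • D (A y (X y)))
    (continuous_cexp_smul hA hX)
    (fun x => integrableOn_cexp_smul hA hi hz hX (fun y _ => hb y)) x
  have h3 : HasDerivAt (fun x : ℝ => Complex.exp (2 * Complex.I * z * x))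
      (Complex.exp (2 * Complex.I * z * x) * (2 * Complex.I * z)) x := by
    have := (((hasDerivAt_id x).ofReal_comp).const_mul (2 * Complex.I * z)).cexp
    simpa using this
  have hfun : volterra A D z X = fun x => (∫ y in Iic x, (1 - D) (A y (X y))) +
      Complex.exp (2 * Complex.I * z * x) •
        ∫ y in Iic x, Complex.exp (-(2 * Complex.I * z * y)) • D (A y (X y)) :=
    funext fun x => volterra_eq hA hi hz hX (fun y _ => hb y)
  rw [apply_volterra hD hA hi hz hX (fun y _ => hb y), hfun]
  refine HasDerivAt.congr_deriv (h1.add (h3.smul h2)) ?_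
  rw [smul_smul (Complex.exp _), ← Complex.exp_add]
  simp only [add_neg_cancel, Complex.exp_zero, one_smul, sub_apply,
    one_apply_eq_self, smul_smul]
  rw [mul_comm (2 * Complex.I * z) (Complex.exp _)]
  abel

/-- Stability of the Volterra equation. -/
theorem norm_le_of_sub_volterra_le (hA : Continuous A) (hi : Integrable A) (hz : 0 ≤ z.im)
    {x b c : ℝ} (hb : ∀ y ≤ x, ‖X y‖ ≤ b) (hc : ∀ y ≤ x, ‖X y - volterra A D z X y‖ ≤ c) :
    ‖X x‖ ≤ 2 * c * weight (kernelBound A D) x := by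
  set w := weight (kernelBound A D)
  have hw1 : ∀ y, 1 ≤ w y := one_le_weight kernelBound_nonneg
  have hw0 : ∀ y, 0 < w y := weight_pos
  have hb0 : 0 ≤ b := (norm_nonneg _).trans (hb x le_rfl)
  have hc0 : 0 ≤ c := (norm_nonneg _).trans (hc x le_rfl)
  have hbdd : BddAbove (range fun y : Iic x => ‖X y‖ / w y) := by
    refine ⟨b, ?_⟩
    rintro _ ⟨y, rfl⟩
    exact (div_le_self (norm_nonneg _) (hw1 _)).trans (hb y y.2)
  -- The a priori bound `b` only makes this supremum finite. It drops out of the result, because `N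
  -- ≤ c + N / 2` forces `N ≤ 2 * c`.
  set N := ⨆ y : Iic x, ‖X y‖ / w y
  have hN : ∀ y ≤ x, ‖X y‖ ≤ N * w y := fun y hy =>
    (div_le_iff₀ (hw0 y)).1 (le_ciSup hbdd (⟨y, hy⟩ : Iic x))
  have : Nonempty (Iic x) := ⟨⟨x, mem_Iic.2 le_rfl⟩⟩
  have hle : N ≤ c + N / 2 := by
    refine ciSup_le fun y => ?_
    rw [div_le_iff₀ (hw0 y)]
    have h1 := norm_volterra_le (x := y) (D := D) hA hi hz (fun t ht => hN t (ht.trans y.2))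
    have h2 := hc y y.2
    have h3 : c ≤ c * w y := le_mul_of_one_le_right hc0 (hw1 y)
    calc ‖X y‖ = ‖(X y - volterra A D z X y) + volterra A D z X y‖ := by rw [sub_add_cancel]
      _ ≤ c + N / 2 * w y := (norm_add_le _ _).trans (add_le_add h2 h1)
      _ ≤ _ := by linarith
  refine (hN x le_rfl).trans ?_
  gcongr
  · exact (hw0 x).le
  · linarith

/-- `X' = A X + 2 i z D X` with `X → v` at `-∞`. -/
structure IsNormalizedSolution (A : ℝ → E →L[ℂ] E) (D : E →L[ℂ] E) (z : ℂ) (v : E)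
    (X : ℝ → E) : Prop where
  hasDerivAt : ∀ x, HasDerivAt X (A x (X x) + (2 * Complex.I * z) • D (X x)) x
  tendsto : Tendsto X atBot (𝓝 v)

theorem volterra_sub (hA : Continuous A) (hi : Integrable A) (hz : 0 ≤ z.im) {X Y : ℝ → E}
    (hX : Continuous X) (hY : Continuous Y) {x b c : ℝ} (hb : ∀ y ≤ x, ‖X y‖ ≤ b)
    (hc : ∀ y ≤ x, ‖Y y‖ ≤ c) :
    volterra A D z (fun y => X y - Y y) x = volterra A D z X x - volterra A D z Y x := by
  simp only [volterra, map_sub]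
  exact integral_sub (integrableOn_green hA hi hz hX hb) (integrableOn_green hA hi hz hY hc)

/-- Banach's fixed point theorem for `V = X / w` in the bounded continuous functions: dividing by
the weight turns the weighted norm into the sup norm, so that `norm_volterra_le` becomes a Lipschitz
constant `1 / 2`. -/
theorem exists_volterra_fixedPoint [CompleteSpace E] (hD : D * D = D) (hA : Continuous A)
    (hi : Integrable A) (hz : 0 ≤ z.im) (v : E) :
    ∃ X : ℝ → E, Continuous X ∧ (∃ c, ∀ x, ‖X x‖ ≤ c) ∧ ∀ x, X x = v + volterra A D z X x := by
  set w := weight (kernelBound A D) with hw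
  have hwc : Continuous w := continuous_weight (continuous_kernelBound hA)
    (integrable_kernelBound hi)
  have hw1 : ∀ y, 1 ≤ w y := one_le_weight kernelBound_nonneg
  have hw0 : ∀ y, 0 < w y := weight_pos
  obtain ⟨B, hB⟩ : ∃ B, ∀ y, w y ≤ B :=
    ⟨_, weight_le kernelBound_nonneg (integrable_kernelBound hi)⟩
  have hwB : ∀ (V : BoundedContinuousFunction ℝ E) y, ‖w y • V y‖ ≤ ‖V‖ * w y := fun V y => by
    rw [norm_smul, Real.norm_of_nonneg (hw0 y).le, mul_comm]
    exact mul_le_mul_of_nonneg_right (V.norm_coe_le_norm y) (hw0 y).le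
  have hwB' : ∀ (V : BoundedContinuousFunction ℝ E) y, ‖w y • V y‖ ≤ ‖V‖ * B := fun V y =>
    (hwB V y).trans (mul_le_mul_of_nonneg_left (hB y) (norm_nonneg _))
  have hwV : ∀ V : BoundedContinuousFunction ℝ E, Continuous fun y => w y • V y :=
    fun V => hwc.smul V.continuous
  have hvc : ∀ V : BoundedContinuousFunction ℝ E,
      Continuous (volterra A D z fun y => w y • V y) := fun V =>
    continuous_iff_continuousAt.2 fun x =>
      (hasDerivAt_volterra hD hA hi hz (hwV V) (hwB' V) x).continuousAt
  have hwi : Continuous fun x => (w x)⁻¹ := hwc.inv₀ fun x => (hw0 x).ne'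
  have hbound : ∀ (V : BoundedContinuousFunction ℝ E) x,
      ‖(w x)⁻¹ • volterra A D z (fun y => w y • V y) x‖ ≤ ‖V‖ / 2 := fun V x => by
    rw [norm_smul, norm_inv, Real.norm_of_nonneg (hw0 x).le, inv_mul_le_iff₀ (hw0 x), mul_comm]
    exact norm_volterra_le hA hi hz fun y _ => hwB V y
  let F : BoundedContinuousFunction ℝ E → BoundedContinuousFunction ℝ E := fun V =>
    BoundedContinuousFunction.ofNormedAddCommGroup
      (fun x => (w x)⁻¹ • (v + volterra A D z (fun y => w y • V y) x))
      (hwi.smul (continuous_const.add (hvc V))) (‖v‖ + ‖V‖ / 2) (fun x => by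
        rw [smul_add]
        refine (norm_add_le _ _).trans (add_le_add ?_ (hbound V x))
        rw [norm_smul, norm_inv, Real.norm_of_nonneg (hw0 x).le]
        exact mul_le_of_le_one_left (norm_nonneg _) (inv_le_one_of_one_le₀ (hw1 x)))
  have hF : ContractingWith (1 / 2) F := by
    refine ⟨by rw [← NNReal.coe_lt_coe]; norm_num, LipschitzWith.of_dist_le_mul fun V W => ?_⟩
    rw [BoundedContinuousFunction.dist_le (by positivity)]
    intro x
    rw [dist_eq_norm, dist_eq_norm]
    have h1 : F V x - F W x
        = (w x)⁻¹ • volterra A D z (fun y => w y • (V - W) y) x := by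
      have := volterra_sub (D := D) hA hi hz (hwV V) (hwV W) (x := x) (fun y _ => hwB' V y)
        (fun y _ => hwB' W y)
      simp only [← smul_sub] at this
      simp only [BoundedContinuousFunction.sub_apply, this]
      simp only [F, BoundedContinuousFunction.coe_ofNormedAddCommGroup, ← smul_sub,
        add_sub_add_left_eq_sub]
    rw [h1]
    refine (hbound _ x).trans (le_of_eq ?_)
    push_cast
    ring
  set V := ContractingWith.fixedPoint F hF
  have hV : F V = V := hF.fixedPoint_isFixedPt
  refine ⟨fun x => w x • V x, hwV V, ⟨_, hwB' V⟩, fun x => ?_⟩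
  have h2 : V x = (w x)⁻¹ • (v + volterra A D z (fun y => w y • V y) x) := by
    conv_lhs => rw [← hV]
    rfl
  change w x • V x = _
  rw [h2, smul_inv_smul₀ (hw0 x).ne']

/-- Since `D v = 0`, the constant term is invisible to the part `2iz D` of the equation, and the
fixed point solves it. The integral term vanishes at `-∞` as the tail of an integrable function. -/
theorem exists_isNormalizedSolution [CompleteSpace E] (hD : D * D = D) (hA : Continuous A)
    (hi : Integrable A) (hz : 0 ≤ z.im) {v : E} (hv : D v = 0) :
    ∃ X : ℝ → E, IsNormalizedSolution A D z v X := by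
  obtain ⟨X, hX, ⟨c, hc⟩, hfix⟩ := exists_volterra_fixedPoint hD hA hi hz v
  have hfun : X = fun x => v + volterra A D z X x := funext hfix
  refine ⟨X, fun x => ?_, ?_⟩
  · have h := (hasDerivAt_volterra hD hA hi hz hX hc x).const_add v
    have hDX : D (X x) = D (volterra A D z X x) := by
      conv_lhs => rw [hfix x, map_add, hv, zero_add]
    rw [hDX]
    rwa [← hfun] at h
  · have h1 : Tendsto (fun x => ∫ y in Iic x, kernelBound A D y * c) atBot (𝓝 0) :=
      tendsto_integral_Iic_zero tendsto_id
    have h2 : Tendsto (volterra A D z X) atBot (𝓝 0) := by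
      refine squeeze_zero_norm (fun x => ?_) h1
      refine norm_integral_le_of_norm_le
        ((integrable_kernelBound hi).mul_const c).integrableOn ?_
      filter_upwards [ae_restrict_mem measurableSet_Iic] with y hy
      exact (norm_green_apply_le hz hy (X y)).trans
        (mul_le_mul_of_nonneg_left (hc y) (kernelBound_nonneg y))
    rw [hfun]
    simpa using h2.const_add v

theorem IsNormalizedSolution.continuous {v : E} (h : IsNormalizedSolution A D z v X) :
    Continuous X :=
  continuous_iff_continuousAt.2 fun x => (h.hasDerivAt x).continuousAt

theorem IsNormalizedSolution.bound {v : E} (h : IsNormalizedSolution A D z v X) (x : ℝ) :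
    ∃ c, ∀ y ≤ x, ‖X y‖ ≤ c := by
  obtain ⟨a, ha⟩ := (eventually_atBot.1 ((h.tendsto.norm).eventually_le_const
    (lt_add_one ‖v‖)))
  obtain ⟨c, hc⟩ := (isCompact_Icc (a := a) (b := x)).exists_bound_of_continuousOn
    h.continuous.continuousOn
  refine ⟨max (‖v‖ + 1) c, fun y hy => ?_⟩
  rcases le_total y a with h1 | h1
  · exact (ha y h1).trans (le_max_left _ _)
  · exact (hc y ⟨h1, hy⟩).trans (le_max_right _ _)

/-- Variation of constants: `(1 - D) X` and `exp (-2izx) D X` have derivatives free of the `2iz D`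
term and are integrated from `-∞`. The second has no boundary term, as the exponential is bounded
for `x ≤ 0` and `D X` tends to `D v = 0`. -/
theorem IsNormalizedSolution.eq_add_volterra [CompleteSpace E] {v : E}
    (h : IsNormalizedSolution A D z v X) (hD : D * D = D) (hA : Continuous A)
    (hi : Integrable A) (hz : 0 ≤ z.im) (hv : D v = 0) (x : ℝ) :
    X x = v + volterra A D z X x := by
  have hDD : ∀ v, D (D v) = D v := fun v => congrArg (fun T : E →L[ℂ] E => T v) hD
  have hX := h.continuous
  obtain ⟨c, hc⟩ := h.bound x
  have h1 := integral_Iic_of_hasDerivAt_of_tendsto' (a := x) (f := fun y => (1 - D) (X y))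
    (f' := fun y => (1 - D) (A y (X y))) (m := (1 - D) v)
    (fun y _ => by
      have := ((1 - D).restrictScalars ℝ).hasFDerivAt.comp_hasDerivAt y (h.hasDerivAt y)
      refine HasDerivAt.congr_deriv this ?_
      change (1 - D) (A y (X y) + (2 * Complex.I * z) • D (X y)) = _
      simp [hDD])
    (integrableOn_sub_apply hA hi hX hc) (((1 - D).continuous.tendsto v).comp h.tendsto)
  have h2 := integral_Iic_of_hasDerivAt_of_tendsto' (a := x)
    (f := fun y : ℝ => Complex.exp (-(2 * Complex.I * z * y)) • D (X y))
    (f' := fun y : ℝ => Complex.exp (-(2 * Complex.I * z * y)) • D (A y (X y))) (m := 0)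
    (fun y _ => by
      have h3 := (D.restrictScalars ℝ).hasFDerivAt.comp_hasDerivAt y (h.hasDerivAt y)
      have h4 : HasDerivAt (fun x : ℝ => Complex.exp (-(2 * Complex.I * z * x)))
          (Complex.exp (-(2 * Complex.I * z * y)) * (-(2 * Complex.I * z))) y := by
        have := ((((hasDerivAt_id y).ofReal_comp).const_mul (2 * Complex.I * z)).neg).cexp
        simpa using this
      refine HasDerivAt.congr_deriv (h4.smul h3) ?_
      change _ • D (A y (X y) + (2 * Complex.I * z) • D (X y)) + _ • D (X y) = _
      simp [hDD, smul_smul])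
    (integrableOn_cexp_smul hA hi hz hX hc) (by
      have h5 : Tendsto (fun y => D (X y)) atBot (𝓝 0) := by
        simpa [hv, Function.comp_def] using (D.continuous.tendsto v).comp h.tendsto
      refine squeeze_zero_norm' ?_ (by simpa using h5.norm)
      filter_upwards [eventually_le_atBot 0] with y hy
      rw [norm_smul]
      refine mul_le_of_le_one_left (norm_nonneg _) ?_
      have := norm_cexp_two_mul_le_one hz (neg_nonneg.2 hy)
      simpa using this)
  rw [volterra_eq hA hi hz hX hc, h1, h2, sub_zero, smul_smul, ← Complex.exp_add]
  simp only [sub_apply, one_apply_eq_self, hv, add_neg_cancel,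
    Complex.exp_zero, one_smul]
  abel

theorem IsNormalizedSolution.unique [CompleteSpace E] {v : E} {Y : ℝ → E}
    (h : IsNormalizedSolution A D z v X) (h' : IsNormalizedSolution A D z v Y)
    (hD : D * D = D) (hA : Continuous A) (hi : Integrable A) (hz : 0 ≤ z.im) : X = Y := by
  have h0 : IsNormalizedSolution A D z 0 (fun x => X x - Y x) :=
    ⟨fun x => by
      refine HasDerivAt.congr_deriv ((h.hasDerivAt x).sub (h'.hasDerivAt x)) ?_
      simp only [map_sub, smul_sub]
      abel, by simpa using h.tendsto.sub h'.tendsto⟩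
  funext x
  obtain ⟨c, hc⟩ := h0.bound x
  have := norm_le_of_sub_volterra_le (D := D) (c := 0) hA hi hz hc (fun y _ => by
    rw [h0.eq_add_volterra hD hA hi hz (map_zero D) y]
    simp)
  rw [mul_zero, zero_mul, norm_le_zero_iff] at this
  exact sub_eq_zero.1 this

/-! ### Dependence of the normalized solution on the spectral parameter. -/

theorem norm_cexp_sub_le {c : ℝ} (hc : 0 < c) {z w : ℂ} (hz : c ≤ z.im) (hw : c ≤ w.im)
    {t : ℝ} (ht : 0 ≤ t) :
    ‖Complex.exp (2 * Complex.I * z * t) - Complex.exp (2 * Complex.I * w * t)‖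
      ≤ c⁻¹ * ‖z - w‖ := by
  have hconv : Convex ℝ {u : ℂ | c ≤ u.im} := convex_halfSpace_im_ge c
  refine hconv.norm_image_sub_le_of_norm_hasDerivWithin_le
    (f := fun u : ℂ => Complex.exp (2 * Complex.I * u * t))
    (f' := fun u : ℂ => Complex.exp (2 * Complex.I * u * t) * (2 * Complex.I * t))
    (fun u _ => ?_) (fun u hu => ?_) hw hz
  · have := ((((hasDerivAt_id u).const_mul (2 * Complex.I)).mul_const (t : ℂ)).cexp)
    simpa using this.hasDerivWithinAt
  · rw [norm_mul, norm_cexp_two_mul]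
    have h1 : ‖(2 * Complex.I * t : ℂ)‖ = 2 * t := by simp [abs_of_nonneg ht]
    rw [h1]
    have h2 : Real.exp (-2 * u.im * t) ≤ Real.exp (-(2 * c * t)) := by
      gcongr
      have : c * t ≤ u.im * t := mul_le_mul_of_nonneg_right hu ht
      linarith
    -- The factor `2 * t` from the derivative in `u` is absorbed by the decay of the exponential;
    -- this gives a Lipschitz constant uniform in `t ≥ 0`.
    have h3 : 2 * c * t ≤ Real.exp (2 * c * t) := by
      linarith [Real.add_one_le_exp (2 * c * t)]
    calc Real.exp (-2 * u.im * t) * (2 * t)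
        ≤ Real.exp (-(2 * c * t)) * (c⁻¹ * Real.exp (2 * c * t)) := by
          refine mul_le_mul h2 ?_ (by positivity) (Real.exp_pos _).le
          rw [inv_mul_eq_div, le_div_iff₀ hc]
          linarith
      _ = c⁻¹ := by
          rw [mul_left_comm, ← Real.exp_add, neg_add_cancel, Real.exp_zero, mul_one]

theorem norm_volterra_sub_le (hA : Continuous A) (hi : Integrable A) {c : ℝ} (hc : 0 < c) {z w : ℂ}
    (hz : c ≤ z.im) (hw : c ≤ w.im) (hX : Continuous X) {x b : ℝ} (hb : ∀ y ≤ x, ‖X y‖ ≤ b) :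
    ‖volterra A D z X x - volterra A D w X x‖
      ≤ c⁻¹ * ‖z - w‖ * (‖D‖ * b * ∫ y, ‖A y‖) := by
  have hb0 : 0 ≤ b := (norm_nonneg _).trans (hb x le_rfl)
  rw [volterra, volterra, ← integral_sub (integrableOn_green hA hi (hc.le.trans hz) hX hb)
    (integrableOn_green hA hi (hc.le.trans hw) hX hb)]
  have h1 : ‖∫ y in Iic x, (green D z (x - y) (A y (X y)) - green D w (x - y) (A y (X y)))‖
      ≤ ∫ y in Iic x, c⁻¹ * ‖z - w‖ * (‖D‖ * b) * ‖A y‖ := by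
    refine norm_integral_le_of_norm_le (hi.norm.const_mul _).integrableOn ?_
    filter_upwards [ae_restrict_mem measurableSet_Iic] with y hy
    have h2 := norm_cexp_sub_le hc hz hw (sub_nonneg.2 (mem_Iic.1 hy))
    have h3 := D.le_opNorm (A y (X y))
    have h4 := (A y).le_opNorm (X y)
    have h5 := hb y hy
    rw [show green D z (x - y) (A y (X y)) - green D w (x - y) (A y (X y))
      = (Complex.exp (2 * Complex.I * z * (x - y : ℝ))
        - Complex.exp (2 * Complex.I * w * (x - y : ℝ))) • D (A y (X y)) by
      simp [green, sub_smul], norm_smul]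
    calc _ ≤ c⁻¹ * ‖z - w‖ * (‖D‖ * (‖A y‖ * b)) := by
          gcongr
          exact h3.trans (by gcongr; exact h4.trans (by gcongr))
      _ = _ := by ring
  refine h1.trans ?_
  rw [integral_const_mul]
  have h6 : ∫ y in Iic x, ‖A y‖ ≤ ∫ y, ‖A y‖ :=
    setIntegral_le_integral hi.norm (Eventually.of_forall fun y => norm_nonneg _)
  calc _ ≤ c⁻¹ * ‖z - w‖ * (‖D‖ * b) * ∫ y, ‖A y‖ := by gcongr
    _ = _ := by ring

/-- The difference `X z - X w` satisfies the homogeneous Volterra equation at `z` up to the defect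
obtained by applying the difference of the two operators to `X w`. The defect is of order `‖z - w‖`,
and stability passes this on to the difference itself. -/
theorem continuousAt_normalizedSolution [CompleteSpace E] (hD : D * D = D) (hA : Continuous A)
    (hi : Integrable A) {v : E} (hv : D v = 0) {X : ℂ → ℝ → E}
    (hX : ∀ z : ℂ, 0 < z.im → IsNormalizedSolution A D z v (X z)) {w : ℂ} (hw : 0 < w.im) (x : ℝ) :
    ContinuousAt (fun z => X z x) w := by
  obtain ⟨b, hb⟩ := (hX w hw).bound x
  -- Half the height of `w` leaves room for a neighbourhood of `w` on which `c` is a common lower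
  -- bound for the imaginary parts.
  set c := w.im / 2 with hcdef
  have hc : 0 < c := by positivity
  set M := ‖D‖ * b * ∫ y, ‖A y‖
  set W := weight (kernelBound A D) x
  have key : ∀ z : ℂ, c ≤ z.im → ‖X z x - X w x‖ ≤ 2 * (c⁻¹ * ‖z - w‖ * M) * W := by
    intro z hz
    have hz0 : 0 < z.im := hc.trans_le hz
    obtain ⟨b', hb'⟩ := (hX z hz0).bound x
    refine norm_le_of_sub_volterra_le (X := fun y => X z y - X w y) (z := z) (b := b' + b)
      hA hi hz0.le (fun y hy => (norm_sub_le _ _).trans (add_le_add (hb' y hy) (hb y hy)))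
      (fun y hy => ?_)
    have h1 := volterra_sub (D := D) hA hi hz0.le (hX z hz0).continuous (hX w hw).continuous
      (fun t (ht : t ≤ y) => hb' t (ht.trans hy)) (fun t ht => hb t (ht.trans hy))
    have h2 := (hX z hz0).eq_add_volterra hD hA hi hz0.le hv y
    have h3 := (hX w hw).eq_add_volterra hD hA hi hw.le hv y
    have h4 := norm_volterra_sub_le (D := D) hA hi hc hz (w := w) (by linarith)
      (hX w hw).continuous (fun t ht => hb t (ht.trans hy))
    rw [h1]
    convert h4 using 2
    conv_lhs => rw [h2, h3]
    abel
  rw [ContinuousAt, tendsto_iff_norm_sub_tendsto_zero]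
  have hlim : Tendsto (fun z : ℂ => 2 * (c⁻¹ * ‖z - w‖ * M) * W) (𝓝 w) (𝓝 0) := by
    have : Continuous fun z : ℂ => 2 * (c⁻¹ * ‖z - w‖ * M) * W := by fun_prop
    simpa using this.tendsto w
  refine squeeze_zero' (Eventually.of_forall fun _ => norm_nonneg _) ?_ hlim
  have hopen : ∀ᶠ z : ℂ in 𝓝 w, c < z.im :=
    Complex.continuous_im.continuousAt.eventually (lt_mem_nhds (by linarith : c < w.im))
  filter_upwards [hopen] with z hz using key z hz.le

end Volterra

/-! ### Existence, uniqueness and regularity of the Jost solutions -/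

section Jost

open MeasureTheory Set Filter Topology

/-- Continuous and absolutely integrable potentials. -/
structure IsL1Potential {r : ℕ} (Q : ℝ → BMat r) : Prop where
  continuous : Continuous Q
  integrable : ∀ i j, Integrable (fun x => Q x i j)

theorem IsPotential.isL1Potential {r : ℕ} {Q : ℝ → BMat r} (h : IsPotential Q) :
    IsL1Potential Q := ⟨h.continuous, h.integrable⟩

/-- The half-plane in which the half of the Jost solution with asymptotics `e^{-isλx}` along `l`
exists. -/
def Admissible (l : Filter ℝ) (s z : ℂ) : Prop :=
  (s = 1 ∨ s = -1) ∧ (l = atBot ∧ 0 ≤ (s * z).im ∨ l = atTop ∧ (s * z).im ≤ 0)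

variable {r : ℕ} {Q : ℝ → BMat r} {l : Filter ℝ} {s z : ℂ}

theorem Admissible.mul_self (h : Admissible l s z) : s * s = 1 := by
  rcases h.1 with rfl | rfl <;> norm_num

theorem Admissible.neBot (h : Admissible l s z) : l.NeBot := by
  rcases h.2 with ⟨rfl, _⟩ | ⟨rfl, _⟩ <;> infer_instance

theorem Admissible.neg_neg (h : Admissible l s z) : Admissible l (-s) (-z) := by
  refine ⟨?_, by simpa using h.2⟩
  rcases h.1 with rfl | rfl <;> simp

theorem J_mul_J (r : ℕ) : J r * J r = 1 := by
  simp [J, Matrix.fromBlocks_multiply]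

theorem J_transpose (r : ℕ) : (J r)ᵀ = J r := by
  simp [J, Matrix.fromBlocks_transpose]

/-- Multiplication of a vector by a matrix. -/
def mulVecCLM (r : ℕ) : BMat r →L[ℂ] (Fin r ⊕ Fin r → ℂ) →L[ℂ] (Fin r ⊕ Fin r → ℂ) :=
  LinearMap.toContinuousLinearMap
    (LinearMap.toContinuousLinearMap.toLinearMap ∘ₗ
      LinearMap.mk₂ ℂ (fun (M : BMat r) (v : Fin r ⊕ Fin r → ℂ) => M *ᵥ v) Matrix.add_mulVec
        (fun c M v => Matrix.smul_mulVec c M v) Matrix.mulVec_add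
        (fun c M v => Matrix.mulVec_smul M c v))

@[simp]
theorem mulVecCLM_apply (M : BMat r) (v : Fin r ⊕ Fin r → ℂ) : mulVecCLM r M v = M *ᵥ v := rfl

/-- The coefficient `i Q` as an operator. -/
def potentialOp (Q : ℝ → BMat r) (x : ℝ) : (Fin r ⊕ Fin r → ℂ) →L[ℂ] (Fin r ⊕ Fin r → ℂ) :=
  mulVecCLM r (Complex.I • Q x)

/-- The projection `(1 - s J) / 2` as an operator. -/
def projOp (r : ℕ) (s : ℂ) : (Fin r ⊕ Fin r → ℂ) →L[ℂ] (Fin r ⊕ Fin r → ℂ) :=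
  mulVecCLM r ((1 / 2 : ℂ) • (1 - s • J r))

theorem projOp_apply (v : Fin r ⊕ Fin r → ℂ) :
    projOp r s v = (1 / 2 : ℂ) • (v - s • (J r *ᵥ v)) := by
  rw [projOp, mulVecCLM_apply, Matrix.smul_mulVec, Matrix.sub_mulVec, Matrix.one_mulVec,
    Matrix.smul_mulVec]

theorem projOp_mul_self (hs : s * s = 1) : projOp r s * projOp r s = projOp r s := by
  ext1 v
  change projOp r s (projOp r s v) = projOp r s v
  simp only [projOp_apply, Matrix.mulVec_sub, Matrix.mulVec_smul, Matrix.mulVec_mulVec, J_mul_J,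
    Matrix.one_mulVec, smul_sub, smul_smul]
  rw [show 1 / 2 * (s * (1 / 2 * s)) = 1 / 2 * (1 / 2) * (s * s) by ring, hs]
  module

theorem continuous_potentialOp (hQ : IsL1Potential Q) : Continuous (potentialOp Q) :=
  (mulVecCLM r).continuous.comp (hQ.continuous.const_smul Complex.I)

theorem mulVecCLM_eq_sum (M : BMat r) :
    mulVecCLM r M = ∑ i, ∑ j, M i j • mulVecCLM r (Matrix.single i j 1) := by
  conv_lhs => rw [Matrix.matrix_eq_sum_single M]
  simp only [map_sum, ← map_smul, Matrix.smul_single, smul_eq_mul, mul_one]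

theorem integrable_sum_smul {ι F : Type*} [Fintype ι] [NormedAddCommGroup F] [NormedSpace ℂ F]
    {f : ι → ι → ℝ → ℂ} (hf : ∀ i j, Integrable (f i j)) (T : ι → ι → F) :
    Integrable fun x => ∑ i, ∑ j, f i j x • T i j :=
  integrable_finsetSum _ fun i _ => integrable_finsetSum _ fun j _ => (hf i j).smul_const _

theorem integrable_potentialOp (hQ : IsL1Potential Q) : Integrable (potentialOp Q) :=
  (integrable_sum_smul (fun i j => (hQ.integrable i j).const_mul Complex.I)
    fun i j => mulVecCLM r (Matrix.single i j 1)).congr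
    (Eventually.of_forall fun x => (mulVecCLM_eq_sum (Complex.I • Q x)).symm)

theorem hasDerivAt_cexp_smul {Y : ℝ → Fin r ⊕ Fin r → ℂ} {c : ℂ} {Y' : Fin r ⊕ Fin r → ℂ} {x : ℝ}
    (h : HasDerivAt Y Y' x) :
    HasDerivAt (fun x : ℝ => Complex.exp (c * x) • Y x)
      (Complex.exp (c * x) • (Y' + c • Y x)) x := by
  have h1 : HasDerivAt (fun x : ℝ => Complex.exp (c * x)) (Complex.exp (c * x) * c) x := by
    have := (((hasDerivAt_id x).ofReal_comp).const_mul c).cexp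
    simpa using this
  refine HasDerivAt.congr_deriv (h1.smul h) ?_
  rw [smul_add, smul_smul]

/-- Removing the exponential adds `isλ` to the coefficient `iQ - iλJ`. As `s² = 1`, the constant
part `isλ - iλJ` equals `2i(sλ)` times the projection `(1 - sJ) / 2`, which is the form treated by
the Volterra equation with parameter `sλ`. -/
theorem IsJostCols.isNormalizedSolution {E : Cols r} {Y : ℝ → Cols r} (hs : s * s = 1)
    (h : IsJostCols Q atBot s E z Y) (j : Fin r) :
    IsNormalizedSolution (potentialOp Q) (projOp r s) (s * z) (fun i => E i j)
      (fun x : ℝ => Complex.exp (Complex.I * s * z * x) • fun i => Y x i j) := by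
  refine ⟨fun x => ?_, ?_⟩
  · refine HasDerivAt.congr_deriv (hasDerivAt_cexp_smul (hasDerivAt_pi.2 fun i => h.1 x i j)) ?_
    change _ • (Complex.I • (laxU Q z x *ᵥ fun i => Y x i j) + _) = _
    rw [potentialOp, map_smul (mulVecCLM r _), map_smul (projOp r s), projOp_apply]
    simp only [mulVecCLM_apply, laxU, Matrix.sub_mulVec, Matrix.smul_mulVec]
    simp only [smul_comm _ (Complex.exp (Complex.I * s * z * x)), ← smul_add]
    congr 1
    rw [show Complex.I * s * z = (2 * Complex.I * (s * z)) * (1 / 2) by ring]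
    simp only [smul_sub, smul_smul]
    rw [show 2 * Complex.I * (s * z) * (1 / 2 * s) = (s * s) * (Complex.I * z) by ring, hs,
      one_mul]
    abel
  · exact tendsto_pi_nhds.2 fun i => tendsto_pi_nhds.1 (tendsto_pi_nhds.1 h.2 i) j

theorem IsNormalizedSolution.isJostCols {E : Cols r} {X : Fin r → ℝ → Fin r ⊕ Fin r → ℂ}
    (hs : s * s = 1)
    (h : ∀ j, IsNormalizedSolution (potentialOp Q) (projOp r s) (s * z) (fun i => E i j) (X j)) :
    IsJostCols Q atBot s E z
      (fun x : ℝ => Matrix.of fun i j => Complex.exp (-(Complex.I * s * z) * x) * X j x i) := by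
  refine ⟨fun x i j => ?_, ?_⟩
  · refine HasDerivAt.congr_deriv
      (hasDerivAt_pi.1 (hasDerivAt_cexp_smul (c := -(Complex.I * s * z))
        ((h j).hasDerivAt x)) i) ?_
    change _ = (Complex.I • (laxU Q z x *ᵥ
      (Complex.exp (-(Complex.I * s * z) * x) • X j x))) i
    refine congrFun ?_ i
    rw [Matrix.mulVec_smul, smul_comm Complex.I]
    simp only [potentialOp, mulVecCLM_apply, projOp_apply, laxU, Matrix.sub_mulVec,
      Matrix.smul_mulVec]
    congr 1
    rw [show -(Complex.I * s * z) = -((2 * Complex.I * (s * z)) * (1 / 2)) by ring]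
    simp only [smul_sub, smul_smul]
    rw [show 2 * Complex.I * (s * z) * (1 / 2 * s) = (s * s) * (Complex.I * z) by ring, hs,
      one_mul, neg_smul]
    abel
  · refine tendsto_pi_nhds.2 fun i => tendsto_pi_nhds.2 fun j => ?_
    refine (tendsto_pi_nhds.1 (h j).tendsto i).congr fun x => ?_
    change _ = Complex.exp _ * (Complex.exp _ * X j x i)
    rw [← mul_assoc, ← Complex.exp_add]
    simp

/-- The reflection `x ↦ -x`. -/
theorem IsJostCols.reflect {E : Cols r} {Y : ℝ → Cols r} (h : IsJostCols Q l s E z Y) :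
    IsJostCols (fun x => -Q (-x)) (l.map Neg.neg) s E (-z) (fun x => Y (-x)) := by
  refine ⟨fun x i j => ?_, ?_⟩
  · have := (h.1 (-x) i j).scomp x (hasDerivAt_neg x)
    refine HasDerivAt.congr_deriv this ?_
    rw [show laxU (fun x => -Q (-x)) (-z) x = -laxU Q z (-x) by
      simp only [laxU, neg_smul]; abel, Matrix.neg_mul, smul_neg, neg_smul, one_smul]
    rfl
  · rw [tendsto_map'_iff]
    refine h.2.congr fun x => ?_
    simp

theorem IsJostCols.reflect_atTop {E : Cols r} {Y : ℝ → Cols r} (h : IsJostCols Q atTop s E z Y) :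
    IsJostCols (fun x => -Q (-x)) atBot s E (-z) (fun x => Y (-x)) := by
  have := h.reflect
  rwa [map_neg_atTop] at this

theorem IsL1Potential.reflect (hQ : IsL1Potential Q) : IsL1Potential fun x => -Q (-x) :=
  ⟨(hQ.continuous.comp continuous_neg).neg, fun i j => (hQ.integrable i j).comp_neg.neg⟩

theorem projOp_apply_col (hs : s * s = 1) {E : Cols r} (hE : J r * E = s • E) (j : Fin r) :
    projOp r s (fun i => E i j) = 0 := by
  have h : J r *ᵥ (fun i => E i j) = s • fun i => E i j :=
    funext fun i => congrFun (congrFun hE i) j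
  rw [projOp_apply, h, smul_smul, hs, one_smul, sub_self, smul_zero]

/-- The columns of `E` are eigenvectors of `J` for `s`, so the projection `(1 - sJ) / 2` kills them,
as the Volterra theory requires. The end `+∞` is reduced to `-∞` by reflecting the line. -/
theorem exists_isJostCols (hQ : IsL1Potential Q) (ha : Admissible l s z) {E : Cols r}
    (hE : J r * E = s • E) : ∃ Y, IsJostCols Q l s E z Y := by
  have hs := ha.mul_self
  have hv := projOp_apply_col hs hE
  rcases ha.2 with ⟨rfl, hz⟩ | ⟨rfl, hz⟩
  · choose X hX using fun j => exists_isNormalizedSolution (projOp_mul_self hs)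
      (continuous_potentialOp hQ) (integrable_potentialOp hQ) hz (hv j)
    exact ⟨_, IsNormalizedSolution.isJostCols hs hX⟩
  · choose X hX using fun j => exists_isNormalizedSolution (z := s * -z) (projOp_mul_self hs)
      (continuous_potentialOp hQ.reflect) (integrable_potentialOp hQ.reflect)
      (by rw [mul_neg, Complex.neg_im]; linarith) (hv j)
    have := (IsNormalizedSolution.isJostCols hs hX).reflect
    rw [map_neg_atBot] at this
    simp only [neg_neg] at this
    exact ⟨_, this⟩

theorem IsJostCols.unique (hQ : IsL1Potential Q) (ha : Admissible l s z) {E : Cols r}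
    {Y Y' : ℝ → Cols r} (h : IsJostCols Q l s E z Y) (h' : IsJostCols Q l s E z Y') : Y = Y' := by
  have hs := ha.mul_self
  have key : ∀ {Q : ℝ → BMat r} {z : ℂ} {Y Y' : ℝ → Cols r}, IsL1Potential Q → 0 ≤ (s * z).im →
      IsJostCols Q atBot s E z Y → IsJostCols Q atBot s E z Y' → Y = Y' := by
    intro Q z Y Y' hQ hz h h'
    funext x
    ext i j
    have := (h.isNormalizedSolution hs j).unique (h'.isNormalizedSolution hs j)
      (projOp_mul_self hs) (continuous_potentialOp hQ) (integrable_potentialOp hQ) hz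
    exact mul_left_cancel₀ (Complex.exp_ne_zero _) (congrFun (congrFun this x) i)
  rcases ha.2 with ⟨rfl, hz⟩ | ⟨rfl, hz⟩
  · exact key hQ hz h h'
  · have := key hQ.reflect (by rw [mul_neg, Complex.neg_im]; linarith) h.reflect_atTop h'.reflect_atTop
    funext x
    simpa using congrFun this (-x)

theorem jostCols_spec (hQ : IsL1Potential Q) (ha : Admissible l s z) {E : Cols r}
    (hE : J r * E = s • E) : IsJostCols Q l s E z (jostCols Q l s E z) := by
  have h := exists_isJostCols hQ ha hE
  rw [jostCols, dif_pos h]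
  exact h.choose_spec

theorem IsJostCols.jostCols_eq (hQ : IsL1Potential Q) (ha : Admissible l s z) {E : Cols r}
    {Y : ℝ → Cols r} (h : IsJostCols Q l s E z Y) : jostCols Q l s E z = Y := by
  have h' : ∃ Y, IsJostCols Q l s E z Y := ⟨Y, h⟩
  rw [jostCols, dif_pos h']
  exact h'.choose_spec.unique hQ ha h

/-! Rows are transposed columns for `-Qᵀ`. -/

theorem laxU_neg_transpose (x : ℝ) :
    laxU (fun x => -(Q x)ᵀ) (-z) x = -(laxU Q z x)ᵀ := by
  simp only [laxU, Matrix.transpose_sub, Matrix.transpose_smul, J_transpose, neg_smul]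
  abel

theorem isJostRows_iff {E : Rows r} {Z : ℝ → Rows r} :
    IsJostRows Q l s E z Z ↔
      IsJostCols (fun x => -(Q x)ᵀ) l s Eᵀ (-z) (fun x => (Z x)ᵀ) := by
  refine and_congr ?_ ?_
  · refine forall_congr' fun x => ?_
    rw [forall_comm]
    refine forall_congr' fun i => forall_congr' fun j => ?_
    rw [laxU_neg_transpose, Matrix.neg_mul, ← Matrix.transpose_mul, smul_neg, ← neg_smul]
    rfl
  · rw [show (fun x : ℝ => Complex.exp (Complex.I * s * -z * x) • (Z x)ᵀ)
      = fun x : ℝ => (Complex.exp (-(Complex.I * s * z * x)) • Z x)ᵀ by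
        funext x; rw [Matrix.transpose_smul]; congr 2; ring]
    constructor
    · exact fun h => (continuous_id.matrix_transpose.tendsto E).comp h
    · intro h
      have := (continuous_id.matrix_transpose.tendsto Eᵀ).comp h
      simpa [Function.comp_def] using this

theorem IsL1Potential.neg_transpose (hQ : IsL1Potential Q) : IsL1Potential fun x => -(Q x)ᵀ :=
  ⟨hQ.continuous.matrix_transpose.neg, fun i j => (hQ.integrable j i).neg⟩

theorem IsJostRows.jostRows_eq (hQ : IsL1Potential Q) (ha : Admissible l s (-z)) {E : Rows r}
    {Z : ℝ → Rows r} (h : IsJostRows Q l s E z Z) : jostRows Q l s E z = Z := by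
  have h' : ∃ Y, IsJostRows Q l s E z Y := ⟨Z, h⟩
  rw [jostRows, dif_pos h']
  have := (isJostRows_iff.1 h'.choose_spec).unique hQ.neg_transpose ha (isJostRows_iff.1 h)
  funext x
  exact Matrix.transpose_injective (congrFun this x)

theorem jostRows_spec (hQ : IsL1Potential Q) (ha : Admissible l s (-z)) {E : Rows r}
    (hE : E * J r = s • E) : IsJostRows Q l s E z (jostRows Q l s E z) := by
  have h : ∃ Z, IsJostRows Q l s E z Z := by
    obtain ⟨Y, hY⟩ := exists_isJostCols (E := Eᵀ) hQ.neg_transpose ha (by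
      rw [← J_transpose, ← Matrix.transpose_mul, hE, Matrix.transpose_smul])
    exact ⟨fun x => (Y x)ᵀ, isJostRows_iff.2 hY⟩
  rw [jostRows, dif_pos h]
  exact h.choose_spec

/-! ### Nondegeneracy -/

/-- The coefficient is bounded only on compact intervals, so uniqueness for Lipschitz equations is
applied on a bounded interval containing both `x₀` and the point in question. -/
theorem eq_zero_of_hasDerivAt_linear {E : Type*} [NormedAddCommGroup E] [NormedSpace ℂ E]
    {B : ℝ → E →L[ℂ] E} (hB : Continuous B) {f : ℝ → E} (hf : ∀ x, HasDerivAt f (B x (f x)) x)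
    {x₀ : ℝ} (h0 : f x₀ = 0) : f = 0 := by
  funext x
  obtain ⟨a, b, hx, hx₀⟩ : ∃ a b, x ∈ Ioo a b ∧ x₀ ∈ Ioo a b :=
    ⟨min x x₀ - 1, max x x₀ + 1, by grind, by grind⟩
  obtain ⟨K, hK⟩ := (isCompact_Icc (a := a) (b := b)).exists_bound_of_continuousOn hB.continuousOn
  have := ODE_solution_unique_of_mem_Ioo (v := fun t y => B t y) (s := fun _ => univ)
    (K := K.toNNReal) (f := f) (g := fun _ => 0)
    (fun t ht => by
      refine (LipschitzWith.weaken (B t).lipschitz ?_).lipschitzOnWith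
      rw [← NNReal.coe_le_coe, coe_nnnorm]
      exact (hK t (Ioo_subset_Icc_self ht)).trans (Real.le_coe_toNNReal K)) hx₀
    (fun t _ => ⟨hf t, mem_univ _⟩)
    (fun t _ => ⟨by simpa using hasDerivAt_const t (0 : E), mem_univ _⟩) h0
  exact this hx

/-- A combination of columns that vanishes at one point vanishes identically, hence so does its
normalized limit. This makes the Jost columns linearly independent at every `x`, also at
eigenvalues. -/
theorem IsJostCols.mulVec_eq_zero (hQ : IsL1Potential Q) [l.NeBot] {E : Cols r} {Y : ℝ → Cols r}
    (h : IsJostCols Q l s E z Y) {x : ℝ} {v : Fin r → ℂ} (hv : Y x *ᵥ v = 0) : E *ᵥ v = 0 := by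
  have hf : (fun x => Y x *ᵥ v) = 0 := by
    refine eq_zero_of_hasDerivAt_linear
      (B := fun x => mulVecCLM r (Complex.I • laxU Q z x)) ?_ (fun y => ?_) hv
    · have : Continuous fun x => Complex.I • laxU Q z x :=
        (hQ.continuous.sub (continuous_const (y := z • J r))).const_smul Complex.I
      exact (mulVecCLM r).continuous.comp this
    · rw [hasDerivAt_pi]
      intro i
      rw [mulVecCLM_apply, Matrix.mulVec_mulVec, Matrix.smul_mul]
      exact HasDerivAt.fun_sum (u := Finset.univ) fun j _ => (h.1 y i j).mul_const (v j)
  have h1 : Tendsto (fun x : ℝ => (Complex.exp (Complex.I * s * z * x) • Y x) *ᵥ v) l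
      (𝓝 (E *ᵥ v)) :=
    ((continuous_id.matrix_mulVec continuous_const).tendsto E).comp h.2
  refine tendsto_nhds_unique h1 ?_
  refine tendsto_const_nhds.congr fun x => ?_
  rw [Matrix.smul_mulVec, show Y x *ᵥ v = 0 from congrFun hf x, smul_zero]

/-! ### Pairings -/

/-- The equations for rows and columns carry opposite signs, so the derivative of the product
cancels. The two normalizations may refer to different ends of the line. -/
theorem IsJostRows.mul_eq {l' : Filter ℝ} {s' : ℂ} {E : Cols r} {E' : Rows r} {Y : ℝ → Cols r}
    {Z : ℝ → Rows r} (hZ : IsJostRows Q l' s' E' z Z) (hY : IsJostCols Q l s E z Y) (x y : ℝ) :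
    Z x * Y x = Z y * Y y := by
  ext i j
  refine is_const_of_deriv_eq_zero (f := fun x => (Z x * Y x) i j) ?_ ?_ x y
  all_goals
    have key : ∀ x, HasDerivAt (fun x => (Z x * Y x) i j) 0 x := by
      intro x
      have := HasDerivAt.fun_sum (u := Finset.univ)
        fun k (_ : k ∈ Finset.univ) => (hZ.1 x i k).mul (hY.1 x k j)
      refine HasDerivAt.congr_deriv this ?_
      rw [Finset.sum_add_distrib, ← Matrix.mul_apply, ← Matrix.mul_apply, ← Matrix.add_apply]
      rw [Matrix.smul_mul, Matrix.mul_smul, Matrix.mul_assoc, neg_smul, neg_add_cancel]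
      rfl
  · exact fun x => (key x).differentiableAt
  · exact fun x => (key x).deriv

theorem tendsto_matrix_mul {α l m n : Type*} [Fintype m] {F : Filter α} {f : α → Matrix l m ℂ}
    {g : α → Matrix m n ℂ} {A : Matrix l m ℂ} {B : Matrix m n ℂ} (hf : Tendsto f F (𝓝 A))
    (hg : Tendsto g F (𝓝 B)) : Tendsto (fun x => f x * g x) F (𝓝 (A * B)) := by
  refine tendsto_pi_nhds.2 fun i => tendsto_pi_nhds.2 fun j => tendsto_finsetSum _ fun k _ => ?_
  exact (tendsto_pi_nhds.1 (tendsto_pi_nhds.1 hf i) k).mul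
    (tendsto_pi_nhds.1 (tendsto_pi_nhds.1 hg k) j)

theorem IsJostRows.mul_eq_of_same {E : Cols r} {E' : Rows r} {Y : ℝ → Cols r}
    {Z : ℝ → Rows r} [l.NeBot] (hZ : IsJostRows Q l s E' z Z) (hY : IsJostCols Q l s E z Y)
    (x : ℝ) : Z x * Y x = E' * E := by
  have h1 : Tendsto (fun y : ℝ => (Complex.exp (-(Complex.I * s * z * y)) • Z y) *
      (Complex.exp (Complex.I * s * z * y) • Y y)) l (𝓝 (E' * E)) :=
    tendsto_matrix_mul hZ.2 hY.2
  refine tendsto_nhds_unique ?_ h1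
  refine tendsto_const_nhds.congr fun y => ?_
  rw [Matrix.smul_mul, Matrix.mul_smul, smul_smul, ← Complex.exp_add, neg_add_cancel,
    Complex.exp_zero, one_smul, hZ.mul_eq hY x y]

/-- The constant product equals the normalized product `P y`, which tends to `E' * E = 0`, times an
exponential of modulus at most `1` towards the end `l`. On the real axis the exponential does not
decay, and the limit of `P` alone does the work. -/
theorem IsJostRows.mul_eq_zero {E : Cols r} {E' : Rows r} {Y : ℝ → Cols r}
    {Z : ℝ → Rows r} (ha : Admissible l s z) (hE : E' * E = 0)
    (hZ : IsJostRows Q l (-s) E' z Z) (hY : IsJostCols Q l s E z Y)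
    (x : ℝ) : Z x * Y x = 0 := by
  have := ha.neBot
  set P : ℝ → Blk r := fun y => (Complex.exp (-(Complex.I * -s * z * y)) • Z y) *
      (Complex.exp (Complex.I * s * z * y) • Y y) with hP
  have h1 : Tendsto P l (𝓝 0) := by
    rw [← hE]
    exact tendsto_matrix_mul hZ.2 hY.2
  have h3 : ∀ᶠ y : ℝ in l, ‖Complex.exp (2 * Complex.I * (s * z) * (-y : ℝ))‖ ≤ 1 := by
    rcases ha.2 with ⟨rfl, hz⟩ | ⟨rfl, hz⟩
    · filter_upwards [eventually_le_atBot 0] with y hy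
      exact norm_cexp_two_mul_le_one hz (neg_nonneg.2 hy)
    · filter_upwards [eventually_ge_atTop 0] with y hy
      rw [norm_cexp_two_mul, Real.exp_le_one_iff]
      have := mul_nonpos_of_nonpos_of_nonneg hz hy
      linarith
  have h4 : ∀ y : ℝ, Z x * Y x = Complex.exp (2 * Complex.I * (s * z) * (-y : ℝ)) • P y := by
    intro y
    simp only [hP]
    rw [Matrix.smul_mul, Matrix.mul_smul, smul_smul, smul_smul, ← Complex.exp_add,
      ← Complex.exp_add, hZ.mul_eq hY x y]
    have : 2 * Complex.I * (s * z) * ((-y : ℝ) : ℂ) +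
        -(Complex.I * -s * z * y) + Complex.I * s * z * y = 0 := by
      push_cast
      ring
    rw [this, Complex.exp_zero, one_smul]
  ext i j
  have h5 : Tendsto (fun y => P y i j) l (𝓝 0) := tendsto_pi_nhds.1 (tendsto_pi_nhds.1 h1 i) j
  have h2 : ∀ᶠ y : ℝ in l, ‖(Z x * Y x) i j‖ ≤ ‖P y i j‖ := by
    filter_upwards [h3] with y hy
    rw [h4 y, Matrix.smul_apply, norm_smul]
    exact mul_le_of_le_one_left (norm_nonneg _) hy
  have h6 := le_of_tendsto_of_tendsto tendsto_const_nhds h5.norm h2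
  rwa [norm_zero, norm_le_zero_iff] at h6

/-! ### Continuity in the spectral parameter -/

theorem continuousAt_jostCols_atBot (hQ : IsL1Potential Q) (hs : s = 1 ∨ s = -1)
    {E : Cols r} (hE : J r * E = s • E) {w : ℂ} (hw : 0 < (s * w).im) (x : ℝ) :
    ContinuousAt (fun z => jostCols Q atBot s E z x) w := by
  have hss : s * s = 1 := by rcases hs with rfl | rfl <;> norm_num
  refine continuousAt_pi.2 fun i => continuousAt_pi.2 fun j => ?_
  have h := continuousAt_normalizedSolution (projOp_mul_self hss) (continuous_potentialOp hQ)
    (integrable_potentialOp hQ) (projOp_apply_col hss hE j)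
    -- The Volterra theory is parametrized by `s * z`, so the family is written in that variable; `s
    -- * s = 1` returns to the original parameter.
    (X := fun z x => Complex.exp (Complex.I * s * (s * z) * x) •
      fun i => jostCols Q atBot s E (s * z) x i j)
    (fun z hz => by
      have := (jostCols_spec (z := s * z) hQ ⟨hs, Or.inl ⟨rfl, by
        rw [← mul_assoc, hss, one_mul]; exact hz.le⟩⟩ hE).isNormalizedSolution hss j
      rwa [← mul_assoc s s z, hss, one_mul] at this) hw x
  have h1 : ContinuousAt (fun z : ℂ => s * z) w := by fun_prop
  have h2 := continuousAt_pi.1 (ContinuousAt.comp (x := w) (f := fun z : ℂ => s * z) h h1) i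
  have h3 : ContinuousAt (fun z : ℂ => Complex.exp (-(Complex.I * s * z * x))) w := by fun_prop
  refine (h3.mul h2).congr (Eventually.of_forall fun z => ?_)
  change Complex.exp _ * (Complex.exp (Complex.I * s * (s * (s * z)) * x) *
    jostCols Q atBot s E (s * (s * z)) x i j) = _
  rw [← mul_assoc s s z, hss, one_mul, ← mul_assoc, ← Complex.exp_add, neg_add_cancel,
    Complex.exp_zero, one_mul]

theorem continuousAt_jostCols_atTop (hQ : IsL1Potential Q) (hs : s = 1 ∨ s = -1)
    {E : Cols r} (hE : J r * E = s • E) {w : ℂ} (hw : (s * w).im < 0) (x : ℝ) :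
    ContinuousAt (fun z => jostCols Q atTop s E z x) w := by
  have h := continuousAt_jostCols_atBot hQ.reflect hs hE (w := -w) (by rw [mul_neg, Complex.neg_im]; linarith) (-x)
  have h1 := ContinuousAt.comp (x := w) (f := fun z : ℂ => -z) h continuousAt_neg
  refine h1.congr ?_
  have hopen : ∀ᶠ z : ℂ in 𝓝 w, (s * z).im < 0 := by
    have : ContinuousAt (fun z : ℂ => (s * z).im) w := by fun_prop
    exact this.eventually (gt_mem_nhds hw)
  filter_upwards [hopen] with z hz
  have h2 := (jostCols_spec hQ ⟨hs, Or.inr ⟨rfl, hz.le⟩⟩ hE).reflect_atTop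
  have h3 := h2.jostCols_eq hQ.reflect ⟨hs, Or.inl ⟨rfl, by rw [mul_neg, Complex.neg_im]; linarith⟩⟩
  simp only [Function.comp_apply, h3, neg_neg]

end Jost

/-! ### Relations between the Jost solutions and the scattering data -/

section Scattering

open Filter

variable {r : ℕ} {Q : ℝ → BMat r} {z : ℂ}

theorem admissible_atBot_one (hz : 0 ≤ z.im) : Admissible atBot 1 z :=
  ⟨Or.inl rfl, Or.inl ⟨rfl, by simpa using hz⟩⟩

theorem admissible_atBot_neg_one (hz : z.im ≤ 0) : Admissible atBot (-1) z :=
  ⟨Or.inr rfl, Or.inl ⟨rfl, by simpa using hz⟩⟩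

theorem admissible_atTop_one (hz : z.im ≤ 0) : Admissible atTop 1 z :=
  ⟨Or.inl rfl, Or.inr ⟨rfl, by simpa using hz⟩⟩

theorem admissible_atTop_neg_one (hz : 0 ≤ z.im) : Admissible atTop (-1) z :=
  ⟨Or.inr rfl, Or.inr ⟨rfl, by simpa using hz⟩⟩

theorem J_mul_fromRows_one_zero (r : ℕ) :
    J r * (Matrix.fromRows 1 0 : Cols r) = (1 : ℂ) • Matrix.fromRows 1 0 := by
  simp [J, Matrix.fromBlocks_mul_fromRows]

theorem J_mul_fromRows_zero_one (r : ℕ) :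
    J r * (Matrix.fromRows 0 1 : Cols r) = (-1 : ℂ) • Matrix.fromRows 0 1 := by
  simp [J, Matrix.fromBlocks_mul_fromRows, Matrix.fromRows_neg]

theorem fromCols_one_zero_mul_J (r : ℕ) :
    (Matrix.fromCols 1 0 : Rows r) * J r = (1 : ℂ) • Matrix.fromCols 1 0 := by
  simp [J, Matrix.fromCols_mul_fromBlocks]

theorem fromCols_zero_one_mul_J (r : ℕ) :
    (Matrix.fromCols 0 1 : Rows r) * J r = (-1 : ℂ) • Matrix.fromCols 0 1 := by
  simp [J, Matrix.fromCols_mul_fromBlocks, Matrix.fromCols_neg]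

section Specs

variable (hQ : IsL1Potential Q)
include hQ

theorem phiP_spec (hz : 0 ≤ z.im) :
    IsJostCols Q atBot 1 (Matrix.fromRows 1 0) z (phiP Q z) :=
  jostCols_spec hQ (admissible_atBot_one hz) (J_mul_fromRows_one_zero r)

theorem phiM_spec (hz : z.im ≤ 0) :
    IsJostCols Q atBot (-1) (Matrix.fromRows 0 1) z (phiM Q z) :=
  jostCols_spec hQ (admissible_atBot_neg_one hz) (J_mul_fromRows_zero_one r)

theorem psiM_spec (hz : z.im ≤ 0) :
    IsJostCols Q atTop 1 (Matrix.fromRows 1 0) z (psiM Q z) :=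
  jostCols_spec hQ (admissible_atTop_one hz) (J_mul_fromRows_one_zero r)

theorem psiP_spec (hz : 0 ≤ z.im) :
    IsJostCols Q atTop (-1) (Matrix.fromRows 0 1) z (psiP Q z) :=
  jostCols_spec hQ (admissible_atTop_neg_one hz) (J_mul_fromRows_zero_one r)

theorem phiInvM_spec (hz : z.im ≤ 0) :
    IsJostRows Q atBot 1 (Matrix.fromCols 1 0) z (phiInvM Q z) :=
  jostRows_spec hQ (admissible_atBot_one (by simpa using hz)) (fromCols_one_zero_mul_J r)

theorem phiInvP_spec (hz : 0 ≤ z.im) :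
    IsJostRows Q atBot (-1) (Matrix.fromCols 0 1) z (phiInvP Q z) :=
  jostRows_spec hQ (admissible_atBot_neg_one (by simpa using hz)) (fromCols_zero_one_mul_J r)

theorem psiInvP_spec (hz : 0 ≤ z.im) :
    IsJostRows Q atTop 1 (Matrix.fromCols 1 0) z (psiInvP Q z) :=
  jostRows_spec hQ (admissible_atTop_one (by simpa using hz)) (fromCols_one_zero_mul_J r)

theorem psiInvM_spec (hz : z.im ≤ 0) :
    IsJostRows Q atTop (-1) (Matrix.fromCols 0 1) z (psiInvM Q z) :=
  jostRows_spec hQ (admissible_atTop_neg_one (by simpa using hz)) (fromCols_zero_one_mul_J r)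

/-! Products of the halves. -/

theorem psiInvP_mul_psiP (hz : 0 ≤ z.im) (x : ℝ) : psiInvP Q z x * psiP Q z x = 0 :=
  IsJostRows.mul_eq_zero (E' := Matrix.fromCols 1 0) (E := Matrix.fromRows 0 1)
    (admissible_atTop_neg_one hz) (by simp [Matrix.fromCols_mul_fromRows])
    (by simpa using psiInvP_spec hQ hz) (psiP_spec hQ hz) x

theorem phiInvP_mul_phiP (hz : 0 ≤ z.im) (x : ℝ) : phiInvP Q z x * phiP Q z x = 0 :=
  IsJostRows.mul_eq_zero (admissible_atBot_one hz) (by simp [Matrix.fromCols_mul_fromRows])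
    (phiInvP_spec hQ hz) (phiP_spec hQ hz) x

theorem psiInvM_mul_psiM (hz : z.im ≤ 0) (x : ℝ) : psiInvM Q z x * psiM Q z x = 0 :=
  IsJostRows.mul_eq_zero (admissible_atTop_one hz) (by simp [Matrix.fromCols_mul_fromRows])
    (psiInvM_spec hQ hz) (psiM_spec hQ hz) x

theorem phiInvM_mul_phiM (hz : z.im ≤ 0) (x : ℝ) : phiInvM Q z x * phiM Q z x = 0 :=
  IsJostRows.mul_eq_zero (E' := Matrix.fromCols 1 0) (E := Matrix.fromRows 0 1)
    (admissible_atBot_neg_one hz) (by simp [Matrix.fromCols_mul_fromRows])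
    (by simpa using phiInvM_spec hQ hz) (phiM_spec hQ hz) x

theorem psiInvP_mul_psiM (hz : z.im = 0) (x : ℝ) : psiInvP Q z x * psiM Q z x = 1 := by
  rw [(psiInvP_spec hQ hz.ge).mul_eq_of_same (psiM_spec hQ hz.le) x]
  simp [Matrix.fromCols_mul_fromRows]

theorem psiInvM_mul_psiP (hz : z.im = 0) (x : ℝ) : psiInvM Q z x * psiP Q z x = 1 := by
  rw [(psiInvM_spec hQ hz.le).mul_eq_of_same (psiP_spec hQ hz.ge) x]
  simp [Matrix.fromCols_mul_fromRows]

theorem phiInvM_mul_phiP (hz : z.im = 0) (x : ℝ) : phiInvM Q z x * phiP Q z x = 1 := by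
  rw [(phiInvM_spec hQ hz.le).mul_eq_of_same (phiP_spec hQ hz.ge) x]
  simp [Matrix.fromCols_mul_fromRows]

theorem phiInvP_mul_phiM (hz : z.im = 0) (x : ℝ) : phiInvP Q z x * phiM Q z x = 1 := by
  rw [(phiInvP_spec hQ hz.ge).mul_eq_of_same (phiM_spec hQ hz.le) x]
  simp [Matrix.fromCols_mul_fromRows]

theorem aP_eq (hz : 0 ≤ z.im) (x : ℝ) : aP Q z = psiInvP Q z x * phiP Q z x :=
  (psiInvP_spec hQ hz).mul_eq (phiP_spec hQ hz) 0 x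

theorem cP_eq (hz : 0 ≤ z.im) (x : ℝ) : cP Q z = phiInvP Q z x * psiP Q z x :=
  (phiInvP_spec hQ hz).mul_eq (psiP_spec hQ hz) 0 x

theorem scatT_eq (hz : z.im = 0) (x : ℝ) :
    scatT Q z = Matrix.fromRows (psiInvP Q z x) (psiInvM Q z x) * phi Q z x := by
  rw [phi, Matrix.fromRows_mul_fromCols, scatT, aP, aM, bP, bM, neg_neg,
    (psiInvP_spec hQ hz.ge).mul_eq (phiP_spec hQ hz.ge) 0 x,
    (psiInvP_spec hQ hz.ge).mul_eq (phiM_spec hQ hz.le) 0 x,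
    (psiInvM_spec hQ hz.le).mul_eq (phiP_spec hQ hz.ge) 0 x,
    (psiInvM_spec hQ hz.le).mul_eq (phiM_spec hQ hz.le) 0 x]

/-- The row halves are defined by their own equations; this identifies them with the two halves of
the inverse of `ψ`. The products in the other order are known, and for square matrices a left
inverse is a right inverse. -/
theorem psi_mul_inv (hz : z.im = 0) (x : ℝ) :
    psi Q z x * Matrix.fromRows (psiInvP Q z x) (psiInvM Q z x) = 1 := by
  rw [mul_eq_one_comm, psi, Matrix.fromRows_mul_fromCols, psiInvP_mul_psiM hQ hz,
    psiInvP_mul_psiP hQ hz.ge, psiInvM_mul_psiM hQ hz.le, psiInvM_mul_psiP hQ hz,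
    Matrix.fromBlocks_one]

theorem phi_mul_inv (hz : z.im = 0) (x : ℝ) :
    phi Q z x * Matrix.fromRows (phiInvM Q z x) (phiInvP Q z x) = 1 := by
  rw [mul_eq_one_comm, phi, Matrix.fromRows_mul_fromCols, phiInvM_mul_phiP hQ hz,
    phiInvM_mul_phiM hQ hz.le, phiInvP_mul_phiP hQ hz.ge, phiInvP_mul_phiM hQ hz,
    Matrix.fromBlocks_one]

theorem phi_eq_psi_mul_scatT (hz : z.im = 0) (x : ℝ) :
    phi Q z x = psi Q z x * scatT Q z := by
  rw [scatT_eq hQ hz x, ← Matrix.mul_assoc, psi_mul_inv hQ hz, Matrix.one_mul]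

/-- The second factor is `φ̂ψ`, which inverts `T = ψ̂φ`. -/
theorem scatT_mul_inv (hz : z.im = 0) :
    scatT Q z * Matrix.fromBlocks (cM Q z) (dM Q z) (-dP Q z) (cP Q z) = 1 := by
  have h : Matrix.fromBlocks (cM Q z) (dM Q z) (-dP Q z) (cP Q z)
      = Matrix.fromRows (phiInvM Q z 0) (phiInvP Q z 0) * psi Q z 0 := by
    rw [psi, Matrix.fromRows_mul_fromCols, cM, dM, dP, cP, neg_neg]
  rw [h, scatT_eq hQ hz 0, Matrix.mul_assoc, ← Matrix.mul_assoc (phi Q z 0), phi_mul_inv hQ hz,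
    Matrix.one_mul, mul_eq_one_comm, psi_mul_inv hQ hz]

theorem scatT_inv (hz : z.im = 0) :
    (scatT Q z)⁻¹ = Matrix.fromBlocks (cM Q z) (dM Q z) (-dP Q z) (cP Q z) :=
  Matrix.inv_eq_right_inv (scatT_mul_inv hQ hz)

/-- The off-diagonal identities give `τ⁺ = d⁻ĉ⁺` and `τ⁻ = d⁺ĉ⁻` where the inverses exist. This
change of order is what transposing a Gauss factor requires. -/
theorem scatT_mul_inv_blocks (hz : z.im = 0) :
    aP Q z * cM Q z + bM Q z * dP Q z = 1 ∧ aP Q z * dM Q z = bM Q z * cP Q z ∧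
    bP Q z * cM Q z = aM Q z * dP Q z ∧ bP Q z * dM Q z + aM Q z * cP Q z = 1 := by
  have h := scatT_mul_inv hQ hz
  rw [scatT, Matrix.fromBlocks_multiply, ← Matrix.fromBlocks_one, Matrix.fromBlocks_inj] at h
  simp only [Matrix.neg_mul, Matrix.mul_neg, neg_neg, ← sub_eq_add_neg, sub_eq_zero] at h
  exact h

theorem scatT_inv_mul_blocks (hz : z.im = 0) :
    cM Q z * aP Q z + dM Q z * bP Q z = 1 ∧ dM Q z * aM Q z = cM Q z * bM Q z ∧
    cP Q z * bP Q z = dP Q z * aP Q z ∧ dP Q z * bM Q z + cP Q z * aM Q z = 1 := by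
  have h := scatT_mul_inv hQ hz
  rw [mul_eq_one_comm, scatT, Matrix.fromBlocks_multiply, ← Matrix.fromBlocks_one,
    Matrix.fromBlocks_inj] at h
  simp only [Matrix.neg_mul, Matrix.mul_neg, neg_neg, neg_add_eq_sub, sub_eq_zero] at h
  exact h

end Specs

/-! ### Degeneracy of `a` and `c` -/

/-- One inclusion is `R * K = 0`; equality is a dimension count, as both spaces have dimension `r`
in a space of dimension `2r`. -/
theorem range_eq_ker {R : Rows r} {K : Cols r} (hR : Function.Injective (Rᵀ *ᵥ ·))
    (hK : Function.Injective (K *ᵥ ·)) (h : R * K = 0) :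
    LinearMap.range K.mulVecLin = LinearMap.ker R.mulVecLin := by
  refine Submodule.eq_of_le_of_finrank_eq ?_ ?_
  · rintro _ ⟨v, rfl⟩
    simp [h]
  · have h1 : Module.finrank ℂ (LinearMap.range K.mulVecLin) = r := by
      rw [LinearMap.finrank_range_of_inj hK]
      simp
    have h2 : Module.finrank ℂ (LinearMap.range R.mulVecLin) = r := by
      have h3 : Module.finrank ℂ (LinearMap.range Rᵀ.mulVecLin) = r := by
        rw [LinearMap.finrank_range_of_inj hR]
        simp
      exact (Matrix.rank_transpose R).symm.trans h3
    have h4 := R.mulVecLin.finrank_range_add_finrank_ker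
    rw [h2, Module.finrank_pi, Fintype.card_sum, Fintype.card_fin] at h4
    omega

/-- If `R K v = 0`, then `K v` lies in the kernel of `R`, which is the range of `K'`. So `K v = K'
w` with `w ≠ 0`, and `R' K' w = R' K v = 0`. -/
theorem det_eq_zero_of_dual {R R' : Rows r} {K K' : Cols r}
    (hR : Function.Injective (Rᵀ *ᵥ ·)) (hK : Function.Injective (K *ᵥ ·))
    (hK' : Function.Injective (K' *ᵥ ·)) (h : R * K' = 0) (h' : R' * K = 0)
    (hdet : (R * K).det = 0) : (R' * K').det = 0 := by
  obtain ⟨v, hv, hRK⟩ := Matrix.exists_mulVec_eq_zero_iff.2 hdet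
  have hmem : K *ᵥ v ∈ LinearMap.range K'.mulVecLin := by
    rw [range_eq_ker hR hK' h, LinearMap.mem_ker]
    simpa using hRK
  obtain ⟨w, hw⟩ := hmem
  rw [Matrix.mulVecLin_apply] at hw
  refine Matrix.exists_mulVec_eq_zero_iff.1 ⟨w, ?_, ?_⟩
  · rintro rfl
    rw [Matrix.mulVec_zero] at hw
    exact hv (hK (by simpa using hw.symm))
  · rw [← Matrix.mulVec_mulVec, hw, Matrix.mulVec_mulVec, h', Matrix.zero_mulVec]

theorem IsJostCols.injective (hQ : IsL1Potential Q) {l : Filter ℝ} {s : ℂ} [l.NeBot] {E : Cols r}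
    {Y : ℝ → Cols r} (h : IsJostCols Q l s E z Y) (hE : ∀ v, E *ᵥ v = 0 → v = 0) (x : ℝ) :
    Function.Injective (Y x *ᵥ ·) := by
  intro v w hvw
  refine sub_eq_zero.1 (hE _ (h.mulVec_eq_zero hQ (x := x) ?_))
  rw [Matrix.mulVec_sub]
  exact sub_eq_zero.2 hvw

theorem IsJostRows.injective (hQ : IsL1Potential Q) {l : Filter ℝ} {s : ℂ} [l.NeBot] {E : Rows r}
    {Z : ℝ → Rows r} (h : IsJostRows Q l s E z Z) (hE : ∀ v, Eᵀ *ᵥ v = 0 → v = 0) (x : ℝ) :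
    Function.Injective ((Z x)ᵀ *ᵥ ·) :=
  (isJostRows_iff.1 h).injective hQ.neg_transpose hE x

theorem eq_zero_of_fromRows_one_zero_mulVec (v : Fin r → ℂ)
    (h : (Matrix.fromRows 1 0 : Cols r) *ᵥ v = 0) : v = 0 := by
  funext i
  simpa [Matrix.fromRows_mulVec] using congrFun h (Sum.inl i)

theorem eq_zero_of_fromRows_zero_one_mulVec (v : Fin r → ℂ)
    (h : (Matrix.fromRows 0 1 : Cols r) *ᵥ v = 0) : v = 0 := by
  funext i
  simpa [Matrix.fromRows_mulVec] using congrFun h (Sum.inr i)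

theorem eq_zero_of_fromCols_one_zero_mulVec (v : Fin r → ℂ)
    (h : (Matrix.fromCols 1 0 : Rows r)ᵀ *ᵥ v = 0) : v = 0 :=
  eq_zero_of_fromRows_one_zero_mulVec v (by simpa [Matrix.transpose_fromCols] using h)

theorem eq_zero_of_fromCols_zero_one_mulVec (v : Fin r → ℂ)
    (h : (Matrix.fromCols 0 1 : Rows r)ᵀ *ᵥ v = 0) : v = 0 :=
  eq_zero_of_fromRows_zero_one_mulVec v (by simpa [Matrix.transpose_fromCols] using h)

theorem psiP_injective (hQ : IsL1Potential Q) (hz : 0 ≤ z.im) (x : ℝ) :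
    Function.Injective (psiP Q z x *ᵥ ·) :=
  (psiP_spec hQ hz).injective hQ eq_zero_of_fromRows_zero_one_mulVec x

theorem phiP_injective (hQ : IsL1Potential Q) (hz : 0 ≤ z.im) (x : ℝ) :
    Function.Injective (phiP Q z x *ᵥ ·) :=
  (phiP_spec hQ hz).injective hQ eq_zero_of_fromRows_one_zero_mulVec x

theorem psiM_injective (hQ : IsL1Potential Q) (hz : z.im ≤ 0) (x : ℝ) :
    Function.Injective (psiM Q z x *ᵥ ·) :=
  (psiM_spec hQ hz).injective hQ eq_zero_of_fromRows_one_zero_mulVec x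

theorem phiM_injective (hQ : IsL1Potential Q) (hz : z.im ≤ 0) (x : ℝ) :
    Function.Injective (phiM Q z x *ᵥ ·) :=
  (phiM_spec hQ hz).injective hQ eq_zero_of_fromRows_zero_one_mulVec x

/-- Valid up to the real axis, so that a regularity condition on `a` alone also makes the inverse of
`c` in the Gauss factors genuine. -/
theorem det_aP_eq_zero_iff (hQ : IsL1Potential Q) (hz : 0 ≤ z.im) :
    (aP Q z).det = 0 ↔ (cP Q z).det = 0 :=
  ⟨det_eq_zero_of_dual ((psiInvP_spec hQ hz).injective hQ eq_zero_of_fromCols_one_zero_mulVec 0)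
    (phiP_injective hQ hz 0) (psiP_injective hQ hz 0) (psiInvP_mul_psiP hQ hz 0)
    (phiInvP_mul_phiP hQ hz 0),
   det_eq_zero_of_dual ((phiInvP_spec hQ hz).injective hQ eq_zero_of_fromCols_zero_one_mulVec 0)
    (psiP_injective hQ hz 0) (phiP_injective hQ hz 0) (phiInvP_mul_phiP hQ hz 0)
    (psiInvP_mul_psiP hQ hz 0)⟩

theorem det_aM_eq_zero_iff (hQ : IsL1Potential Q) (hz : z.im ≤ 0) :
    (aM Q z).det = 0 ↔ (cM Q z).det = 0 :=
  ⟨det_eq_zero_of_dual ((psiInvM_spec hQ hz).injective hQ eq_zero_of_fromCols_zero_one_mulVec 0)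
    (phiM_injective hQ hz 0) (psiM_injective hQ hz 0) (psiInvM_mul_psiM hQ hz 0)
    (phiInvM_mul_phiM hQ hz 0),
   det_eq_zero_of_dual ((phiInvM_spec hQ hz).injective hQ eq_zero_of_fromCols_one_zero_mulVec 0)
    (psiM_injective hQ hz 0) (phiM_injective hQ hz 0) (phiInvM_mul_phiM hQ hz 0)
    (psiInvM_mul_psiM hQ hz 0)⟩

end Scattering

/-! ### Transformations of the potential -/

section Transformations

open Filter Topology

variable {r : ℕ} {Q : ℝ → BMat r} {l : Filter ℝ} {s z : ℂ}

/-- The potential `-Qᵀ`. -/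
def negTranspose (Q : ℝ → BMat r) (x : ℝ) : BMat r := -(Q x)ᵀ

/-- The potential `-Q*`. -/
def negConj (Q : ℝ → BMat r) (x : ℝ) : BMat r := -cc (Q x)

/-- The potential `C⁻¹ Q C`. -/
def gauge (C : BMat r) (Q : ℝ → BMat r) (x : ℝ) : BMat r := aut C (Q x)

theorem isL1Potential_negTranspose (hQ : IsL1Potential Q) : IsL1Potential (negTranspose Q) :=
  hQ.neg_transpose

theorem isL1Potential_negConj (hQ : IsL1Potential Q) : IsL1Potential (negConj Q) :=
  ⟨(hQ.continuous.matrix_map Complex.continuous_conj).neg, fun i j =>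
    (Complex.conjCLE.toContinuousLinearMap.integrable_comp (hQ.integrable i j)).neg⟩

theorem isL1Potential_gauge (hQ : IsL1Potential Q) (C : BMat r) : IsL1Potential (gauge C Q) := by
  refine ⟨(continuous_const.matrix_mul hQ.continuous).matrix_mul continuous_const,
    fun i j => ?_⟩
  simp only [gauge, aut, Matrix.mul_apply]
  exact MeasureTheory.integrable_finsetSum _ fun k _ =>
    (MeasureTheory.integrable_finsetSum _ fun k' _ =>
      (hQ.integrable k' k).const_mul _).mul_const _

/-! #### Transposition -/

theorem jostCols_negTranspose (hQ : IsL1Potential Q) (ha : Admissible l s z) {E : Cols r}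
    (hE : J r * E = s • E) (x : ℝ) :
    jostCols (negTranspose Q) l s E z x = (jostRows Q l s Eᵀ (-z) x)ᵀ := by
  have h := jostRows_spec (z := -z) (E := Eᵀ) hQ (by rwa [neg_neg]) (by
    rw [← J_transpose, ← Matrix.transpose_mul, hE, Matrix.transpose_smul])
  have h' := isJostRows_iff.1 h
  rw [Matrix.transpose_transpose, neg_neg] at h'
  exact congrFun (IsJostCols.jostCols_eq hQ.neg_transpose ha h') x

theorem jostRows_negTranspose (hQ : IsL1Potential Q) (ha : Admissible l s (-z)) {E : Rows r}
    (hE : E * J r = s • E) (x : ℝ) :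
    jostRows (negTranspose Q) l s E z x = (jostCols Q l s Eᵀ (-z) x)ᵀ := by
  have h := jostCols_spec (z := -z) (E := Eᵀ) hQ ha (by
    rw [← J_transpose, ← Matrix.transpose_mul, hE, Matrix.transpose_smul])
  refine congrFun (IsJostRows.jostRows_eq (isL1Potential_negTranspose hQ) ha
    (Z := fun x => (jostCols Q l s Eᵀ (-z) x)ᵀ) (isJostRows_iff.2 ?_)) x
  simpa [negTranspose] using h

section

variable (hQ : IsL1Potential Q)
include hQ

theorem phiP_negTranspose (hz : 0 ≤ z.im) (x : ℝ) :
    phiP (negTranspose Q) z x = (phiInvM Q (-z) x)ᵀ := by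
  simpa [phiP, phiInvM, Matrix.transpose_fromRows] using
    jostCols_negTranspose hQ (admissible_atBot_one hz) (J_mul_fromRows_one_zero r) x

theorem phiM_negTranspose (hz : z.im ≤ 0) (x : ℝ) :
    phiM (negTranspose Q) z x = (phiInvP Q (-z) x)ᵀ := by
  simpa [phiM, phiInvP, Matrix.transpose_fromRows] using
    jostCols_negTranspose hQ (admissible_atBot_neg_one hz) (J_mul_fromRows_zero_one r) x

theorem psiM_negTranspose (hz : z.im ≤ 0) (x : ℝ) :
    psiM (negTranspose Q) z x = (psiInvP Q (-z) x)ᵀ := by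
  simpa [psiM, psiInvP, Matrix.transpose_fromRows] using
    jostCols_negTranspose hQ (admissible_atTop_one hz) (J_mul_fromRows_one_zero r) x

theorem psiP_negTranspose (hz : 0 ≤ z.im) (x : ℝ) :
    psiP (negTranspose Q) z x = (psiInvM Q (-z) x)ᵀ := by
  simpa [psiP, psiInvM, Matrix.transpose_fromRows] using
    jostCols_negTranspose hQ (admissible_atTop_neg_one hz) (J_mul_fromRows_zero_one r) x

theorem phiInvM_negTranspose (hz : z.im ≤ 0) (x : ℝ) :
    phiInvM (negTranspose Q) z x = (phiP Q (-z) x)ᵀ := by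
  simpa [phiP, phiInvM, Matrix.transpose_fromCols] using jostRows_negTranspose hQ
    (admissible_atBot_one (by simpa using hz)) (fromCols_one_zero_mul_J r) x

theorem phiInvP_negTranspose (hz : 0 ≤ z.im) (x : ℝ) :
    phiInvP (negTranspose Q) z x = (phiM Q (-z) x)ᵀ := by
  simpa [phiM, phiInvP, Matrix.transpose_fromCols] using jostRows_negTranspose hQ
    (admissible_atBot_neg_one (by simpa using hz)) (fromCols_zero_one_mul_J r) x

theorem psiInvP_negTranspose (hz : 0 ≤ z.im) (x : ℝ) :
    psiInvP (negTranspose Q) z x = (psiM Q (-z) x)ᵀ := by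
  simpa [psiM, psiInvP, Matrix.transpose_fromCols] using jostRows_negTranspose hQ
    (admissible_atTop_one (by simpa using hz)) (fromCols_one_zero_mul_J r) x

theorem psiInvM_negTranspose (hz : z.im ≤ 0) (x : ℝ) :
    psiInvM (negTranspose Q) z x = (psiP Q (-z) x)ᵀ := by
  simpa [psiP, psiInvM, Matrix.transpose_fromCols] using jostRows_negTranspose hQ
    (admissible_atTop_neg_one (by simpa using hz)) (fromCols_zero_one_mul_J r) x

/-- Transposition exchanges solutions with their inverses, hence `a` with `c`, and `λ ↦ -λ`
exchanges the half-planes, hence `+` with `-`. -/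
theorem aP_negTranspose (hz : 0 ≤ z.im) : aP (negTranspose Q) z = (cM Q (-z))ᵀ := by
  rw [aP, psiInvP_negTranspose hQ hz, phiP_negTranspose hQ hz, ← Matrix.transpose_mul, cM]

theorem aM_negTranspose (hz : z.im ≤ 0) : aM (negTranspose Q) z = (cP Q (-z))ᵀ := by
  rw [aM, psiInvM_negTranspose hQ hz, phiM_negTranspose hQ hz, ← Matrix.transpose_mul, cP]

theorem cP_negTranspose (hz : 0 ≤ z.im) : cP (negTranspose Q) z = (aM Q (-z))ᵀ := by
  rw [cP, phiInvP_negTranspose hQ hz, psiP_negTranspose hQ hz, ← Matrix.transpose_mul, aM]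

theorem cM_negTranspose (hz : z.im ≤ 0) : cM (negTranspose Q) z = (aP Q (-z))ᵀ := by
  rw [cM, phiInvM_negTranspose hQ hz, psiM_negTranspose hQ hz, ← Matrix.transpose_mul, aP]

theorem bP_negTranspose (hz : z.im = 0) : bP (negTranspose Q) z = (dM Q (-z))ᵀ := by
  rw [bP, psiInvM_negTranspose hQ hz.le, phiP_negTranspose hQ hz.ge, ← Matrix.transpose_mul, dM]

theorem bM_negTranspose (hz : z.im = 0) : bM (negTranspose Q) z = (dP Q (-z))ᵀ := by
  rw [bM, psiInvP_negTranspose hQ hz.ge, phiM_negTranspose hQ hz.le, ← Matrix.transpose_mul, dP,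
    Matrix.transpose_neg]

theorem dP_negTranspose (hz : z.im = 0) : dP (negTranspose Q) z = (bM Q (-z))ᵀ := by
  rw [dP, phiInvP_negTranspose hQ hz.ge, psiM_negTranspose hQ hz.le, ← Matrix.transpose_mul, bM,
    Matrix.transpose_neg]

theorem dM_negTranspose (hz : z.im = 0) : dM (negTranspose Q) z = (bP Q (-z))ᵀ := by
  rw [dM, phiInvM_negTranspose hQ hz.le, psiP_negTranspose hQ hz.ge, ← Matrix.transpose_mul, bP]

theorem scatT_negTranspose (hz : z.im = 0) :
    scatT (negTranspose Q) z = ((scatT Q (-z))⁻¹)ᵀ := by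
  rw [scatT_inv hQ (by simpa using hz), scatT, aP_negTranspose hQ hz.ge, aM_negTranspose hQ hz.le,
    bP_negTranspose hQ hz, bM_negTranspose hQ hz, Matrix.fromBlocks_transpose,
    Matrix.transpose_neg]

end

/-! ### Gauss factors under transposition. -/

theorem fromBlocks_upper_inv (X : Blk r) :
    (Matrix.fromBlocks 1 X 0 1 : BMat r)⁻¹ = Matrix.fromBlocks 1 (-X) 0 1 :=
  Matrix.inv_eq_right_inv (by simp [Matrix.fromBlocks_multiply])

theorem fromBlocks_lower_inv (X : Blk r) :
    (Matrix.fromBlocks 1 0 X 1 : BMat r)⁻¹ = Matrix.fromBlocks 1 0 (-X) 1 :=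
  Matrix.inv_eq_right_inv (by simp [Matrix.fromBlocks_multiply])

theorem fromBlocks_diag_inv {A D : Blk r} (hA : IsUnit A.det) (hD : IsUnit D.det) :
    (Matrix.fromBlocks A 0 0 D : BMat r)⁻¹ = Matrix.fromBlocks A⁻¹ 0 0 D⁻¹ :=
  Matrix.inv_eq_right_inv (by
    simp [Matrix.fromBlocks_multiply, Matrix.mul_nonsing_inv _ hA, Matrix.mul_nonsing_inv _ hD])

theorem inv_mul_eq_mul_inv {A B C D : Blk r} (hA : A.det ≠ 0) (hD : D.det ≠ 0)
    (h : B * D = A * C) : A⁻¹ * B = C * D⁻¹ := by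
  have hA' := Matrix.nonsing_inv_mul A (isUnit_iff_ne_zero.2 hA)
  have hD' := Matrix.mul_nonsing_inv D (isUnit_iff_ne_zero.2 hD)
  calc A⁻¹ * B = A⁻¹ * (B * D) * D⁻¹ := by
        rw [Matrix.mul_assoc, Matrix.mul_assoc B, hD', Matrix.mul_one]
    _ = C * D⁻¹ := by rw [h, ← Matrix.mul_assoc A⁻¹, hA', Matrix.one_mul]

/-- At a regular real point all four of `a⁺, a⁻, c⁺, c⁻` are invertible. -/
theorem RealRegular.det_ne (hQ : IsL1Potential Q) (h : RealRegular Q z) :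
    (aP Q z).det ≠ 0 ∧ (aM Q z).det ≠ 0 ∧ (cP Q z).det ≠ 0 ∧ (cM Q z).det ≠ 0 :=
  ⟨h.2.1, h.2.2, fun h' => h.2.1 ((det_aP_eq_zero_iff hQ h.1.ge).2 h'),
    fun h' => h.2.2 ((det_aM_eq_zero_iff hQ h.1.le).2 h')⟩

section

variable (hQ : IsL1Potential Q)
include hQ

/-- The hypothesis concerns `c` of `Q`, the conclusion `a`; they are linked by their simultaneous
degeneracy. -/
theorem RealRegular.of_negTranspose (h : RealRegular (negTranspose Q) z) :
    RealRegular Q (-z) := by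
  obtain ⟨hz, h1, h2⟩ := h
  have hz' : (-z).im = 0 := by simpa using hz
  rw [aP_negTranspose hQ hz.ge, Matrix.det_transpose] at h1
  rw [aM_negTranspose hQ hz.le, Matrix.det_transpose] at h2
  exact ⟨hz', fun h => h2 ((det_aP_eq_zero_iff hQ hz'.ge).1 h),
    fun h => h1 ((det_aM_eq_zero_iff hQ hz'.le).1 h)⟩

/-- The block `d⁻ĉ⁺` becomes the transpose of `â⁻b⁺`, which the block identities for `T` rewrite as
`d⁺ĉ⁻`, the block of `S⁻` up to sign. The other three triangular factors follow the same pattern. -/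
theorem gaussSP_negTranspose (h : RealRegular (negTranspose Q) z) :
    gaussSP (negTranspose Q) z = ((gaussSM Q (-z))⁻¹)ᵀ := by
  have h' := RealRegular.of_negTranspose hQ h
  obtain ⟨h1, h2, h3, h4⟩ := h'.det_ne hQ
  have hb := scatT_mul_inv_blocks hQ h'.1
  rw [gaussSP, gaussSM, fromBlocks_lower_inv, Matrix.fromBlocks_transpose,
    dM_negTranspose hQ h.1, cP_negTranspose hQ h.1.ge, ← Matrix.transpose_nonsing_inv,
    ← Matrix.transpose_mul, inv_mul_eq_mul_inv h2 h4 hb.2.2.1]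
  simp

theorem gaussSM_negTranspose (h : RealRegular (negTranspose Q) z) :
    gaussSM (negTranspose Q) z = ((gaussSP Q (-z))⁻¹)ᵀ := by
  have h' := RealRegular.of_negTranspose hQ h
  obtain ⟨h1, h2, h3, h4⟩ := h'.det_ne hQ
  have hb := scatT_mul_inv_blocks hQ h'.1
  rw [gaussSP, gaussSM, fromBlocks_upper_inv, Matrix.fromBlocks_transpose,
    dP_negTranspose hQ h.1, cM_negTranspose hQ h.1.le, ← Matrix.transpose_nonsing_inv,
    ← Matrix.transpose_mul, inv_mul_eq_mul_inv h1 h3 hb.2.1.symm]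
  simp

theorem gaussTP_negTranspose (h : RealRegular (negTranspose Q) z) :
    gaussTP (negTranspose Q) z = ((gaussTM Q (-z))⁻¹)ᵀ := by
  have h' := RealRegular.of_negTranspose hQ h
  obtain ⟨h1, h2, h3, h4⟩ := h'.det_ne hQ
  have hb := scatT_inv_mul_blocks hQ h'.1
  rw [gaussTP, gaussTM, fromBlocks_lower_inv, Matrix.fromBlocks_transpose,
    bM_negTranspose hQ h.1, aM_negTranspose hQ h.1.le, ← Matrix.transpose_nonsing_inv,
    ← Matrix.transpose_mul, inv_mul_eq_mul_inv h3 h1 hb.2.2.1.symm]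
  simp

theorem gaussTM_negTranspose (h : RealRegular (negTranspose Q) z) :
    gaussTM (negTranspose Q) z = ((gaussTP Q (-z))⁻¹)ᵀ := by
  have h' := RealRegular.of_negTranspose hQ h
  obtain ⟨h1, h2, h3, h4⟩ := h'.det_ne hQ
  have hb := scatT_inv_mul_blocks hQ h'.1
  rw [gaussTP, gaussTM, fromBlocks_upper_inv, Matrix.fromBlocks_transpose,
    bP_negTranspose hQ h.1, aP_negTranspose hQ h.1.ge, ← Matrix.transpose_nonsing_inv,
    ← Matrix.transpose_mul, inv_mul_eq_mul_inv h4 h2 hb.2.1]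
  simp

theorem gaussDP_negTranspose (h : UpperRegular (negTranspose Q) z) :
    gaussDP (negTranspose Q) z = ((gaussDM Q (-z))⁻¹)ᵀ := by
  obtain ⟨hz, h1⟩ := h
  have hz' : (-z).im ≤ 0 := by simpa using hz
  rw [aP_negTranspose hQ hz, Matrix.det_transpose] at h1
  have h2 : (aM Q (-z)).det ≠ 0 := fun h => h1 ((det_aM_eq_zero_iff hQ hz').1 h)
  have h3 := isUnit_iff_ne_zero.2 h1
  rw [gaussDP, gaussDM, fromBlocks_diag_inv (Matrix.isUnit_nonsing_inv_det _ h3)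
    (isUnit_iff_ne_zero.2 h2), Matrix.nonsing_inv_nonsing_inv _ h3, Matrix.fromBlocks_transpose,
    aP_negTranspose hQ hz, cP_negTranspose hQ hz, Matrix.transpose_nonsing_inv]
  simp

theorem gaussDM_negTranspose (h : LowerRegular (negTranspose Q) z) :
    gaussDM (negTranspose Q) z = ((gaussDP Q (-z))⁻¹)ᵀ := by
  obtain ⟨hz, h1⟩ := h
  have hz' : 0 ≤ (-z).im := by simpa using hz
  rw [aM_negTranspose hQ hz, Matrix.det_transpose] at h1
  have h2 : (aP Q (-z)).det ≠ 0 := fun h => h1 ((det_aP_eq_zero_iff hQ hz').1 h)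
  have h3 := isUnit_iff_ne_zero.2 h1
  rw [gaussDP, gaussDM, fromBlocks_diag_inv (isUnit_iff_ne_zero.2 h2)
    (Matrix.isUnit_nonsing_inv_det _ h3), Matrix.nonsing_inv_nonsing_inv _ h3,
    Matrix.fromBlocks_transpose, aM_negTranspose hQ hz, cM_negTranspose hQ hz,
    Matrix.transpose_nonsing_inv]
  simp

end

/-! #### Complex conjugation -/

theorem map_conj_inv {n : Type*} [Fintype n] [DecidableEq n] (X : Matrix n n ℂ) :
    (X⁻¹).map (starRingEnd ℂ) = (X.map (starRingEnd ℂ))⁻¹ := by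
  have h : ∀ Y : Matrix n n ℂ, Y.map (starRingEnd ℂ) = Yᴴᵀ := fun Y => rfl
  rw [h, h, Matrix.conjTranspose_nonsing_inv, Matrix.transpose_nonsing_inv]

theorem cc_J (r : ℕ) : cc (J r) = J r := by
  simp [cc, J, Matrix.fromBlocks_map, Matrix.map_neg _ (map_neg (starRingEnd ℂ))]

theorem laxU_negConj (x : ℝ) : laxU (negConj Q) (-conj z) x = -cc (laxU Q z x) := by
  have h : cc (z • J r) = conj z • J r := by
    conv_rhs => rw [← cc_J]
    ext i j
    simp [cc]
  have h' : cc (laxU Q z x) = cc (Q x) - cc (z • J r) := by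
    ext i j
    simp [cc, laxU]
  rw [h', h, laxU, negConj, neg_smul]
  abel

/-- Conjugation turns `i` into `-i`; the sign is absorbed by `-Q*` and `-conj λ`. As the conjugate
of `iλ` is `i(-conj λ)`, the type of asymptotics is kept. -/
theorem IsJostCols.negConj {E : Cols r} {Y : ℝ → Cols r} (hs : conj s = s)
    (h : IsJostCols Q l s E z Y) :
    IsJostCols (negConj Q) l s (E.map (starRingEnd ℂ)) (-conj z)
      (fun x => (Y x).map (starRingEnd ℂ)) := by
  refine ⟨fun x i j => ?_, ?_⟩
  · have h1 := Complex.conjCLE.toContinuousLinearMap.hasFDerivAt.comp_hasDerivAt x (h.1 x i j)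
    refine HasDerivAt.congr_deriv h1 ?_
    rw [laxU_negConj, cc, Matrix.neg_mul,
      ← Matrix.map_mul (L := laxU Q z x) (M := Y x) (f := starRingEnd ℂ)]
    change conj (Complex.I * (laxU Q z x * Y x) i j)
      = Complex.I * -conj ((laxU Q z x * Y x) i j)
    rw [map_mul, Complex.conj_I]
    ring
  · have h1 : Continuous fun M : Cols r => M.map (starRingEnd ℂ) :=
      continuous_id.matrix_map Complex.continuous_conj
    refine ((h1.tendsto E).comp h.2).congr fun x => ?_
    ext i j
    simp [← Complex.exp_conj, hs]

theorem IsJostRows.negConj {E : Rows r} {Z : ℝ → Rows r} (hs : conj s = s)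
    (h : IsJostRows Q l s E z Z) :
    IsJostRows (negConj Q) l s (E.map (starRingEnd ℂ)) (-conj z)
      (fun x => (Z x).map (starRingEnd ℂ)) := by
  have h1 := (isJostRows_iff.1 h).negConj hs
  rw [map_neg] at h1
  refine isJostRows_iff.2 ?_
  have h2 : (fun x => -(LaxScattering.negConj Q x)ᵀ)
      = LaxScattering.negConj fun x => -(Q x)ᵀ := by
    funext x
    ext i j
    simp [LaxScattering.negConj, cc]
  rw [h2]
  exact h1

theorem conj_of_sign (hs : s = 1 ∨ s = -1) : conj s = s := by
  rcases hs with rfl | rfl <;> simp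

theorem Admissible.neg_conj (ha : Admissible l s z) : Admissible l s (-conj z) := by
  refine ⟨ha.1, ?_⟩
  have h : (s * -conj z).im = (s * z).im := by
    rcases ha.1 with rfl | rfl <;> simp
  rw [h]
  exact ha.2

theorem jostCols_negConj (hQ : IsL1Potential Q) (ha : Admissible l s z) {E : Cols r}
    (hE : J r * E = s • E) (hEr : E.map (starRingEnd ℂ) = E) (x : ℝ) :
    jostCols (negConj Q) l s E z x = (jostCols Q l s E (-conj z) x).map (starRingEnd ℂ) := by
  have h := (jostCols_spec hQ ha.neg_conj hE).negConj (conj_of_sign ha.1)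
  rw [hEr, map_neg, Complex.conj_conj, neg_neg] at h
  exact congrFun (h.jostCols_eq (isL1Potential_negConj hQ) ha) x

theorem jostRows_negConj (hQ : IsL1Potential Q) (ha : Admissible l s (-z)) {E : Rows r}
    (hE : E * J r = s • E) (hEr : E.map (starRingEnd ℂ) = E) (x : ℝ) :
    jostRows (negConj Q) l s E z x = (jostRows Q l s E (-conj z) x).map (starRingEnd ℂ) := by
  have ha' : Admissible l s (- -conj z) := by simpa using ha.neg_conj
  have h := (jostRows_spec hQ ha' hE).negConj (conj_of_sign ha.1)
  rw [hEr, map_neg, Complex.conj_conj, neg_neg] at h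
  exact congrFun (h.jostRows_eq (isL1Potential_negConj hQ) ha) x

theorem fromRows_one_zero_map (r : ℕ) :
    (Matrix.fromRows 1 0 : Cols r).map (starRingEnd ℂ) = Matrix.fromRows 1 0 := by
  ext (i | i) j <;> simp [Matrix.one_apply, apply_ite]

theorem fromRows_zero_one_map (r : ℕ) :
    (Matrix.fromRows 0 1 : Cols r).map (starRingEnd ℂ) = Matrix.fromRows 0 1 := by
  ext (i | i) j <;> simp [Matrix.one_apply, apply_ite]

theorem fromCols_one_zero_map (r : ℕ) :
    (Matrix.fromCols 1 0 : Rows r).map (starRingEnd ℂ) = Matrix.fromCols 1 0 := by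
  ext i (j | j) <;> simp [Matrix.one_apply, apply_ite]

theorem fromCols_zero_one_map (r : ℕ) :
    (Matrix.fromCols 0 1 : Rows r).map (starRingEnd ℂ) = Matrix.fromCols 0 1 := by
  ext i (j | j) <;> simp [Matrix.one_apply, apply_ite]

section

variable (hQ : IsL1Potential Q)
include hQ

theorem phiP_negConj (hz : 0 ≤ z.im) (x : ℝ) :
    phiP (negConj Q) z x = (phiP Q (-conj z) x).map (starRingEnd ℂ) :=
  jostCols_negConj hQ (admissible_atBot_one hz) (J_mul_fromRows_one_zero r)
    (fromRows_one_zero_map r) x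

theorem phiM_negConj (hz : z.im ≤ 0) (x : ℝ) :
    phiM (negConj Q) z x = (phiM Q (-conj z) x).map (starRingEnd ℂ) :=
  jostCols_negConj hQ (admissible_atBot_neg_one hz) (J_mul_fromRows_zero_one r)
    (fromRows_zero_one_map r) x

theorem psiM_negConj (hz : z.im ≤ 0) (x : ℝ) :
    psiM (negConj Q) z x = (psiM Q (-conj z) x).map (starRingEnd ℂ) :=
  jostCols_negConj hQ (admissible_atTop_one hz) (J_mul_fromRows_one_zero r)
    (fromRows_one_zero_map r) x

theorem psiP_negConj (hz : 0 ≤ z.im) (x : ℝ) :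
    psiP (negConj Q) z x = (psiP Q (-conj z) x).map (starRingEnd ℂ) :=
  jostCols_negConj hQ (admissible_atTop_neg_one hz) (J_mul_fromRows_zero_one r)
    (fromRows_zero_one_map r) x

theorem phiInvM_negConj (hz : z.im ≤ 0) (x : ℝ) :
    phiInvM (negConj Q) z x = (phiInvM Q (-conj z) x).map (starRingEnd ℂ) :=
  jostRows_negConj hQ (admissible_atBot_one (by simpa using hz)) (fromCols_one_zero_mul_J r)
    (fromCols_one_zero_map r) x

theorem phiInvP_negConj (hz : 0 ≤ z.im) (x : ℝ) :
    phiInvP (negConj Q) z x = (phiInvP Q (-conj z) x).map (starRingEnd ℂ) :=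
  jostRows_negConj hQ (admissible_atBot_neg_one (by simpa using hz)) (fromCols_zero_one_mul_J r)
    (fromCols_zero_one_map r) x

theorem psiInvP_negConj (hz : 0 ≤ z.im) (x : ℝ) :
    psiInvP (negConj Q) z x = (psiInvP Q (-conj z) x).map (starRingEnd ℂ) :=
  jostRows_negConj hQ (admissible_atTop_one (by simpa using hz)) (fromCols_one_zero_mul_J r)
    (fromCols_one_zero_map r) x

theorem psiInvM_negConj (hz : z.im ≤ 0) (x : ℝ) :
    psiInvM (negConj Q) z x = (psiInvM Q (-conj z) x).map (starRingEnd ℂ) :=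
  jostRows_negConj hQ (admissible_atTop_neg_one (by simpa using hz)) (fromCols_zero_one_mul_J r)
    (fromCols_zero_one_map r) x

theorem aP_negConj (hz : 0 ≤ z.im) :
    aP (negConj Q) z = (aP Q (-conj z)).map (starRingEnd ℂ) := by
  rw [aP, psiInvP_negConj hQ hz, phiP_negConj hQ hz, ← Matrix.map_mul, aP]

theorem aM_negConj (hz : z.im ≤ 0) :
    aM (negConj Q) z = (aM Q (-conj z)).map (starRingEnd ℂ) := by
  rw [aM, psiInvM_negConj hQ hz, phiM_negConj hQ hz, ← Matrix.map_mul, aM]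

theorem cP_negConj (hz : 0 ≤ z.im) :
    cP (negConj Q) z = (cP Q (-conj z)).map (starRingEnd ℂ) := by
  rw [cP, phiInvP_negConj hQ hz, psiP_negConj hQ hz, ← Matrix.map_mul, cP]

theorem cM_negConj (hz : z.im ≤ 0) :
    cM (negConj Q) z = (cM Q (-conj z)).map (starRingEnd ℂ) := by
  rw [cM, phiInvM_negConj hQ hz, psiM_negConj hQ hz, ← Matrix.map_mul, cM]

theorem bP_negConj (hz : z.im = 0) :
    bP (negConj Q) z = (bP Q (-conj z)).map (starRingEnd ℂ) := by
  rw [bP, psiInvM_negConj hQ hz.le, phiP_negConj hQ hz.ge, ← Matrix.map_mul, bP]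

theorem bM_negConj (hz : z.im = 0) :
    bM (negConj Q) z = (bM Q (-conj z)).map (starRingEnd ℂ) := by
  rw [bM, psiInvP_negConj hQ hz.ge, phiM_negConj hQ hz.le, ← Matrix.map_mul, bM,
    Matrix.map_neg _ (map_neg _)]

theorem dP_negConj (hz : z.im = 0) :
    dP (negConj Q) z = (dP Q (-conj z)).map (starRingEnd ℂ) := by
  rw [dP, phiInvP_negConj hQ hz.ge, psiM_negConj hQ hz.le, ← Matrix.map_mul, dP,
    Matrix.map_neg _ (map_neg _)]

theorem dM_negConj (hz : z.im = 0) :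
    dM (negConj Q) z = (dM Q (-conj z)).map (starRingEnd ℂ) := by
  rw [dM, phiInvM_negConj hQ hz.le, psiP_negConj hQ hz.ge, ← Matrix.map_mul, dM]

theorem scatT_negConj (hz : z.im = 0) : scatT (negConj Q) z = cc (scatT Q (-conj z)) := by
  rw [scatT, scatT, cc, Matrix.fromBlocks_map, aP_negConj hQ hz.ge, aM_negConj hQ hz.le,
    bP_negConj hQ hz, bM_negConj hQ hz, Matrix.map_neg _ (map_neg _)]

theorem gaussSP_negConj (hz : z.im = 0) : gaussSP (negConj Q) z = cc (gaussSP Q (-conj z)) := by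
  rw [gaussSP, gaussSP, cc, Matrix.fromBlocks_map, dM_negConj hQ hz, cP_negConj hQ hz.ge,
    Matrix.map_mul, map_conj_inv]
  simp

theorem gaussSM_negConj (hz : z.im = 0) : gaussSM (negConj Q) z = cc (gaussSM Q (-conj z)) := by
  rw [gaussSM, gaussSM, cc, Matrix.fromBlocks_map, dP_negConj hQ hz, cM_negConj hQ hz.le,
    Matrix.map_neg _ (map_neg _), Matrix.map_mul, map_conj_inv]
  simp

theorem gaussTP_negConj (hz : z.im = 0) : gaussTP (negConj Q) z = cc (gaussTP Q (-conj z)) := by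
  rw [gaussTP, gaussTP, cc, Matrix.fromBlocks_map, bM_negConj hQ hz, aM_negConj hQ hz.le,
    Matrix.map_neg _ (map_neg _), Matrix.map_mul, map_conj_inv]
  simp

theorem gaussTM_negConj (hz : z.im = 0) : gaussTM (negConj Q) z = cc (gaussTM Q (-conj z)) := by
  rw [gaussTM, gaussTM, cc, Matrix.fromBlocks_map, bP_negConj hQ hz, aP_negConj hQ hz.ge,
    Matrix.map_mul, map_conj_inv]
  simp

theorem gaussDP_negConj (hz : 0 ≤ z.im) : gaussDP (negConj Q) z = cc (gaussDP Q (-conj z)) := by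
  rw [gaussDP, gaussDP, cc, Matrix.fromBlocks_map, aP_negConj hQ hz, cP_negConj hQ hz,
    map_conj_inv]
  simp

theorem gaussDM_negConj (hz : z.im ≤ 0) : gaussDM (negConj Q) z = cc (gaussDM Q (-conj z)) := by
  rw [gaussDM, gaussDM, cc, Matrix.fromBlocks_map, aM_negConj hQ hz, cM_negConj hQ hz,
    map_conj_inv]
  simp

theorem det_aP_negConj (hz : 0 ≤ z.im) :
    (aP (negConj Q) z).det = conj (aP Q (-conj z)).det := by
  rw [aP_negConj hQ hz, RingHom.map_det]
  rfl

theorem det_aM_negConj (hz : z.im ≤ 0) :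
    (aM (negConj Q) z).det = conj (aM Q (-conj z)).det := by
  rw [aM_negConj hQ hz, RingHom.map_det]
  rfl

end

end Transformations

/-! ### Gauge transformations -/

section Gauge

open Filter Topology

variable {r : ℕ} {Q : ℝ → BMat r} {l : Filter ℝ} {s z ε : ℂ} {C : BMat r}

theorem laxU_gauge (hε : ε * ε = 1) (hJ : aut C (J r) = ε • J r) (x : ℝ) :
    laxU (gauge C Q) z x = aut C (laxU Q (ε * z) x) := by
  have h : aut C (laxU Q (ε * z) x) = aut C (Q x) - (ε * z) • aut C (J r) := by
    simp only [aut, laxU, Matrix.mul_sub, Matrix.sub_mul, Matrix.mul_smul, Matrix.smul_mul]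
  rw [h, hJ, smul_smul, mul_right_comm, hε, one_mul]
  rfl

theorem hasDerivAt_mul_mul {m n m' n' : Type*} [Fintype m] [Fintype n] (A : Matrix m' m ℂ)
    (B : Matrix n n' ℂ) {Y : ℝ → Matrix m n ℂ} {Y' : Matrix m n ℂ} {x : ℝ}
    (h : ∀ i j, HasDerivAt (fun y => Y y i j) (Y' i j) x) (i : m') (j : n') :
    HasDerivAt (fun y => (A * Y y * B) i j) ((A * Y' * B) i j) x := by
  simp only [Matrix.mul_apply]
  exact HasDerivAt.fun_sum fun k _ =>
    (HasDerivAt.fun_sum fun k' _ => (h k' k).const_mul _).mul_const _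

/-- `C⁻¹ Y` solves the transformed equation but has limit `C⁻¹ E`. The constant block `K` on the
right is there to restore the standard normalization. -/
theorem IsJostCols.gauge (hC : IsUnit C.det) (hε : ε * ε = 1) (hJ : aut C (J r) = ε • J r)
    {E : Cols r} {Y : ℝ → Cols r} (h : IsJostCols Q l (ε * s) E (ε * z) Y) (K : Blk r) :
    IsJostCols (gauge C Q) l s (C⁻¹ * E * K) z (fun x => C⁻¹ * Y x * K) := by
  refine ⟨fun x i j => HasDerivAt.congr_deriv (hasDerivAt_mul_mul _ _ (h.1 x) i j) ?_, ?_⟩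
  · rw [laxU_gauge hε hJ, aut]
    simp only [Matrix.mul_smul, Matrix.smul_mul, ← Matrix.mul_assoc]
    rw [Matrix.mul_nonsing_inv_cancel_right _ _ hC]
  · refine (tendsto_matrix_mul (tendsto_matrix_mul (tendsto_const_nhds (x := C⁻¹)) h.2)
      (tendsto_const_nhds (x := K))).congr fun x => ?_
    rw [Matrix.mul_smul, Matrix.smul_mul]
    congr 2
    linear_combination Complex.I * s * z * x * hε

theorem IsJostRows.gauge (hC : IsUnit C.det) (hε : ε * ε = 1) (hJ : aut C (J r) = ε • J r)
    {E : Rows r} {Z : ℝ → Rows r} (h : IsJostRows Q l (ε * s) E (ε * z) Z) (K : Blk r) :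
    IsJostRows (gauge C Q) l s (K * E * C) z (fun x => K * Z x * C) := by
  refine ⟨fun x i j => HasDerivAt.congr_deriv (hasDerivAt_mul_mul _ _ (h.1 x) i j) ?_, ?_⟩
  · rw [laxU_gauge hε hJ, aut]
    simp only [Matrix.mul_smul, Matrix.smul_mul, ← Matrix.mul_assoc]
    rw [Matrix.mul_nonsing_inv_cancel_right _ _ hC]
  · refine (tendsto_matrix_mul (tendsto_matrix_mul (tendsto_const_nhds (x := K)) h.2)
      (tendsto_const_nhds (x := C))).congr fun x => ?_
    rw [Matrix.mul_smul, Matrix.smul_mul]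
    congr 2
    linear_combination -Complex.I * s * z * x * hε

theorem Admissible.sign_mul (hε : ε = 1 ∨ ε = -1) (ha : Admissible l s z) :
    Admissible l (ε * s) (ε * z) := by
  rcases hε with rfl | rfl
  · simpa using ha
  · simpa using ha.neg_neg

theorem jostCols_gauge (hQ : IsL1Potential Q) (hC : IsUnit C.det) (hε : ε = 1 ∨ ε = -1)
    (hJ : aut C (J r) = ε • J r) (ha : Admissible l s z) {E E' : Cols r} {K : Blk r}
    (hE' : J r * E' = (ε * s) • E') (hE : E' * K = C * E) (x : ℝ) :
    jostCols (gauge C Q) l s E z x = C⁻¹ * jostCols Q l (ε * s) E' (ε * z) x * K := by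
  have hε' : ε * ε = 1 := by rcases hε with rfl | rfl <;> norm_num
  have h := (jostCols_spec hQ (ha.sign_mul hε) hE').gauge hC hε' hJ K
  rw [Matrix.mul_assoc, hE, Matrix.nonsing_inv_mul_cancel_left _ _ hC] at h
  exact congrFun (h.jostCols_eq (isL1Potential_gauge hQ C) ha) x

theorem jostRows_gauge (hQ : IsL1Potential Q) (hC : IsUnit C.det) (hε : ε = 1 ∨ ε = -1)
    (hJ : aut C (J r) = ε • J r) (ha : Admissible l s (-z)) {E E' : Rows r} {K : Blk r}
    (hE' : E' * J r = (ε * s) • E') (hE : K * E' * C = E) (x : ℝ) :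
    jostRows (gauge C Q) l s E z x = K * jostRows Q l (ε * s) E' (ε * z) x * C := by
  have hε' : ε * ε = 1 := by rcases hε with rfl | rfl <;> norm_num
  have ha' : Admissible l (ε * s) (-(ε * z)) := by
    rw [← mul_neg]
    exact ha.sign_mul hε
  have h := (jostRows_spec hQ ha' hE').gauge hC hε' hJ K
  rw [hE] at h
  exact congrFun (h.jostRows_eq (isL1Potential_gauge hQ C) ha) x

/-- `C` cancels between row and column, so only the normalizing blocks act on the scattering
coefficients. -/
theorem gauge_pairing (hC : IsUnit C.det) (K L : Blk r) (Z : Rows r) (Y : Cols r) :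
    (K * Z * C) * (C⁻¹ * Y * L) = K * (Z * Y) * L := by
  rw [← Matrix.mul_assoc, ← Matrix.mul_assoc, Matrix.mul_nonsing_inv_cancel_right _ _ hC,
    Matrix.mul_assoc K]

theorem conj_mul_inv {A B : Blk r} (hA : IsUnit A.det) (X Y : Blk r) :
    B * X * A * (A⁻¹ * Y * A)⁻¹ = B * (X * Y⁻¹) * A := by
  rw [Matrix.mul_inv_rev, Matrix.mul_inv_rev, Matrix.nonsing_inv_nonsing_inv _ hA,
    Matrix.mul_assoc, ← Matrix.mul_assoc A, Matrix.mul_nonsing_inv _ hA, Matrix.one_mul]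
  simp only [Matrix.mul_assoc]

theorem conj_inv {A : Blk r} (hA : IsUnit A.det) (Y : Blk r) :
    (A⁻¹ * Y * A)⁻¹ = A⁻¹ * Y⁻¹ * A := by
  rw [Matrix.mul_inv_rev, Matrix.mul_inv_rev, Matrix.nonsing_inv_nonsing_inv _ hA,
    Matrix.mul_assoc]

theorem det_conj {A : Blk r} (hA : IsUnit A.det) (Y : Blk r) : (A⁻¹ * Y * A).det = Y.det := by
  rw [Matrix.mul_assoc, Matrix.det_mul, Matrix.det_mul, mul_left_comm, ← Matrix.det_mul,
    Matrix.nonsing_inv_mul _ hA, Matrix.det_one, mul_one]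

theorem aut_mul (hC : IsUnit C.det) (X Y : BMat r) : aut C (X * Y) = aut C X * aut C Y := by
  simp only [aut, ← Matrix.mul_assoc]
  rw [Matrix.mul_nonsing_inv_cancel_right _ _ hC]

theorem aut_inv (hC : IsUnit C.det) (X : BMat r) : (aut C X)⁻¹ = aut C X⁻¹ := by
  rw [aut, aut, Matrix.mul_inv_rev, Matrix.mul_inv_rev, Matrix.nonsing_inv_nonsing_inv _ hC,
    Matrix.mul_assoc]

/-! #### Class A -/

theorem eq_zero_of_eq_neg {m n : Type*} {X : Matrix m n ℂ} (h : X = -X) : X = 0 := by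
  ext i j
  simpa [self_eq_neg] using congrFun (congrFun h i) j

/-- `C` commutes with `J`, so each off-diagonal block equals its own negative. -/
theorem ClassA.exists_blocks (h : ClassA C) : ∃ A B : Blk r, IsUnit A.det ∧ IsUnit B.det ∧
    C = Matrix.fromBlocks A 0 0 B := by
  obtain ⟨hC, hJ⟩ := h
  have h1 : J r * C = C * J r := by
    conv_rhs => rw [← hJ, aut, Matrix.mul_assoc, Matrix.mul_nonsing_inv_cancel_left _ _ hC]
  obtain ⟨A, X, Y, B, rfl⟩ : ∃ A X Y B : Blk r, C = Matrix.fromBlocks A X Y B :=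
    ⟨_, _, _, _, (Matrix.fromBlocks_toBlocks C).symm⟩
  rw [J, Matrix.fromBlocks_multiply, Matrix.fromBlocks_multiply, Matrix.fromBlocks_inj] at h1
  have hX : X = 0 := eq_zero_of_eq_neg (by simpa using h1.2.1)
  have hY : Y = 0 := eq_zero_of_eq_neg (by simpa using h1.2.2.1.symm)
  subst hX hY
  rw [Matrix.det_fromBlocks_zero₂₁] at hC
  exact ⟨A, B, isUnit_of_mul_isUnit_left hC, isUnit_of_mul_isUnit_right hC, rfl⟩

section ClassA

variable {A B : Blk r} (hA : IsUnit A.det) (hB : IsUnit B.det)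
include hA hB

theorem aut_fromBlocks_diag (a b c d : Blk r) :
    aut (Matrix.fromBlocks A 0 0 B) (Matrix.fromBlocks a b c d)
      = Matrix.fromBlocks (A⁻¹ * a * A) (A⁻¹ * b * B) (B⁻¹ * c * A) (B⁻¹ * d * B) := by
  rw [aut, fromBlocks_diag_inv hA hB]
  simp [Matrix.fromBlocks_multiply]

theorem isUnit_det_fromBlocks_diag : IsUnit (Matrix.fromBlocks A 0 0 B : BMat r).det := by
  rw [Matrix.det_fromBlocks_zero₂₁]
  exact hA.mul hB

theorem aut_fromBlocks_diag_J : aut (Matrix.fromBlocks A 0 0 B) (J r) = (1 : ℂ) • J r := by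
  rw [J, aut_fromBlocks_diag hA hB]
  simp [Matrix.nonsing_inv_mul _ hA, Matrix.nonsing_inv_mul _ hB]

variable (hQ : IsL1Potential Q)
include hQ

theorem phiP_gaugeA (hz : 0 ≤ z.im) (x : ℝ) :
    phiP (gauge (Matrix.fromBlocks A 0 0 B) Q) z x
      = (Matrix.fromBlocks A 0 0 B)⁻¹ * phiP Q z x * A := by
  have := jostCols_gauge (E := Matrix.fromRows 1 0) (E' := Matrix.fromRows 1 0) (K := A) hQ
    (isUnit_det_fromBlocks_diag hA hB) (Or.inl rfl) (aut_fromBlocks_diag_J hA hB)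
    (admissible_atBot_one hz) (by simpa using J_mul_fromRows_one_zero r)
    (by simp [Matrix.fromBlocks_mul_fromRows, Matrix.fromRows_mul]) x
  simp only [one_mul] at this
  exact this

theorem psiM_gaugeA (hz : z.im ≤ 0) (x : ℝ) :
    psiM (gauge (Matrix.fromBlocks A 0 0 B) Q) z x
      = (Matrix.fromBlocks A 0 0 B)⁻¹ * psiM Q z x * A := by
  have := jostCols_gauge (E := Matrix.fromRows 1 0) (E' := Matrix.fromRows 1 0) (K := A) hQ
    (isUnit_det_fromBlocks_diag hA hB) (Or.inl rfl) (aut_fromBlocks_diag_J hA hB)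
    (admissible_atTop_one hz) (by simpa using J_mul_fromRows_one_zero r)
    (by simp [Matrix.fromBlocks_mul_fromRows, Matrix.fromRows_mul]) x
  simp only [one_mul] at this
  exact this

theorem phiM_gaugeA (hz : z.im ≤ 0) (x : ℝ) :
    phiM (gauge (Matrix.fromBlocks A 0 0 B) Q) z x
      = (Matrix.fromBlocks A 0 0 B)⁻¹ * phiM Q z x * B := by
  have := jostCols_gauge (E := Matrix.fromRows 0 1) (E' := Matrix.fromRows 0 1) (K := B) hQ
    (isUnit_det_fromBlocks_diag hA hB) (Or.inl rfl) (aut_fromBlocks_diag_J hA hB)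
    (admissible_atBot_neg_one hz) (by simpa using J_mul_fromRows_zero_one r)
    (by simp [Matrix.fromBlocks_mul_fromRows, Matrix.fromRows_mul]) x
  simp only [one_mul] at this
  exact this

theorem psiP_gaugeA (hz : 0 ≤ z.im) (x : ℝ) :
    psiP (gauge (Matrix.fromBlocks A 0 0 B) Q) z x
      = (Matrix.fromBlocks A 0 0 B)⁻¹ * psiP Q z x * B := by
  have := jostCols_gauge (E := Matrix.fromRows 0 1) (E' := Matrix.fromRows 0 1) (K := B) hQ
    (isUnit_det_fromBlocks_diag hA hB) (Or.inl rfl) (aut_fromBlocks_diag_J hA hB)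
    (admissible_atTop_neg_one hz) (by simpa using J_mul_fromRows_zero_one r)
    (by simp [Matrix.fromBlocks_mul_fromRows, Matrix.fromRows_mul]) x
  simp only [one_mul] at this
  exact this

theorem phiInvM_gaugeA (hz : z.im ≤ 0) (x : ℝ) :
    phiInvM (gauge (Matrix.fromBlocks A 0 0 B) Q) z x
      = A⁻¹ * phiInvM Q z x * Matrix.fromBlocks A 0 0 B := by
  have := jostRows_gauge (E := Matrix.fromCols 1 0) (E' := Matrix.fromCols 1 0) (K := A⁻¹) hQ
    (isUnit_det_fromBlocks_diag hA hB) (Or.inl rfl) (aut_fromBlocks_diag_J hA hB)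
    (admissible_atBot_one (by simpa using hz)) (by simpa using fromCols_one_zero_mul_J r)
    (by simp [Matrix.fromCols_mul_fromBlocks, Matrix.mul_fromCols,
      Matrix.nonsing_inv_mul _ hA]) x
  simp only [one_mul] at this
  exact this

theorem psiInvP_gaugeA (hz : 0 ≤ z.im) (x : ℝ) :
    psiInvP (gauge (Matrix.fromBlocks A 0 0 B) Q) z x
      = A⁻¹ * psiInvP Q z x * Matrix.fromBlocks A 0 0 B := by
  have := jostRows_gauge (E := Matrix.fromCols 1 0) (E' := Matrix.fromCols 1 0) (K := A⁻¹) hQ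
    (isUnit_det_fromBlocks_diag hA hB) (Or.inl rfl) (aut_fromBlocks_diag_J hA hB)
    (admissible_atTop_one (by simpa using hz)) (by simpa using fromCols_one_zero_mul_J r)
    (by simp [Matrix.fromCols_mul_fromBlocks, Matrix.mul_fromCols,
      Matrix.nonsing_inv_mul _ hA]) x
  simp only [one_mul] at this
  exact this

theorem phiInvP_gaugeA (hz : 0 ≤ z.im) (x : ℝ) :
    phiInvP (gauge (Matrix.fromBlocks A 0 0 B) Q) z x
      = B⁻¹ * phiInvP Q z x * Matrix.fromBlocks A 0 0 B := by
  have := jostRows_gauge (E := Matrix.fromCols 0 1) (E' := Matrix.fromCols 0 1) (K := B⁻¹) hQ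
    (isUnit_det_fromBlocks_diag hA hB) (Or.inl rfl) (aut_fromBlocks_diag_J hA hB)
    (admissible_atBot_neg_one (by simpa using hz)) (by simpa using fromCols_zero_one_mul_J r)
    (by simp [Matrix.fromCols_mul_fromBlocks, Matrix.mul_fromCols,
      Matrix.nonsing_inv_mul _ hB]) x
  simp only [one_mul] at this
  exact this

theorem psiInvM_gaugeA (hz : z.im ≤ 0) (x : ℝ) :
    psiInvM (gauge (Matrix.fromBlocks A 0 0 B) Q) z x
      = B⁻¹ * psiInvM Q z x * Matrix.fromBlocks A 0 0 B := by
  have := jostRows_gauge (E := Matrix.fromCols 0 1) (E' := Matrix.fromCols 0 1) (K := B⁻¹) hQ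
    (isUnit_det_fromBlocks_diag hA hB) (Or.inl rfl) (aut_fromBlocks_diag_J hA hB)
    (admissible_atTop_neg_one (by simpa using hz)) (by simpa using fromCols_zero_one_mul_J r)
    (by simp [Matrix.fromCols_mul_fromBlocks, Matrix.mul_fromCols,
      Matrix.nonsing_inv_mul _ hB]) x
  simp only [one_mul] at this
  exact this

theorem aP_gaugeA (hz : 0 ≤ z.im) :
    aP (gauge (Matrix.fromBlocks A 0 0 B) Q) z = A⁻¹ * aP Q z * A := by
  rw [aP, psiInvP_gaugeA hA hB hQ hz, phiP_gaugeA hA hB hQ hz,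
    gauge_pairing (isUnit_det_fromBlocks_diag hA hB), aP]

theorem aM_gaugeA (hz : z.im ≤ 0) :
    aM (gauge (Matrix.fromBlocks A 0 0 B) Q) z = B⁻¹ * aM Q z * B := by
  rw [aM, psiInvM_gaugeA hA hB hQ hz, phiM_gaugeA hA hB hQ hz,
    gauge_pairing (isUnit_det_fromBlocks_diag hA hB), aM]

theorem cP_gaugeA (hz : 0 ≤ z.im) :
    cP (gauge (Matrix.fromBlocks A 0 0 B) Q) z = B⁻¹ * cP Q z * B := by
  rw [cP, phiInvP_gaugeA hA hB hQ hz, psiP_gaugeA hA hB hQ hz,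
    gauge_pairing (isUnit_det_fromBlocks_diag hA hB), cP]

theorem cM_gaugeA (hz : z.im ≤ 0) :
    cM (gauge (Matrix.fromBlocks A 0 0 B) Q) z = A⁻¹ * cM Q z * A := by
  rw [cM, phiInvM_gaugeA hA hB hQ hz, psiM_gaugeA hA hB hQ hz,
    gauge_pairing (isUnit_det_fromBlocks_diag hA hB), cM]

theorem bP_gaugeA (hz : z.im = 0) :
    bP (gauge (Matrix.fromBlocks A 0 0 B) Q) z = B⁻¹ * bP Q z * A := by
  rw [bP, psiInvM_gaugeA hA hB hQ hz.le, phiP_gaugeA hA hB hQ hz.ge,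
    gauge_pairing (isUnit_det_fromBlocks_diag hA hB), bP]

theorem bM_gaugeA (hz : z.im = 0) :
    bM (gauge (Matrix.fromBlocks A 0 0 B) Q) z = A⁻¹ * bM Q z * B := by
  rw [bM, psiInvP_gaugeA hA hB hQ hz.ge, phiM_gaugeA hA hB hQ hz.le,
    gauge_pairing (isUnit_det_fromBlocks_diag hA hB), bM, Matrix.mul_neg, Matrix.neg_mul]

theorem dP_gaugeA (hz : z.im = 0) :
    dP (gauge (Matrix.fromBlocks A 0 0 B) Q) z = B⁻¹ * dP Q z * A := by
  rw [dP, phiInvP_gaugeA hA hB hQ hz.ge, psiM_gaugeA hA hB hQ hz.le,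
    gauge_pairing (isUnit_det_fromBlocks_diag hA hB), dP, Matrix.mul_neg, Matrix.neg_mul]

theorem dM_gaugeA (hz : z.im = 0) :
    dM (gauge (Matrix.fromBlocks A 0 0 B) Q) z = A⁻¹ * dM Q z * B := by
  rw [dM, phiInvM_gaugeA hA hB hQ hz.le, psiP_gaugeA hA hB hQ hz.ge,
    gauge_pairing (isUnit_det_fromBlocks_diag hA hB), dM]

end ClassA

section ClassA

variable (hC : ClassA C) (hQ : IsL1Potential Q)
include hC hQ

theorem scatT_gaugeA (hz : z.im = 0) : scatT (gauge C Q) z = aut C (scatT Q z) := by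
  obtain ⟨A, B, hA, hB, rfl⟩ := hC.exists_blocks
  rw [scatT, scatT, aut_fromBlocks_diag hA hB, aP_gaugeA hA hB hQ hz.ge,
    aM_gaugeA hA hB hQ hz.le, bP_gaugeA hA hB hQ hz, bM_gaugeA hA hB hQ hz]
  simp

theorem gaussSP_gaugeA (hz : z.im = 0) : gaussSP (gauge C Q) z = aut C (gaussSP Q z) := by
  obtain ⟨A, B, hA, hB, rfl⟩ := hC.exists_blocks
  rw [gaussSP, gaussSP, aut_fromBlocks_diag hA hB, dM_gaugeA hA hB hQ hz,
    cP_gaugeA hA hB hQ hz.ge, conj_mul_inv hB]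
  simp [Matrix.nonsing_inv_mul _ hA, Matrix.nonsing_inv_mul _ hB]

theorem gaussSM_gaugeA (hz : z.im = 0) : gaussSM (gauge C Q) z = aut C (gaussSM Q z) := by
  obtain ⟨A, B, hA, hB, rfl⟩ := hC.exists_blocks
  rw [gaussSM, gaussSM, aut_fromBlocks_diag hA hB, dP_gaugeA hA hB hQ hz,
    cM_gaugeA hA hB hQ hz.le, conj_mul_inv hA]
  simp [Matrix.nonsing_inv_mul _ hA, Matrix.nonsing_inv_mul _ hB]

theorem gaussTP_gaugeA (hz : z.im = 0) : gaussTP (gauge C Q) z = aut C (gaussTP Q z) := by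
  obtain ⟨A, B, hA, hB, rfl⟩ := hC.exists_blocks
  rw [gaussTP, gaussTP, aut_fromBlocks_diag hA hB, bM_gaugeA hA hB hQ hz,
    aM_gaugeA hA hB hQ hz.le, conj_mul_inv hB]
  simp [Matrix.nonsing_inv_mul _ hA, Matrix.nonsing_inv_mul _ hB]

theorem gaussTM_gaugeA (hz : z.im = 0) : gaussTM (gauge C Q) z = aut C (gaussTM Q z) := by
  obtain ⟨A, B, hA, hB, rfl⟩ := hC.exists_blocks
  rw [gaussTM, gaussTM, aut_fromBlocks_diag hA hB, bP_gaugeA hA hB hQ hz,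
    aP_gaugeA hA hB hQ hz.ge, conj_mul_inv hA]
  simp [Matrix.nonsing_inv_mul _ hA, Matrix.nonsing_inv_mul _ hB]

theorem gaussDP_gaugeA (hz : 0 ≤ z.im) : gaussDP (gauge C Q) z = aut C (gaussDP Q z) := by
  obtain ⟨A, B, hA, hB, rfl⟩ := hC.exists_blocks
  rw [gaussDP, gaussDP, aut_fromBlocks_diag hA hB, aP_gaugeA hA hB hQ hz,
    cP_gaugeA hA hB hQ hz, conj_inv hB]
  simp

theorem gaussDM_gaugeA (hz : z.im ≤ 0) : gaussDM (gauge C Q) z = aut C (gaussDM Q z) := by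
  obtain ⟨A, B, hA, hB, rfl⟩ := hC.exists_blocks
  rw [gaussDM, gaussDM, aut_fromBlocks_diag hA hB, aM_gaugeA hA hB hQ hz,
    cM_gaugeA hA hB hQ hz, conj_inv hA]
  simp

theorem det_aP_gaugeA (hz : 0 ≤ z.im) : (aP (gauge C Q) z).det = (aP Q z).det := by
  obtain ⟨A, B, hA, hB, rfl⟩ := hC.exists_blocks
  rw [aP_gaugeA hA hB hQ hz, det_conj hA]

theorem det_aM_gaugeA (hz : z.im ≤ 0) : (aM (gauge C Q) z).det = (aM Q z).det := by
  obtain ⟨A, B, hA, hB, rfl⟩ := hC.exists_blocks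
  rw [aM_gaugeA hA hB hQ hz, det_conj hB]

end ClassA

/-! #### Class B -/

theorem ClassB.exists_blocks (h : ClassB C) : ∃ A B : Blk r, IsUnit A.det ∧ IsUnit B.det ∧
    C = Matrix.fromBlocks 0 A B 0 := by
  obtain ⟨hC, hJ⟩ := h
  have h1 : J r * C = -(C * J r) := by
    rw [← Matrix.mul_neg, ← hJ, aut, Matrix.mul_assoc,
      Matrix.mul_nonsing_inv_cancel_left _ _ hC]
  have h2 := Matrix.mul_nonsing_inv C hC
  obtain ⟨X, A, B, Y, rfl⟩ : ∃ A X Y B : Blk r, C = Matrix.fromBlocks A X Y B :=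
    ⟨_, _, _, _, (Matrix.fromBlocks_toBlocks C).symm⟩
  rw [J, Matrix.fromBlocks_multiply, Matrix.fromBlocks_multiply, Matrix.fromBlocks_neg,
    Matrix.fromBlocks_inj] at h1
  have hX : X = 0 := eq_zero_of_eq_neg (by simpa using h1.1)
  have hY : Y = 0 := eq_zero_of_eq_neg (by simpa using h1.2.2.2.symm)
  subst hX hY
  -- The diagonal blocks of `C * C⁻¹ = 1` exhibit right inverses of `A` and `B`.
  rw [← Matrix.fromBlocks_toBlocks (Matrix.fromBlocks 0 A B 0)⁻¹, Matrix.fromBlocks_multiply,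
    ← Matrix.fromBlocks_one, Matrix.fromBlocks_inj] at h2
  exact ⟨A, B, Matrix.isUnit_det_of_right_inverse (by simpa using h2.1),
    Matrix.isUnit_det_of_right_inverse (by simpa using h2.2.2.2), rfl⟩

theorem ClassB.aut_J (h : ClassB C) : aut C (J r) = (-1 : ℂ) • J r := by
  rw [h.2, neg_smul, one_smul]

theorem ClassB.isUnit_blocks {A B : Blk r} (h : ClassB (Matrix.fromBlocks 0 A B 0)) :
    IsUnit A.det ∧ IsUnit B.det := by
  obtain ⟨A', B', hA, hB, h'⟩ := h.exists_blocks
  rw [Matrix.fromBlocks_inj] at h'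
  rw [h'.2.1, h'.2.2.1]
  exact ⟨hA, hB⟩

theorem aut_fromBlocks_antidiag {A B : Blk r} (hA : IsUnit A.det) (hB : IsUnit B.det) (a b c d : Blk r) :
    aut (Matrix.fromBlocks 0 A B 0) (Matrix.fromBlocks a b c d)
      = Matrix.fromBlocks (B⁻¹ * d * B) (B⁻¹ * c * A) (A⁻¹ * b * B) (A⁻¹ * a * A) := by
  have h : (Matrix.fromBlocks 0 A B 0 : BMat r)⁻¹ = Matrix.fromBlocks 0 B⁻¹ A⁻¹ 0 :=
    Matrix.inv_eq_right_inv (by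
      simp [Matrix.fromBlocks_multiply, Matrix.mul_nonsing_inv _ hA, Matrix.mul_nonsing_inv _ hB])
  rw [aut, h]
  simp [Matrix.fromBlocks_multiply]

section ClassB

variable {A B : Blk r} (hC : ClassB (Matrix.fromBlocks 0 A B 0)) (hQ : IsL1Potential Q)
include hC hQ

/-- An antidiagonal `C` exchanges the two eigenspaces of `J`, hence the two halves normalized at the
same end. The normalizing block is the one by which `C` maps the first eigenspace to the second. -/
theorem phiP_gaugeB (hz : 0 ≤ z.im) (x : ℝ) :
    phiP (gauge (Matrix.fromBlocks 0 A B 0) Q) z x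
      = (Matrix.fromBlocks 0 A B 0)⁻¹ * phiM Q (-z) x * B := by
  have := jostCols_gauge (E := Matrix.fromRows 1 0) (E' := Matrix.fromRows 0 1) (K := B) hQ
    hC.1 (Or.inr rfl) hC.aut_J (admissible_atBot_one hz)
    (by simpa using J_mul_fromRows_zero_one r)
    (by simp [Matrix.fromBlocks_mul_fromRows, Matrix.fromRows_mul]) x
  simp only [neg_mul, one_mul, mul_one] at this
  exact this

theorem psiM_gaugeB (hz : z.im ≤ 0) (x : ℝ) :
    psiM (gauge (Matrix.fromBlocks 0 A B 0) Q) z x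
      = (Matrix.fromBlocks 0 A B 0)⁻¹ * psiP Q (-z) x * B := by
  have := jostCols_gauge (E := Matrix.fromRows 1 0) (E' := Matrix.fromRows 0 1) (K := B) hQ
    hC.1 (Or.inr rfl) hC.aut_J (admissible_atTop_one hz)
    (by simpa using J_mul_fromRows_zero_one r)
    (by simp [Matrix.fromBlocks_mul_fromRows, Matrix.fromRows_mul]) x
  simp only [neg_mul, one_mul, mul_one] at this
  exact this

theorem phiM_gaugeB (hz : z.im ≤ 0) (x : ℝ) :
    phiM (gauge (Matrix.fromBlocks 0 A B 0) Q) z x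
      = (Matrix.fromBlocks 0 A B 0)⁻¹ * phiP Q (-z) x * A := by
  have := jostCols_gauge (E := Matrix.fromRows 0 1) (E' := Matrix.fromRows 1 0) (K := A) hQ
    hC.1 (Or.inr rfl) hC.aut_J (admissible_atBot_neg_one hz)
    (by simpa using J_mul_fromRows_one_zero r)
    (by simp [Matrix.fromBlocks_mul_fromRows, Matrix.fromRows_mul]) x
  simp only [neg_mul, one_mul, neg_neg] at this
  exact this

theorem psiP_gaugeB (hz : 0 ≤ z.im) (x : ℝ) :
    psiP (gauge (Matrix.fromBlocks 0 A B 0) Q) z x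
      = (Matrix.fromBlocks 0 A B 0)⁻¹ * psiM Q (-z) x * A := by
  have := jostCols_gauge (E := Matrix.fromRows 0 1) (E' := Matrix.fromRows 1 0) (K := A) hQ
    hC.1 (Or.inr rfl) hC.aut_J (admissible_atTop_neg_one hz)
    (by simpa using J_mul_fromRows_one_zero r)
    (by simp [Matrix.fromBlocks_mul_fromRows, Matrix.fromRows_mul]) x
  simp only [neg_mul, one_mul, neg_neg] at this
  exact this

theorem phiInvM_gaugeB (hz : z.im ≤ 0) (x : ℝ) :
    phiInvM (gauge (Matrix.fromBlocks 0 A B 0) Q) z x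
      = B⁻¹ * phiInvP Q (-z) x * Matrix.fromBlocks 0 A B 0 := by
  have := jostRows_gauge (E := Matrix.fromCols 1 0) (E' := Matrix.fromCols 0 1) (K := B⁻¹) hQ
    hC.1 (Or.inr rfl) hC.aut_J (admissible_atBot_one (by simpa using hz))
    (by simpa using fromCols_zero_one_mul_J r)
    (by simp [Matrix.fromCols_mul_fromBlocks, Matrix.mul_fromCols,
      Matrix.nonsing_inv_mul _ hC.isUnit_blocks.2]) x
  simp only [neg_mul, one_mul, mul_one] at this
  exact this

theorem psiInvP_gaugeB (hz : 0 ≤ z.im) (x : ℝ) :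
    psiInvP (gauge (Matrix.fromBlocks 0 A B 0) Q) z x
      = B⁻¹ * psiInvM Q (-z) x * Matrix.fromBlocks 0 A B 0 := by
  have := jostRows_gauge (E := Matrix.fromCols 1 0) (E' := Matrix.fromCols 0 1) (K := B⁻¹) hQ
    hC.1 (Or.inr rfl) hC.aut_J (admissible_atTop_one (by simpa using hz))
    (by simpa using fromCols_zero_one_mul_J r)
    (by simp [Matrix.fromCols_mul_fromBlocks, Matrix.mul_fromCols,
      Matrix.nonsing_inv_mul _ hC.isUnit_blocks.2]) x
  simp only [neg_mul, one_mul, mul_one] at this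
  exact this

theorem phiInvP_gaugeB (hz : 0 ≤ z.im) (x : ℝ) :
    phiInvP (gauge (Matrix.fromBlocks 0 A B 0) Q) z x
      = A⁻¹ * phiInvM Q (-z) x * Matrix.fromBlocks 0 A B 0 := by
  have := jostRows_gauge (E := Matrix.fromCols 0 1) (E' := Matrix.fromCols 1 0) (K := A⁻¹) hQ
    hC.1 (Or.inr rfl) hC.aut_J (admissible_atBot_neg_one (by simpa using hz))
    (by simpa using fromCols_one_zero_mul_J r)
    (by simp [Matrix.fromCols_mul_fromBlocks, Matrix.mul_fromCols,
      Matrix.nonsing_inv_mul _ hC.isUnit_blocks.1]) x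
  simp only [neg_mul, one_mul, neg_neg] at this
  exact this

theorem psiInvM_gaugeB (hz : z.im ≤ 0) (x : ℝ) :
    psiInvM (gauge (Matrix.fromBlocks 0 A B 0) Q) z x
      = A⁻¹ * psiInvP Q (-z) x * Matrix.fromBlocks 0 A B 0 := by
  have := jostRows_gauge (E := Matrix.fromCols 0 1) (E' := Matrix.fromCols 1 0) (K := A⁻¹) hQ
    hC.1 (Or.inr rfl) hC.aut_J (admissible_atTop_neg_one (by simpa using hz))
    (by simpa using fromCols_one_zero_mul_J r)
    (by simp [Matrix.fromCols_mul_fromBlocks, Matrix.mul_fromCols,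
      Matrix.nonsing_inv_mul _ hC.isUnit_blocks.1]) x
  simp only [neg_mul, one_mul, neg_neg] at this
  exact this

theorem aP_gaugeB (hz : 0 ≤ z.im) :
    aP (gauge (Matrix.fromBlocks 0 A B 0) Q) z = B⁻¹ * aM Q (-z) * B := by
  rw [aP, psiInvP_gaugeB hC hQ hz, phiP_gaugeB hC hQ hz, gauge_pairing hC.1, aM]

theorem aM_gaugeB (hz : z.im ≤ 0) :
    aM (gauge (Matrix.fromBlocks 0 A B 0) Q) z = A⁻¹ * aP Q (-z) * A := by
  rw [aM, psiInvM_gaugeB hC hQ hz, phiM_gaugeB hC hQ hz, gauge_pairing hC.1, aP]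

theorem cP_gaugeB (hz : 0 ≤ z.im) :
    cP (gauge (Matrix.fromBlocks 0 A B 0) Q) z = A⁻¹ * cM Q (-z) * A := by
  rw [cP, phiInvP_gaugeB hC hQ hz, psiP_gaugeB hC hQ hz, gauge_pairing hC.1, cM]

theorem cM_gaugeB (hz : z.im ≤ 0) :
    cM (gauge (Matrix.fromBlocks 0 A B 0) Q) z = B⁻¹ * cP Q (-z) * B := by
  rw [cM, phiInvM_gaugeB hC hQ hz, psiM_gaugeB hC hQ hz, gauge_pairing hC.1, cP]

/-- The sign comes from the asymmetric definitions: `b⁻` carries a minus sign and `b⁺` does not. -/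
theorem bP_gaugeB (hz : z.im = 0) :
    bP (gauge (Matrix.fromBlocks 0 A B 0) Q) z = -(A⁻¹ * bM Q (-z) * B) := by
  rw [bP, psiInvM_gaugeB hC hQ hz.le, phiP_gaugeB hC hQ hz.ge, gauge_pairing hC.1, bM, Matrix.mul_neg, Matrix.neg_mul, neg_neg]

theorem bM_gaugeB (hz : z.im = 0) :
    bM (gauge (Matrix.fromBlocks 0 A B 0) Q) z = -(B⁻¹ * bP Q (-z) * A) := by
  rw [bM, psiInvP_gaugeB hC hQ hz.ge, phiM_gaugeB hC hQ hz.le, gauge_pairing hC.1, bP]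

theorem dP_gaugeB (hz : z.im = 0) :
    dP (gauge (Matrix.fromBlocks 0 A B 0) Q) z = -(A⁻¹ * dM Q (-z) * B) := by
  rw [dP, phiInvP_gaugeB hC hQ hz.ge, psiM_gaugeB hC hQ hz.le, gauge_pairing hC.1, dM]

theorem dM_gaugeB (hz : z.im = 0) :
    dM (gauge (Matrix.fromBlocks 0 A B 0) Q) z = -(B⁻¹ * dP Q (-z) * A) := by
  rw [dM, phiInvM_gaugeB hC hQ hz.le, psiP_gaugeB hC hQ hz.ge, gauge_pairing hC.1, dP, Matrix.mul_neg, Matrix.neg_mul, neg_neg]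

end ClassB

section ClassB

variable (hC : ClassB C) (hQ : IsL1Potential Q)
include hC hQ

theorem scatT_gaugeB (hz : z.im = 0) : scatT (gauge C Q) z = aut C (scatT Q (-z)) := by
  obtain ⟨A, B, hA, hB, rfl⟩ := hC.exists_blocks
  rw [scatT, scatT, aut_fromBlocks_antidiag hA hB,
    aP_gaugeB hC hQ hz.ge, aM_gaugeB hC hQ hz.le, bP_gaugeB hC hQ hz, bM_gaugeB hC hQ hz]
  simp

theorem gaussSP_gaugeB (hz : z.im = 0) : gaussSP (gauge C Q) z = aut C (gaussSM Q (-z)) := by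
  obtain ⟨A, B, hA, hB, rfl⟩ := hC.exists_blocks
  rw [gaussSP, gaussSM, aut_fromBlocks_antidiag hA hB,
    dM_gaugeB hC hQ hz, cP_gaugeB hC hQ hz.ge, Matrix.neg_mul, conj_mul_inv hA]
  simp [Matrix.nonsing_inv_mul _ hA, Matrix.nonsing_inv_mul _ hB]

theorem gaussSM_gaugeB (hz : z.im = 0) : gaussSM (gauge C Q) z = aut C (gaussSP Q (-z)) := by
  obtain ⟨A, B, hA, hB, rfl⟩ := hC.exists_blocks
  rw [gaussSM, gaussSP, aut_fromBlocks_antidiag hA hB,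
    dP_gaugeB hC hQ hz, cM_gaugeB hC hQ hz.le, Matrix.neg_mul, conj_mul_inv hB]
  simp [Matrix.nonsing_inv_mul _ hA, Matrix.nonsing_inv_mul _ hB]

theorem gaussTP_gaugeB (hz : z.im = 0) : gaussTP (gauge C Q) z = aut C (gaussTM Q (-z)) := by
  obtain ⟨A, B, hA, hB, rfl⟩ := hC.exists_blocks
  rw [gaussTP, gaussTM, aut_fromBlocks_antidiag hA hB,
    bM_gaugeB hC hQ hz, aM_gaugeB hC hQ hz.le, Matrix.neg_mul, conj_mul_inv hA]
  simp [Matrix.nonsing_inv_mul _ hA, Matrix.nonsing_inv_mul _ hB]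

theorem gaussTM_gaugeB (hz : z.im = 0) : gaussTM (gauge C Q) z = aut C (gaussTP Q (-z)) := by
  obtain ⟨A, B, hA, hB, rfl⟩ := hC.exists_blocks
  rw [gaussTM, gaussTP, aut_fromBlocks_antidiag hA hB,
    bP_gaugeB hC hQ hz, aP_gaugeB hC hQ hz.ge, Matrix.neg_mul, conj_mul_inv hB]
  simp [Matrix.nonsing_inv_mul _ hA, Matrix.nonsing_inv_mul _ hB]

theorem gaussDP_gaugeB (hz : 0 ≤ z.im) : gaussDP (gauge C Q) z = aut C (gaussDM Q (-z)) := by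
  obtain ⟨A, B, hA, hB, rfl⟩ := hC.exists_blocks
  rw [gaussDP, gaussDM, aut_fromBlocks_antidiag hA hB,
    aP_gaugeB hC hQ hz, cP_gaugeB hC hQ hz, conj_inv hA]
  simp

theorem gaussDM_gaugeB (hz : z.im ≤ 0) : gaussDM (gauge C Q) z = aut C (gaussDP Q (-z)) := by
  obtain ⟨A, B, hA, hB, rfl⟩ := hC.exists_blocks
  rw [gaussDM, gaussDP, aut_fromBlocks_antidiag hA hB,
    aM_gaugeB hC hQ hz, cM_gaugeB hC hQ hz, conj_inv hB]
  simp

theorem det_aP_gaugeB (hz : 0 ≤ z.im) : (aP (gauge C Q) z).det = (aM Q (-z)).det := by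
  obtain ⟨A, B, hA, hB, rfl⟩ := hC.exists_blocks
  rw [aP_gaugeB hC hQ hz, det_conj hB]

theorem det_aM_gaugeB (hz : z.im ≤ 0) : (aM (gauge C Q) z).det = (aP Q (-z)).det := by
  obtain ⟨A, B, hA, hB, rfl⟩ := hC.exists_blocks
  rw [aM_gaugeB hC hQ hz, det_conj hA]

end ClassB

end Gauge

/-! ### Reductions -/

section Reductions

variable {r : ℕ} {Q : ℝ → BMat r} {z : ℂ} {C : BMat r}

theorem ClassA.aut_J (h : ClassA C) : aut C (J r) = (1 : ℂ) • J r := by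
  rw [h.2, one_smul]

/-! #### Block types -/

theorem ClassA.aut_block (hC : ClassA C) (X : BMat r) :
    (BlockUpper X → BlockUpper (aut C X)) ∧ (BlockLower X → BlockLower (aut C X)) ∧
    (UnitDiag X → UnitDiag (aut C X)) := by
  obtain ⟨A, B, hA, hB, rfl⟩ := hC.exists_blocks
  obtain ⟨a, b, c, d, rfl⟩ : ∃ a b c d : Blk r, X = Matrix.fromBlocks a b c d :=
    ⟨_, _, _, _, (Matrix.fromBlocks_toBlocks X).symm⟩
  rw [aut_fromBlocks_diag hA hB]
  simp only [BlockUpper, BlockLower, UnitDiag, Matrix.toBlocks_fromBlocks₂₁,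
    Matrix.toBlocks_fromBlocks₁₂, Matrix.toBlocks_fromBlocks₁₁, Matrix.toBlocks_fromBlocks₂₂]
  refine ⟨?_, ?_, ?_⟩
  · rintro rfl
    simp
  · rintro rfl
    simp
  · rintro ⟨rfl, rfl⟩
    simp [Matrix.nonsing_inv_mul _ hA, Matrix.nonsing_inv_mul _ hB]

theorem ClassB.aut_block (hC : ClassB C) (X : BMat r) :
    (BlockUpper X → BlockLower (aut C X)) ∧ (BlockLower X → BlockUpper (aut C X)) ∧
    (UnitDiag X → UnitDiag (aut C X)) := by
  obtain ⟨A, B, hA, hB, rfl⟩ := hC.exists_blocks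
  obtain ⟨a, b, c, d, rfl⟩ : ∃ a b c d : Blk r, X = Matrix.fromBlocks a b c d :=
    ⟨_, _, _, _, (Matrix.fromBlocks_toBlocks X).symm⟩
  rw [aut_fromBlocks_antidiag hA hB]
  simp only [BlockUpper, BlockLower, UnitDiag, Matrix.toBlocks_fromBlocks₂₁,
    Matrix.toBlocks_fromBlocks₁₂, Matrix.toBlocks_fromBlocks₁₁, Matrix.toBlocks_fromBlocks₂₂]
  refine ⟨?_, ?_, ?_⟩
  · rintro rfl
    simp
  · rintro rfl
    simp
  · rintro ⟨rfl, rfl⟩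
    simp [Matrix.nonsing_inv_mul _ hA, Matrix.nonsing_inv_mul _ hB]

/-! #### The action on the potential and on the spectral parameter -/

theorem IsPotential.J_mul_mul_J (hQ : IsPotential Q) (x : ℝ) : J r * Q x * J r = -Q x := by
  have h : Q x = Matrix.fromBlocks 0 (Q x).toBlocks₁₂ (Q x).toBlocks₂₁ 0 := by
    conv_lhs => rw [← Matrix.fromBlocks_toBlocks (Q x), hQ.block₁₁, hQ.block₂₂]
  rw [h, J]
  simp [Matrix.fromBlocks_multiply, Matrix.fromBlocks_neg]

theorem smul_J_injective (hr : 0 < r) {c d : ℂ} (h : c • J r = d • J r) : c = d := by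
  have := congrFun (congrFun h (Sum.inl ⟨0, hr⟩)) (Sum.inl ⟨0, hr⟩)
  simpa [J] using this

/-- `aut C` maps `J` to a sign times `J`, so it keeps the oddness of `Y` under `X ↦ J X J`. The
difference `aut C Y - X` is thus odd, yet equal to a multiple of `J`, which is even; both vanish.
Positivity of `r` makes `J` nonzero, which determines `μ`. -/
theorem reduction_split (hr : 0 < r) (hC : IsUnit C.det) {ε : ℂ} (hε : ε * ε = 1)
    (hJ : aut C (J r) = ε • J r) {X Y : BMat r} (hX : J r * X * J r = -X)
    (hY : J r * Y * J r = -Y) {μ z : ℂ} (h : aut C (Y - μ • J r) = X - z • J r) :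
    aut C Y = X ∧ μ = ε * z := by
  have h1 : aut C (Y - μ • J r) = aut C Y - (μ * ε) • J r := by
    rw [← smul_smul, ← hJ]
    simp only [aut, Matrix.mul_sub, Matrix.sub_mul, Matrix.mul_smul, Matrix.smul_mul]
  have hJ' : J r = ε • aut C (J r) := by rw [hJ, smul_smul, hε, one_smul]
  have h2 : J r * aut C Y * J r = -aut C Y := by
    conv_lhs => rw [hJ']
    rw [Matrix.smul_mul, Matrix.smul_mul, Matrix.mul_smul, smul_smul, hε, one_smul,
      ← aut_mul hC, ← aut_mul hC, hY]
    simp [aut]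
  have h3 : aut C Y - X = (μ * ε - z) • J r := by
    rw [h1] at h
    rw [sub_smul, sub_eq_sub_iff_add_eq_add, add_comm _ X, ← sub_eq_sub_iff_add_eq_add] at *
    exact h
  have h4 : J r * (aut C Y - X) * J r = -(aut C Y - X) := by
    rw [Matrix.mul_sub, Matrix.sub_mul, h2, hX]
    abel
  have h5 : aut C Y - X = 0 := by
    refine eq_zero_of_eq_neg ?_
    conv_lhs => rw [h3]
    rw [← h4, h3, Matrix.mul_smul, Matrix.smul_mul, J_mul_J, Matrix.one_mul]
  refine ⟨sub_eq_zero.1 h5, ?_⟩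
  have h6 : μ * ε = z := smul_J_injective hr (by
    rw [← sub_eq_zero, ← sub_smul, ← h3, h5])
  rw [← h6, mul_left_comm, hε, mul_one]

/-- The two minus signs cancel, so reduction a) is built from the transformations for b) and c). -/
theorem conjTranspose_eq_negConj_negTranspose :
    (fun x => (Q x)ᴴ) = negConj (negTranspose Q) := by
  funext x
  ext i j
  simp [negConj, negTranspose, cc]

section Potential

variable (hr : 0 < r) (hQ : IsPotential Q) (hC : IsUnit C.det) {ε : ℂ} (hε : ε = 1 ∨ ε = -1)
  (hJ : aut C (J r) = ε • J r) {κ : ℂ → ℂ}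
include hr hQ hC hε hJ

theorem Reduction1.split (h : Reduction1 Q C κ) :
    (∀ z, κ z = ε * conj z) ∧ Q = gauge C (negConj (negTranspose Q)) := by
  have hε' : ε * ε = 1 := by rcases hε with rfl | rfl <;> norm_num
  have hJH : (J r)ᴴ = J r := by simp [J, Matrix.fromBlocks_conjTranspose]
  have key : ∀ x z, aut C (Q x)ᴴ = Q x ∧ conj (κ z) = ε * z := fun x z => by
    refine reduction_split hr hC hε' hJ (hQ.J_mul_mul_J x) ?_ ?_
    · have := congrArg Matrix.conjTranspose (hQ.J_mul_mul_J x)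
      rw [Matrix.conjTranspose_mul, Matrix.conjTranspose_mul, hJH, Matrix.conjTranspose_neg,
        ← Matrix.mul_assoc] at this
      exact this
    · rw [← show laxU Q z x = Q x - z • J r from rfl, ← h x z, laxU, Matrix.conjTranspose_sub,
        Matrix.conjTranspose_smul, hJH]
      rfl
  refine ⟨fun z => ?_, ?_⟩
  · have h1 := congrArg conj (key 0 z).2
    rw [Complex.conj_conj, map_mul, conj_of_sign hε] at h1
    exact h1
  · rw [← conjTranspose_eq_negConj_negTranspose]
    exact funext fun x => (key x 0).1.symm

theorem Reduction2.split (h : Reduction2 Q C κ) :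
    (∀ z, κ z = -(ε * z)) ∧ Q = gauge C (negTranspose Q) := by
  have hε' : ε * ε = 1 := by rcases hε with rfl | rfl <;> norm_num
  have key : ∀ x z, aut C (-(Q x)ᵀ) = Q x ∧ -κ z = ε * z := fun x z => by
    refine reduction_split hr hC hε' hJ (hQ.J_mul_mul_J x) ?_ ?_
    · have := congrArg Matrix.transpose (hQ.J_mul_mul_J x)
      rw [Matrix.transpose_mul, Matrix.transpose_mul, J_transpose, Matrix.transpose_neg,
        ← Matrix.mul_assoc] at this
      rw [Matrix.mul_neg, Matrix.neg_mul, this]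
    · rw [← show laxU Q z x = Q x - z • J r from rfl, ← neg_neg (laxU Q z x), ← h x z, laxU,
        Matrix.transpose_sub, Matrix.transpose_smul, J_transpose, neg_smul, sub_neg_eq_add,
        neg_add_eq_sub, ← neg_sub]
      simp only [aut, Matrix.mul_neg, Matrix.neg_mul]
  exact ⟨fun z => neg_eq_iff_eq_neg.1 (key 0 z).2, funext fun x => (key x 0).1.symm⟩

theorem Reduction3.split (h : Reduction3 Q C κ) :
    (∀ z, κ z = -(ε * conj z)) ∧ Q = gauge C (negConj Q) := by
  have hε' : ε * ε = 1 := by rcases hε with rfl | rfl <;> norm_num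
  have key : ∀ x z, aut C (-cc (Q x)) = Q x ∧ -conj (κ z) = ε * z := fun x z => by
    refine reduction_split hr hC hε' hJ (hQ.J_mul_mul_J x) ?_ ?_
    · have := congrArg cc (hQ.J_mul_mul_J x)
      rw [cc, cc, Matrix.map_mul, Matrix.map_mul, ← cc, cc_J, Matrix.map_neg _ (map_neg _)] at this
      rw [Matrix.mul_neg, Matrix.neg_mul, cc, this]
    · have h1 := laxU_negConj (Q := Q) (z := κ z) x
      rw [← show laxU Q z x = Q x - z • J r from rfl, ← neg_neg (laxU Q z x), ← h x z,
        ← show laxU (negConj Q) (-conj (κ z)) x = -cc (Q x) - (-conj (κ z)) • J r from rfl, h1]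
      simp [aut]
  refine ⟨fun z => ?_, funext fun x => (key x 0).1.symm⟩
  have h1 := congrArg conj (key 0 z).2
  rw [map_neg, Complex.conj_conj, map_mul, conj_of_sign hε] at h1
  exact neg_eq_iff_eq_neg.1 h1

theorem Reduction4.split (h : Reduction4 Q C κ) :
    (∀ z, κ z = ε * z) ∧ Q = gauge C Q := by
  have hε' : ε * ε = 1 := by rcases hε with rfl | rfl <;> norm_num
  have key : ∀ x z, aut C (Q x) = Q x ∧ κ z = ε * z := fun x z =>
    reduction_split hr hC hε' hJ (hQ.J_mul_mul_J x) (hQ.J_mul_mul_J x) (h x z)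
  exact ⟨fun z => (key 0 z).2, funext fun x => (key x 0).1.symm⟩

end Potential

/-! #### Regular points -/

theorem RealRegular.of_negConj (hQ : IsL1Potential Q) (h : RealRegular (negConj Q) z) :
    RealRegular Q (-conj z) := by
  refine ⟨by simpa using h.1, ?_, ?_⟩
  · simpa [det_aP_negConj hQ h.1.ge] using h.2.1
  · simpa [det_aM_negConj hQ h.1.le] using h.2.2

theorem UpperRegular.of_negConj (hQ : IsL1Potential Q) (h : UpperRegular (negConj Q) z) :
    UpperRegular Q (-conj z) :=
  ⟨by simpa using h.1, by simpa [det_aP_negConj hQ h.1] using h.2⟩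

theorem LowerRegular.of_negConj (hQ : IsL1Potential Q) (h : LowerRegular (negConj Q) z) :
    LowerRegular Q (-conj z) :=
  ⟨by simpa using h.1, by simpa [det_aM_negConj hQ h.1] using h.2⟩

theorem RealRegular.of_gaugeA (hC : ClassA C) (hQ : IsL1Potential Q)
    (h : RealRegular (gauge C Q) z) : RealRegular Q z :=
  ⟨h.1, by simpa [det_aP_gaugeA hC hQ h.1.ge] using h.2.1,
    by simpa [det_aM_gaugeA hC hQ h.1.le] using h.2.2⟩

theorem LowerRegular.of_gaugeA (hC : ClassA C) (hQ : IsL1Potential Q)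
    (h : LowerRegular (gauge C Q) z) : LowerRegular Q z :=
  ⟨h.1, by simpa [det_aM_gaugeA hC hQ h.1] using h.2⟩

theorem RealRegular.of_gaugeB (hC : ClassB C) (hQ : IsL1Potential Q)
    (h : RealRegular (gauge C Q) z) : RealRegular Q (-z) :=
  ⟨by simpa using h.1, by simpa [det_aM_gaugeB hC hQ h.1.le] using h.2.2,
    by simpa [det_aP_gaugeB hC hQ h.1.ge] using h.2.1⟩

theorem UpperRegular.of_gaugeB (hC : ClassB C) (hQ : IsL1Potential Q)
    (h : UpperRegular (gauge C Q) z) : LowerRegular Q (-z) :=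
  ⟨by simpa using h.1, by simpa [det_aP_gaugeB hC hQ h.1] using h.2⟩

theorem LowerRegular.of_gaugeB (hC : ClassB C) (hQ : IsL1Potential Q)
    (h : LowerRegular (gauge C Q) z) : UpperRegular Q (-z) :=
  ⟨by simpa using h.1, by simpa [det_aM_gaugeB hC hQ h.1] using h.2⟩

/-! #### Inverses of transposed data -/

theorem inv_eq_of_eq_inv_transpose {X Y : BMat r} (hY : IsUnit Y.det) (h : X = (Y⁻¹)ᵀ) :
    X⁻¹ = Yᵀ := by
  rw [h, ← Matrix.transpose_nonsing_inv, Matrix.nonsing_inv_nonsing_inv _ hY]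

theorem isUnit_det_upper (X : Blk r) : IsUnit (Matrix.fromBlocks 1 X 0 1 : BMat r).det := by
  simp

theorem isUnit_det_lower (X : Blk r) : IsUnit (Matrix.fromBlocks 1 0 X 1 : BMat r).det := by
  simp

section

variable (hQ : IsL1Potential Q)
include hQ

theorem scatT_negTranspose_inv (hz : z.im = 0) :
    (scatT (negTranspose Q) z)⁻¹ = (scatT Q (-z))ᵀ :=
  inv_eq_of_eq_inv_transpose
    (Matrix.isUnit_det_of_right_inverse (scatT_mul_inv hQ (by simpa using hz)))
    (scatT_negTranspose hQ hz)

theorem gaussSP_negTranspose_inv (h : RealRegular (negTranspose Q) z) :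
    (gaussSP (negTranspose Q) z)⁻¹ = (gaussSM Q (-z))ᵀ :=
  inv_eq_of_eq_inv_transpose (isUnit_det_lower _) (gaussSP_negTranspose hQ h)

theorem gaussSM_negTranspose_inv (h : RealRegular (negTranspose Q) z) :
    (gaussSM (negTranspose Q) z)⁻¹ = (gaussSP Q (-z))ᵀ :=
  inv_eq_of_eq_inv_transpose (isUnit_det_upper _) (gaussSM_negTranspose hQ h)

theorem gaussTP_negTranspose_inv (h : RealRegular (negTranspose Q) z) :
    (gaussTP (negTranspose Q) z)⁻¹ = (gaussTM Q (-z))ᵀ :=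
  inv_eq_of_eq_inv_transpose (isUnit_det_lower _) (gaussTP_negTranspose hQ h)

theorem gaussTM_negTranspose_inv (h : RealRegular (negTranspose Q) z) :
    (gaussTM (negTranspose Q) z)⁻¹ = (gaussTP Q (-z))ᵀ :=
  inv_eq_of_eq_inv_transpose (isUnit_det_upper _) (gaussTM_negTranspose hQ h)

theorem isUnit_det_gaussDP (hz : 0 ≤ z.im) (h : (aP Q z).det ≠ 0) :
    IsUnit (gaussDP Q z).det := by
  have h' : (cP Q z).det ≠ 0 := fun h' => h ((det_aP_eq_zero_iff hQ hz).2 h')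
  rw [gaussDP, Matrix.det_fromBlocks_zero₂₁]
  exact (isUnit_iff_ne_zero.2 h).mul
    (Matrix.isUnit_nonsing_inv_det _ (isUnit_iff_ne_zero.2 h'))

theorem isUnit_det_gaussDM (hz : z.im ≤ 0) (h : (aM Q z).det ≠ 0) :
    IsUnit (gaussDM Q z).det := by
  have h' : (cM Q z).det ≠ 0 := fun h' => h ((det_aM_eq_zero_iff hQ hz).2 h')
  rw [gaussDM, Matrix.det_fromBlocks_zero₂₁]
  exact (Matrix.isUnit_nonsing_inv_det _ (isUnit_iff_ne_zero.2 h')).mul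
    (isUnit_iff_ne_zero.2 h)

theorem gaussDP_negTranspose_inv (h : UpperRegular (negTranspose Q) z) :
    (gaussDP (negTranspose Q) z)⁻¹ = (gaussDM Q (-z))ᵀ := by
  have hz' : (-z).im ≤ 0 := by simpa using h.1
  have h1 := h.2
  rw [aP_negTranspose hQ h.1, Matrix.det_transpose] at h1
  exact inv_eq_of_eq_inv_transpose
    (isUnit_det_gaussDM hQ hz' fun h2 => h1 ((det_aM_eq_zero_iff hQ hz').1 h2))
    (gaussDP_negTranspose hQ h)

theorem gaussDM_negTranspose_inv (h : LowerRegular (negTranspose Q) z) :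
    (gaussDM (negTranspose Q) z)⁻¹ = (gaussDP Q (-z))ᵀ := by
  have hz' : 0 ≤ (-z).im := by simpa using h.1
  have h1 := h.2
  rw [aM_negTranspose hQ h.1, Matrix.det_transpose] at h1
  exact inv_eq_of_eq_inv_transpose
    (isUnit_det_gaussDP hQ hz' fun h2 => h1 ((det_aP_eq_zero_iff hQ hz').1 h2))
    (gaussDM_negTranspose hQ h)

end

theorem cc_inv (X : BMat r) : (cc X)⁻¹ = cc X⁻¹ := (map_conj_inv X).symm

theorem cc_transpose (X : BMat r) : cc Xᵀ = Xᴴ := rfl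

/-- The inverse of a datum of the form `C(X*)`. -/
theorem aut_cc_inv (hC : IsUnit C.det) {X Y : BMat r} (h : X⁻¹ = Yᵀ) :
    (aut C (cc X))⁻¹ = aut C Yᴴ := by
  rw [aut_inv hC, cc_inv, h, cc_transpose]

theorem aut_transpose_inv (hC : IsUnit C.det) {X Y : BMat r} (h : X⁻¹ = Yᵀ) :
    (aut C X)⁻¹ = aut C Yᵀ := by
  rw [aut_inv hC, h]

/-! #### Class A -/

section ClassA

variable (hC : ClassA C) (hQ : IsL1Potential Q)
include hC hQ

theorem ClassA.scattering_dagger (hg : Q = gauge C (negConj (negTranspose Q))) :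
    (∀ z : ℂ, z.im = 0 → aut C (scatT Q (conj z))ᴴ = (scatT Q z)⁻¹) ∧
    (∀ z, RealRegular Q z → aut C (gaussSP Q (conj z))ᴴ = (gaussSM Q z)⁻¹ ∧
      aut C (gaussTM Q (conj z))ᴴ = (gaussTP Q z)⁻¹) ∧
    (∀ z, LowerRegular Q z → aut C (gaussDP Q (conj z))ᴴ = (gaussDM Q z)⁻¹) := by
  have hQ₂ := isL1Potential_negTranspose hQ
  have hQ₁ := isL1Potential_negConj hQ₂
  refine ⟨fun z hz => ?_, fun z h => ?_, fun z h => ?_⟩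
  -- `hg` expresses `Q` through itself, so it is unfolded on one side only. The point moves from `z`
  -- to `-conj z` by conjugation and to `conj z` by transposition.
  · conv_rhs => rw [hg, scatT_gaugeA hC hQ₁ hz, scatT_negConj hQ₂ hz]
    rw [aut_cc_inv hC.1 (scatT_negTranspose_inv hQ (by simpa using hz)), neg_neg]
  · have h' := h
    rw [hg] at h'
    replace h' := (h'.of_gaugeA hC hQ₁).of_negConj hQ₂
    constructor
    · conv_rhs => rw [hg, gaussSM_gaugeA hC hQ₁ h.1, gaussSM_negConj hQ₂ h.1]
      rw [aut_cc_inv hC.1 (gaussSM_negTranspose_inv hQ h'), neg_neg]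
    · conv_rhs => rw [hg, gaussTP_gaugeA hC hQ₁ h.1, gaussTP_negConj hQ₂ h.1]
      rw [aut_cc_inv hC.1 (gaussTP_negTranspose_inv hQ h'), neg_neg]
  · have h' := h
    rw [hg] at h'
    replace h' := (h'.of_gaugeA hC hQ₁).of_negConj hQ₂
    conv_rhs => rw [hg, gaussDM_gaugeA hC hQ₁ h.1, gaussDM_negConj hQ₂ h.1]
    rw [aut_cc_inv hC.1 (gaussDM_negTranspose_inv hQ h'), neg_neg]

theorem ClassA.scattering_transpose (hg : Q = gauge C (negTranspose Q)) :
    (∀ z : ℂ, z.im = 0 → aut C (scatT Q (-z))ᵀ = (scatT Q z)⁻¹) ∧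
    (∀ z, RealRegular Q z → aut C (gaussSP Q (-z))ᵀ = (gaussSM Q z)⁻¹ ∧
      aut C (gaussTM Q (-z))ᵀ = (gaussTP Q z)⁻¹) ∧
    (∀ z, LowerRegular Q z → aut C (gaussDP Q (-z))ᵀ = (gaussDM Q z)⁻¹) := by
  have hQ₂ := isL1Potential_negTranspose hQ
  refine ⟨fun z hz => ?_, fun z h => ?_, fun z h => ?_⟩
  · conv_rhs => rw [hg, scatT_gaugeA hC hQ₂ hz]
    rw [aut_transpose_inv hC.1 (scatT_negTranspose_inv hQ hz)]
  · have h' := h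
    rw [hg] at h'
    replace h' := h'.of_gaugeA hC hQ₂
    constructor
    · conv_rhs => rw [hg, gaussSM_gaugeA hC hQ₂ h.1]
      rw [aut_transpose_inv hC.1 (gaussSM_negTranspose_inv hQ h')]
    · conv_rhs => rw [hg, gaussTP_gaugeA hC hQ₂ h.1]
      rw [aut_transpose_inv hC.1 (gaussTP_negTranspose_inv hQ h')]
  · have h' := h
    rw [hg] at h'
    replace h' := h'.of_gaugeA hC hQ₂
    conv_rhs => rw [hg, gaussDM_gaugeA hC hQ₂ h.1]
    rw [aut_transpose_inv hC.1 (gaussDM_negTranspose_inv hQ h')]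

theorem ClassA.scattering_conj (hg : Q = gauge C (negConj Q)) :
    (∀ z : ℂ, z.im = 0 → aut C (cc (scatT Q (-conj z))) = scatT Q z) ∧
    (∀ z, RealRegular Q z → aut C (cc (gaussSP Q (-conj z))) = gaussSP Q z ∧
      aut C (cc (gaussSM Q (-conj z))) = gaussSM Q z ∧
      aut C (cc (gaussTP Q (-conj z))) = gaussTP Q z ∧
      aut C (cc (gaussTM Q (-conj z))) = gaussTM Q z) ∧
    (∀ z, UpperRegular Q z → aut C (cc (gaussDP Q (-conj z))) = gaussDP Q z) ∧
    (∀ z, LowerRegular Q z → aut C (cc (gaussDM Q (-conj z))) = gaussDM Q z) := by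
  have hQ₁ := isL1Potential_negConj hQ
  refine ⟨fun z hz => ?_, fun z h => ⟨?_, ?_, ?_, ?_⟩, fun z h => ?_, fun z h => ?_⟩
  · conv_rhs => rw [hg, scatT_gaugeA hC hQ₁ hz, scatT_negConj hQ hz]
  · conv_rhs => rw [hg, gaussSP_gaugeA hC hQ₁ h.1, gaussSP_negConj hQ h.1]
  · conv_rhs => rw [hg, gaussSM_gaugeA hC hQ₁ h.1, gaussSM_negConj hQ h.1]
  · conv_rhs => rw [hg, gaussTP_gaugeA hC hQ₁ h.1, gaussTP_negConj hQ h.1]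
  · conv_rhs => rw [hg, gaussTM_gaugeA hC hQ₁ h.1, gaussTM_negConj hQ h.1]
  · conv_rhs => rw [hg, gaussDP_gaugeA hC hQ₁ h.1, gaussDP_negConj hQ h.1]
  · conv_rhs => rw [hg, gaussDM_gaugeA hC hQ₁ h.1, gaussDM_negConj hQ h.1]

theorem ClassA.scattering_self (hg : Q = gauge C Q) :
    (∀ z : ℂ, z.im = 0 → aut C (scatT Q z) = scatT Q z) ∧
    (∀ z, RealRegular Q z → aut C (gaussSP Q z) = gaussSP Q z ∧
      aut C (gaussSM Q z) = gaussSM Q z ∧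
      aut C (gaussTP Q z) = gaussTP Q z ∧
      aut C (gaussTM Q z) = gaussTM Q z) ∧
    (∀ z, UpperRegular Q z → aut C (gaussDP Q z) = gaussDP Q z) ∧
    (∀ z, LowerRegular Q z → aut C (gaussDM Q z) = gaussDM Q z) := by
  refine ⟨fun z hz => ?_, fun z h => ⟨?_, ?_, ?_, ?_⟩, fun z h => ?_, fun z h => ?_⟩
  · conv_rhs => rw [hg, scatT_gaugeA hC hQ hz]
  · conv_rhs => rw [hg, gaussSP_gaugeA hC hQ h.1]
  · conv_rhs => rw [hg, gaussSM_gaugeA hC hQ h.1]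
  · conv_rhs => rw [hg, gaussTP_gaugeA hC hQ h.1]
  · conv_rhs => rw [hg, gaussTM_gaugeA hC hQ h.1]
  · conv_rhs => rw [hg, gaussDP_gaugeA hC hQ h.1]
  · conv_rhs => rw [hg, gaussDM_gaugeA hC hQ h.1]

end ClassA

/-! #### Class B -/

section ClassB

variable (hC : ClassB C) (hQ : IsL1Potential Q)
include hC hQ

/-- Transposition and a class B gauge each exchange the superscripts `+` and `-`. Here both occur,
so each Gauss factor is related to itself; with exactly one of them, as in class A a), b) or class B
c), d), it is related to its partner. -/
theorem ClassB.scattering_dagger (hg : Q = gauge C (negConj (negTranspose Q))) :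
    (∀ z : ℂ, z.im = 0 → aut C (scatT Q (-conj z))ᴴ = (scatT Q z)⁻¹) ∧
    (∀ z, RealRegular Q z → aut C (gaussSP Q (-conj z))ᴴ = (gaussSP Q z)⁻¹ ∧
      aut C (gaussSM Q (-conj z))ᴴ = (gaussSM Q z)⁻¹ ∧
      aut C (gaussTP Q (-conj z))ᴴ = (gaussTP Q z)⁻¹ ∧
      aut C (gaussTM Q (-conj z))ᴴ = (gaussTM Q z)⁻¹) ∧
    (∀ z, UpperRegular Q z → aut C (gaussDP Q (-conj z))ᴴ = (gaussDP Q z)⁻¹) ∧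
    (∀ z, LowerRegular Q z → aut C (gaussDM Q (-conj z))ᴴ = (gaussDM Q z)⁻¹) := by
  have hQ₂ := isL1Potential_negTranspose hQ
  have hQ₁ := isL1Potential_negConj hQ₂
  have hn : ∀ z : ℂ, -(-conj (-z)) = -conj z := fun z => by simp
  refine ⟨fun z hz => ?_, fun z h => ?_, fun z h => ?_, fun z h => ?_⟩
  · have hz' : (-z).im = 0 := by simpa using hz
    conv_rhs => rw [hg, scatT_gaugeB hC hQ₁ hz, scatT_negConj hQ₂ hz']
    rw [aut_cc_inv hC.1 (scatT_negTranspose_inv hQ (by simpa using hz)), hn]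
  · have h' := h
    rw [hg] at h'
    replace h' := h'.of_gaugeB hC hQ₁
    have hz' := h'.1
    replace h' := h'.of_negConj hQ₂
    refine ⟨?_, ?_, ?_, ?_⟩
    · conv_rhs => rw [hg, gaussSP_gaugeB hC hQ₁ h.1, gaussSM_negConj hQ₂ hz']
      rw [aut_cc_inv hC.1 (gaussSM_negTranspose_inv hQ h'), hn]
    · conv_rhs => rw [hg, gaussSM_gaugeB hC hQ₁ h.1, gaussSP_negConj hQ₂ hz']
      rw [aut_cc_inv hC.1 (gaussSP_negTranspose_inv hQ h'), hn]
    · conv_rhs => rw [hg, gaussTP_gaugeB hC hQ₁ h.1, gaussTM_negConj hQ₂ hz']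
      rw [aut_cc_inv hC.1 (gaussTM_negTranspose_inv hQ h'), hn]
    · conv_rhs => rw [hg, gaussTM_gaugeB hC hQ₁ h.1, gaussTP_negConj hQ₂ hz']
      rw [aut_cc_inv hC.1 (gaussTP_negTranspose_inv hQ h'), hn]
  · have h' := h
    rw [hg] at h'
    replace h' := h'.of_gaugeB hC hQ₁
    have hz' := h'.1
    replace h' := h'.of_negConj hQ₂
    conv_rhs => rw [hg, gaussDP_gaugeB hC hQ₁ h.1, gaussDM_negConj hQ₂ hz']
    rw [aut_cc_inv hC.1 (gaussDM_negTranspose_inv hQ h'), hn]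
  · have h' := h
    rw [hg] at h'
    replace h' := h'.of_gaugeB hC hQ₁
    have hz' := h'.1
    replace h' := h'.of_negConj hQ₂
    conv_rhs => rw [hg, gaussDM_gaugeB hC hQ₁ h.1, gaussDP_negConj hQ₂ hz']
    rw [aut_cc_inv hC.1 (gaussDP_negTranspose_inv hQ h'), hn]

theorem ClassB.scattering_transpose (hg : Q = gauge C (negTranspose Q)) :
    (∀ z : ℂ, z.im = 0 → aut C (scatT Q z)ᵀ = (scatT Q z)⁻¹) ∧
    (∀ z, RealRegular Q z → aut C (gaussSP Q z)ᵀ = (gaussSP Q z)⁻¹ ∧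
      aut C (gaussSM Q z)ᵀ = (gaussSM Q z)⁻¹ ∧
      aut C (gaussTP Q z)ᵀ = (gaussTP Q z)⁻¹ ∧
      aut C (gaussTM Q z)ᵀ = (gaussTM Q z)⁻¹) ∧
    (∀ z, UpperRegular Q z → aut C (gaussDP Q z)ᵀ = (gaussDP Q z)⁻¹) ∧
    (∀ z, LowerRegular Q z → aut C (gaussDM Q z)ᵀ = (gaussDM Q z)⁻¹) := by
  have hQ₂ := isL1Potential_negTranspose hQ
  refine ⟨fun z hz => ?_, fun z h => ?_, fun z h => ?_, fun z h => ?_⟩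
  · conv_rhs => rw [hg, scatT_gaugeB hC hQ₂ hz]
    rw [aut_transpose_inv hC.1 (scatT_negTranspose_inv hQ (by simpa using hz)), neg_neg]
  · have h' := h
    rw [hg] at h'
    replace h' := h'.of_gaugeB hC hQ₂
    refine ⟨?_, ?_, ?_, ?_⟩
    · conv_rhs => rw [hg, gaussSP_gaugeB hC hQ₂ h.1]
      rw [aut_transpose_inv hC.1 (gaussSM_negTranspose_inv hQ h'), neg_neg]
    · conv_rhs => rw [hg, gaussSM_gaugeB hC hQ₂ h.1]
      rw [aut_transpose_inv hC.1 (gaussSP_negTranspose_inv hQ h'), neg_neg]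
    · conv_rhs => rw [hg, gaussTP_gaugeB hC hQ₂ h.1]
      rw [aut_transpose_inv hC.1 (gaussTM_negTranspose_inv hQ h'), neg_neg]
    · conv_rhs => rw [hg, gaussTM_gaugeB hC hQ₂ h.1]
      rw [aut_transpose_inv hC.1 (gaussTP_negTranspose_inv hQ h'), neg_neg]
  · have h' := h
    rw [hg] at h'
    replace h' := h'.of_gaugeB hC hQ₂
    conv_rhs => rw [hg, gaussDP_gaugeB hC hQ₂ h.1]
    rw [aut_transpose_inv hC.1 (gaussDM_negTranspose_inv hQ h'), neg_neg]
  · have h' := h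
    rw [hg] at h'
    replace h' := h'.of_gaugeB hC hQ₂
    conv_rhs => rw [hg, gaussDM_gaugeB hC hQ₂ h.1]
    rw [aut_transpose_inv hC.1 (gaussDP_negTranspose_inv hQ h'), neg_neg]

theorem ClassB.scattering_conj (hg : Q = gauge C (negConj Q)) :
    (∀ z : ℂ, z.im = 0 → aut C (cc (scatT Q (conj z))) = scatT Q z) ∧
    (∀ z, RealRegular Q z → aut C (cc (gaussSP Q (conj z))) = gaussSM Q z ∧
      aut C (cc (gaussTM Q (conj z))) = gaussTP Q z) ∧
    (∀ z, LowerRegular Q z → aut C (cc (gaussDP Q (conj z))) = gaussDM Q z) := by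
  have hQ₁ := isL1Potential_negConj hQ
  have hn : ∀ z : ℂ, -conj (-z) = conj z := fun z => by simp
  refine ⟨fun z hz => ?_, fun z h => ?_, fun z h => ?_⟩
  · have hz' : (-z).im = 0 := by simpa using hz
    conv_rhs => rw [hg, scatT_gaugeB hC hQ₁ hz, scatT_negConj hQ hz', hn]
  · have hz' : (-z).im = 0 := by simpa using h.1
    constructor
    · conv_rhs => rw [hg, gaussSM_gaugeB hC hQ₁ h.1, gaussSP_negConj hQ hz', hn]
    · conv_rhs => rw [hg, gaussTP_gaugeB hC hQ₁ h.1, gaussTM_negConj hQ hz', hn]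
  · have hz' : 0 ≤ (-z).im := by simpa using h.1
    conv_rhs => rw [hg, gaussDM_gaugeB hC hQ₁ h.1, gaussDP_negConj hQ hz', hn]

theorem ClassB.scattering_self (hg : Q = gauge C Q) :
    (∀ z : ℂ, z.im = 0 → aut C (scatT Q (-z)) = scatT Q z) ∧
    (∀ z, RealRegular Q z → aut C (gaussSP Q (-z)) = gaussSM Q z ∧
      aut C (gaussTM Q (-z)) = gaussTP Q z) ∧
    (∀ z, LowerRegular Q z → aut C (gaussDP Q (-z)) = gaussDM Q z) := by
  refine ⟨fun z hz => ?_, fun z h => ⟨?_, ?_⟩, fun z h => ?_⟩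
  · conv_rhs => rw [hg, scatT_gaugeB hC hQ hz]
  · conv_rhs => rw [hg, gaussSM_gaugeB hC hQ h.1]
  · conv_rhs => rw [hg, gaussTP_gaugeB hC hQ h.1]
  · conv_rhs => rw [hg, gaussDM_gaugeB hC hQ h.1]

end ClassB

end Reductions

/-! ### The discrete spectrum -/

section Discrete

open Filter Topology

variable {r : ℕ} {Q : ℝ → BMat r} {z : ℂ}

/-! #### Continuity of the Jost solutions in the open upper half-plane -/

theorem continuousAt_phiP (hQ : IsL1Potential Q) (hz : 0 < z.im) (x : ℝ) :
    ContinuousAt (fun w => phiP Q w x) z :=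
  continuousAt_jostCols_atBot hQ (Or.inl rfl) (J_mul_fromRows_one_zero r) (by simpa using hz) x

theorem continuousAt_psiP (hQ : IsL1Potential Q) (hz : 0 < z.im) (x : ℝ) :
    ContinuousAt (fun w => psiP Q w x) z :=
  continuousAt_jostCols_atTop hQ (Or.inr rfl) (J_mul_fromRows_zero_one r) (by simpa using hz) x

theorem negTranspose_negTranspose : negTranspose (negTranspose Q) = Q := by
  funext x
  simp [negTranspose]

theorem eventually_im_pos (hz : 0 < z.im) : ∀ᶠ w : ℂ in 𝓝 z, 0 < w.im :=
  Complex.continuous_im.continuousAt.eventually (lt_mem_nhds hz)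

/-- The rows are transposed columns for `-Qᵀ` at `-w`. This identification is available only in the
half-plane, so the functions are compared near `z`. -/
theorem continuousAt_psiInvP (hQ : IsL1Potential Q) (hz : 0 < z.im) (x : ℝ) :
    ContinuousAt (fun w => psiInvP Q w x) z := by
  have hQ' := isL1Potential_negTranspose hQ
  have h : ContinuousAt (fun w => psiM (negTranspose Q) w x) (-z) :=
    continuousAt_jostCols_atTop hQ' (Or.inl rfl) (J_mul_fromRows_one_zero r) (by simpa using hz) x
  have h1 : ContinuousAt (fun w => (psiM (negTranspose Q) (-w) x)ᵀ) z :=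
    continuous_id.matrix_transpose.continuousAt.comp
      (ContinuousAt.comp (x := z) (f := fun w : ℂ => -w) h continuousAt_neg)
  refine h1.congr ?_
  filter_upwards [eventually_im_pos hz] with w hw
  rw [← psiInvP_negTranspose hQ' hw.le, negTranspose_negTranspose]

theorem continuousAt_phiInvP (hQ : IsL1Potential Q) (hz : 0 < z.im) (x : ℝ) :
    ContinuousAt (fun w => phiInvP Q w x) z := by
  have hQ' := isL1Potential_negTranspose hQ
  have h : ContinuousAt (fun w => phiM (negTranspose Q) w x) (-z) :=
    continuousAt_jostCols_atBot hQ' (Or.inr rfl) (J_mul_fromRows_zero_one r) (by simpa using hz) x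
  have h1 : ContinuousAt (fun w => (phiM (negTranspose Q) (-w) x)ᵀ) z :=
    continuous_id.matrix_transpose.continuousAt.comp
      (ContinuousAt.comp (x := z) (f := fun w : ℂ => -w) h continuousAt_neg)
  refine h1.congr ?_
  filter_upwards [eventually_im_pos hz] with w hw
  rw [← phiInvP_negTranspose hQ' hw.le, negTranspose_negTranspose]

/-! #### The residue identity -/

/-- Completeness of the solutions `φ⁺`, `ψ⁺` away from the spectrum. -/
theorem completeness (hQ : IsL1Potential Q) (hz : 0 ≤ z.im) (ha : (aP Q z).det ≠ 0)
    (hc : (cP Q z).det ≠ 0) (x : ℝ) :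
    phiP Q z x * (aP Q z)⁻¹ * psiInvP Q z x + psiP Q z x * (cP Q z)⁻¹ * phiInvP Q z x = 1 := by
  -- The square matrix `(φ⁺, ψ⁺)` has this left inverse: `ψ̂⁺` kills `ψ⁺` and `φ̂⁺` kills `φ⁺`,
  -- while the diagonal pairings are `a⁺` and `c⁺`. Reversing the order gives the claim.
  have h : Matrix.fromRows ((aP Q z)⁻¹ * psiInvP Q z x) ((cP Q z)⁻¹ * phiInvP Q z x) *
      Matrix.fromCols (phiP Q z x) (psiP Q z x) = 1 := by
    rw [Matrix.fromRows_mul_fromCols, Matrix.mul_assoc, Matrix.mul_assoc, Matrix.mul_assoc,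
      Matrix.mul_assoc, psiInvP_mul_psiP hQ hz, phiInvP_mul_phiP hQ hz, ← aP_eq hQ hz,
      ← cP_eq hQ hz, Matrix.nonsing_inv_mul _ (isUnit_iff_ne_zero.2 ha),
      Matrix.nonsing_inv_mul _ (isUnit_iff_ne_zero.2 hc), Matrix.mul_zero, Matrix.mul_zero,
      Matrix.fromBlocks_one]
  rw [mul_eq_one_comm, Matrix.fromCols_mul_fromRows] at h
  simpa only [Matrix.mul_assoc] using h

/-- `completeness` at `w`, multiplied by `w - z`, in the limit `w → z`. Continuity of the Jost
halves in the open half-plane is enough; no analyticity enters. -/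
theorem residue_identity (hQ : IsL1Potential Q) (hz : 0 < z.im) {Ra Rc : Blk r}
    (ha : InvSimplePole (aP Q) z Ra) (hc : InvSimplePole (cP Q) z Rc) (x : ℝ) :
    phiP Q z x * Ra * psiInvP Q z x + psiP Q z x * Rc * phiInvP Q z x = 0 := by
  have hle : 𝓝[≠] z ≤ 𝓝 z := nhdsWithin_le_nhds
  have h1 : Tendsto (fun w => phiP Q w x * ((w - z) • (aP Q w)⁻¹) * psiInvP Q w x) (𝓝[≠] z)
      (𝓝 (phiP Q z x * Ra * psiInvP Q z x)) :=
    tendsto_matrix_mul (tendsto_matrix_mul ((continuousAt_phiP hQ hz x).tendsto.mono_left hle)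
      ha.2.2) ((continuousAt_psiInvP hQ hz x).tendsto.mono_left hle)
  have h2 : Tendsto (fun w => psiP Q w x * ((w - z) • (cP Q w)⁻¹) * phiInvP Q w x) (𝓝[≠] z)
      (𝓝 (psiP Q z x * Rc * phiInvP Q z x)) :=
    tendsto_matrix_mul (tendsto_matrix_mul ((continuousAt_psiP hQ hz x).tendsto.mono_left hle)
      hc.2.2) ((continuousAt_phiInvP hQ hz x).tendsto.mono_left hle)
  have h3 : Tendsto (fun w : ℂ => (w - z) • (1 : BMat r)) (𝓝[≠] z) (𝓝 0) := by
    have : Continuous fun w : ℂ => (w - z) • (1 : BMat r) := by fun_prop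
    have h := (this.tendsto z).mono_left hle
    rwa [sub_self, zero_smul] at h
  refine tendsto_nhds_unique ((h1.add h2).congr' ?_) h3
  filter_upwards [ha.2.1, hc.2.1, hle (eventually_im_pos hz)] with w hwa hwc hw
  rw [← completeness hQ hw.le hwa hwc x]
  simp only [Matrix.mul_smul, Matrix.smul_mul, smul_add]

theorem eq_zero_of_mul_eq_zero {K : Cols r} (hK : Function.Injective (K *ᵥ ·)) {n : Type*}
    {X : Matrix (Fin r) n ℂ} (h : K * X = 0) : X = 0 := by
  ext i j
  have h1 : K *ᵥ (fun i => X i j) = K *ᵥ 0 := by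
    rw [Matrix.mulVec_zero]
    exact funext fun i => congrFun (congrFun h i) j
  exact congrFun (hK h1) i

/-- Inserting the definition of `ρ` makes `ψ⁺` a common left factor of the residue identity, and
inserting that of `τ` makes `φ⁺` one. Either can be cancelled, being injective. -/
theorem residue_rows (hQ : IsL1Potential Q) (hz : 0 < z.im) {Ra Rc ρ τ : Blk r}
    (ha : InvSimplePole (aP Q) z Ra) (hc : InvSimplePole (cP Q) z Rc) {x : ℝ}
    (hρ : phiP Q z x * Ra = psiP Q z x * ρ) (hτ : psiP Q z x * Rc = phiP Q z x * τ) :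
    Rc * phiInvP Q z x = -(ρ * psiInvP Q z x) ∧ Ra * psiInvP Q z x = -(τ * phiInvP Q z x) := by
  have h := residue_identity hQ hz ha hc x
  constructor
  · rw [hρ, Matrix.mul_assoc, Matrix.mul_assoc, ← Matrix.mul_add] at h
    rw [eq_neg_iff_add_eq_zero, add_comm]
    exact eq_zero_of_mul_eq_zero (psiP_injective hQ hz.le x) h
  · rw [hτ, Matrix.mul_assoc, Matrix.mul_assoc, ← Matrix.mul_add] at h
    rw [eq_neg_iff_add_eq_zero]
    exact eq_zero_of_mul_eq_zero (phiP_injective hQ hz.le x) h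

/-! #### Transport of simple poles -/

theorem tendsto_conj_punctured (z : ℂ) : Tendsto (starRingEnd ℂ) (𝓝[≠] (conj z)) (𝓝[≠] z) := by
  refine tendsto_nhdsWithin_iff.2 ⟨?_, ?_⟩
  · have := (Complex.continuous_conj.tendsto (conj z)).mono_left
      (nhdsWithin_le_nhds (s := {conj z}ᶜ))
    rwa [Complex.conj_conj] at this
  · filter_upwards [self_mem_nhdsWithin] with w hw h
    exact hw (by rw [Set.mem_singleton_iff] at h ⊢; rw [← h, Complex.conj_conj])

/-- Conjugation carries punctured neighbourhoods of `conj z` to those of `z`, and `w - conj z` is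
the conjugate of `conj w - z`, so the adjoint passes to the residue. -/
theorem InvSimplePole.dagger {a a' : ℂ → Blk r} {B R : Blk r} (hB : IsUnit B.det)
    (h : InvSimplePole a z R)
    (ha : ∀ᶠ w in 𝓝 (conj z), a' w = B⁻¹ * (a (conj w))ᴴ * B) :
    InvSimplePole a' (conj z) (B⁻¹ * Rᴴ * B) := by
  have hdet : ∀ w, (B⁻¹ * (a (conj w))ᴴ * B).det = conj (a (conj w)).det := fun w => by
    rw [det_conj hB, Matrix.det_conjTranspose]
    rfl
  refine ⟨?_, ?_, ?_⟩
  · rw [ha.self_of_nhds, hdet, Complex.conj_conj, h.1, map_zero]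
  · filter_upwards [nhdsWithin_le_nhds ha, (tendsto_conj_punctured z).eventually h.2.1]
      with w hw hw'
    rw [hw, hdet]
    simpa using hw'
  · have h1 := h.2.2.comp (tendsto_conj_punctured z)
    have h2 : Continuous fun X : Blk r => Xᴴ := continuous_id.matrix_conjTranspose
    have h3 := tendsto_matrix_mul (tendsto_matrix_mul (tendsto_const_nhds (x := B⁻¹))
      ((h2.tendsto R).comp h1)) (tendsto_const_nhds (x := B))
    refine h3.congr' ?_
    filter_upwards [nhdsWithin_le_nhds ha] with w hw
    rw [hw, conj_inv hB, ← Matrix.conjTranspose_nonsing_inv]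
    simp only [Function.comp_apply, Matrix.conjTranspose_smul, Matrix.mul_smul, Matrix.smul_mul]
    congr 1
    simp

theorem InvSimplePole.unique {a : ℂ → Blk r} {R R' : Blk r} (h : InvSimplePole a z R)
    (hR : InvSimplePole a z R') : R = R' :=
  tendsto_nhds_unique h.2.2 hR.2.2

/-! #### Reduction by an involution from the Cartan subgroup -/

/-- The diagonal entries are `±1`, hence real. -/
theorem conjTranspose_eq_self_of_sq_one {B : Blk r} (hd : B.IsDiag) (h : B * B = 1) : Bᴴ = B := by
  obtain ⟨d, rfl⟩ : ∃ d, B = Matrix.diagonal d := ⟨B.diag, hd.diagonal_diag.symm⟩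
  rw [Matrix.diagonal_conjTranspose]
  congr 1
  funext i
  have hi := congrFun (congrFun h i) i
  rw [Matrix.diagonal_mul_diagonal, Matrix.diagonal_apply_eq, Matrix.one_apply_eq] at hi
  rcases mul_self_eq_one_iff.1 hi with h | h <;> simp [h]

theorem inv_eq_self_of_sq_one {B : Blk r} (h : B * B = 1) : B⁻¹ = B := Matrix.inv_eq_right_inv h

variable {A B : Blk r}

theorem classA_fromBlocks (hA : IsUnit A.det) (hB : IsUnit B.det) :
    ClassA (Matrix.fromBlocks A 0 0 B) :=
  ⟨isUnit_det_fromBlocks_diag hA hB, by rw [aut_fromBlocks_diag_J hA hB, one_smul]⟩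

section Dagger

variable (hQ : IsL1Potential Q) (hA : IsUnit A.det) (hB : IsUnit B.det)
  (hg : Q = gauge (Matrix.fromBlocks A 0 0 B) (negConj (negTranspose Q)))
include hQ hA hB hg

theorem phiM_dagger (hz : z.im ≤ 0) (x : ℝ) :
    phiM Q z x = (Matrix.fromBlocks A 0 0 B)⁻¹ * (phiInvP Q (conj z) x)ᴴ * B := by
  have hQ₂ := isL1Potential_negTranspose hQ
  have hQ₁ := isL1Potential_negConj hQ₂
  conv_lhs => rw [hg, phiM_gaugeA hA hB hQ₁ hz, phiM_negConj hQ₂ hz,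
    phiM_negTranspose hQ (by simpa using hz), neg_neg]
  rfl

theorem psiM_dagger (hz : z.im ≤ 0) (x : ℝ) :
    psiM Q z x = (Matrix.fromBlocks A 0 0 B)⁻¹ * (psiInvP Q (conj z) x)ᴴ * A := by
  have hQ₂ := isL1Potential_negTranspose hQ
  have hQ₁ := isL1Potential_negConj hQ₂
  conv_lhs => rw [hg, psiM_gaugeA hA hB hQ₁ hz, psiM_negConj hQ₂ hz,
    psiM_negTranspose hQ (by simpa using hz), neg_neg]
  rfl

theorem aM_dagger (hz : z.im ≤ 0) : aM Q z = B⁻¹ * (cP Q (conj z))ᴴ * B := by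
  have hQ₂ := isL1Potential_negTranspose hQ
  have hQ₁ := isL1Potential_negConj hQ₂
  conv_lhs => rw [hg, aM_gaugeA hA hB hQ₁ hz, aM_negConj hQ₂ hz,
    aM_negTranspose hQ (by simpa using hz), neg_neg]
  rfl

theorem cM_dagger (hz : z.im ≤ 0) : cM Q z = A⁻¹ * (aP Q (conj z))ᴴ * A := by
  have hQ₂ := isL1Potential_negTranspose hQ
  have hQ₁ := isL1Potential_negConj hQ₂
  conv_lhs => rw [hg, cM_gaugeA hA hB hQ₁ hz, cM_negConj hQ₂ hz,
    cM_negTranspose hQ (by simpa using hz), neg_neg]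
  rfl

/-- The symmetry relates `a⁻` to `c⁺`; simultaneous degeneracy of `a⁺` and `c⁺` brings it back to
`a⁺`. -/
theorem specM_eq_conj_image_specP : specM Q = (fun z => conj z) '' specP Q := by
  have key : ∀ w : ℂ, w.im < 0 → ((aM Q w).det = 0 ↔ (aP Q (conj w)).det = 0) := fun w hw => by
    have hw' : 0 ≤ (conj w).im := by simpa using hw.le
    rw [aM_dagger hQ hA hB hg hw.le, det_conj hB, Matrix.det_conjTranspose, star_eq_zero,
      det_aP_eq_zero_iff hQ hw']
  ext w
  constructor
  · rintro ⟨hw, h⟩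
    exact ⟨conj w, ⟨by simpa using hw, (key w hw).1 h⟩, Complex.conj_conj w⟩
  · rintro ⟨w, ⟨hw, h⟩, rfl⟩
    have hw' : (conj w).im < 0 := by simpa using hw
    exact ⟨hw', (key _ hw').2 (by rwa [Complex.conj_conj])⟩

/-- Up to sign, `ρ±` are the off-diagonal blocks of `T∓`. Those of `S±` are `d⁻ĉ⁺` and `-d⁺ĉ⁻`, that
is `τ⁺` and `-τ⁻`. The relations for the Gauss factors then apply blockwise. -/
theorem rhoM_tauM_dagger (h : RealRegular Q z) :
    rhoM Q z = A⁻¹ * (rhoP Q z)ᴴ * B ∧ tauM Q z = B⁻¹ * (tauP Q z)ᴴ * A := by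
  have hreal : conj z = z := Complex.conj_eq_iff_im.2 h.1
  obtain ⟨h1, h2, h3, h4⟩ := h.det_ne hQ
  have hb := scatT_mul_inv_blocks hQ h.1
  have h5 := ((classA_fromBlocks hA hB).scattering_dagger hQ hg).2.1 z h
  rw [hreal] at h5
  rw [gaussSP, gaussSM, gaussTP, gaussTM, fromBlocks_lower_inv, fromBlocks_upper_inv,
    Matrix.fromBlocks_conjTranspose, Matrix.fromBlocks_conjTranspose, aut_fromBlocks_diag hA hB,
    aut_fromBlocks_diag hA hB, Matrix.fromBlocks_inj, Matrix.fromBlocks_inj, neg_neg, neg_neg] at h5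
  refine ⟨h5.2.2.1.symm, ?_⟩
  rw [tauM, tauP, inv_mul_eq_mul_inv h2 h4 hb.2.2.1, inv_mul_eq_mul_inv h1 h3 hb.2.1.symm]
  exact h5.1.2.2.1.symm

theorem IsDiscreteDatumP.dagger {ρ τ : Blk r} (h : IsDiscreteDatumP Q z ρ τ) :
    IsDiscreteDatumM Q (conj z) (A⁻¹ * ρᴴ * B) (B⁻¹ * τᴴ * A) := by
  obtain ⟨hz, Ra, Rc, ha, hc, hρ, hτ⟩ := h
  have hz' : (conj z).im < 0 := by simpa using hz
  have hev : ∀ᶠ w : ℂ in 𝓝 (conj z), w.im ≤ 0 := by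
    filter_upwards [Complex.continuous_im.continuousAt.eventually (gt_mem_nhds hz')]
      with w hw using le_of_lt hw
  -- The residues change roles: `a⁻` is conjugate to the adjoint of `c⁺`, and `c⁻` to that of `a⁺`.
  -- Accordingly the relation for `ρ` uses the row identity for `Rc`, and the one for `τ` that for
  -- `Ra`.
  refine ⟨hz', B⁻¹ * Rcᴴ * B, A⁻¹ * Raᴴ * A,
    hc.dagger hB (hev.mono fun w hw => aM_dagger hQ hA hB hg hw),
    ha.dagger hA (hev.mono fun w hw => cM_dagger hQ hA hB hg hw), fun x => ?_, fun x => ?_⟩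
  · have h1 := congrArg Matrix.conjTranspose (residue_rows hQ hz ha hc (hρ x) (hτ x)).1
    rw [Matrix.conjTranspose_mul, Matrix.conjTranspose_neg, Matrix.conjTranspose_mul] at h1
    rw [phiM_dagger hQ hA hB hg hz'.le, psiM_dagger hQ hA hB hg hz'.le, Complex.conj_conj]
    simp only [← Matrix.mul_assoc]
    rw [Matrix.mul_nonsing_inv_cancel_right _ _ hB, Matrix.mul_nonsing_inv_cancel_right _ _ hA,
      Matrix.mul_assoc _ _ Rcᴴ, h1, Matrix.mul_neg, Matrix.neg_mul, ← Matrix.mul_assoc]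
  · have h1 := congrArg Matrix.conjTranspose (residue_rows hQ hz ha hc (hρ x) (hτ x)).2
    rw [Matrix.conjTranspose_mul, Matrix.conjTranspose_neg, Matrix.conjTranspose_mul] at h1
    rw [phiM_dagger hQ hA hB hg hz'.le, psiM_dagger hQ hA hB hg hz'.le, Complex.conj_conj]
    simp only [← Matrix.mul_assoc]
    rw [Matrix.mul_nonsing_inv_cancel_right _ _ hB, Matrix.mul_nonsing_inv_cancel_right _ _ hA,
      Matrix.mul_assoc _ _ Raᴴ, h1, Matrix.mul_neg, Matrix.neg_mul, ← Matrix.mul_assoc]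

end Dagger

/-- Residues are unique as limits, and the constants are then determined because the Jost columns
are injective. -/
theorem IsDiscreteDatumM.unique (hQ : IsL1Potential Q) {ρ τ ρ' τ' : Blk r}
    (h : IsDiscreteDatumM Q z ρ τ) (h' : IsDiscreteDatumM Q z ρ' τ') : ρ = ρ' ∧ τ = τ' := by
  obtain ⟨hz, Ra, Rc, ha, hc, hρ, hτ⟩ := h
  obtain ⟨-, Ra', Rc', ha', hc', hρ', hτ'⟩ := h'
  obtain rfl := ha.unique ha'
  obtain rfl := hc.unique hc'
  constructor
  · refine sub_eq_zero.1 (eq_zero_of_mul_eq_zero (psiM_injective hQ hz.le 0) ?_)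
    rw [Matrix.mul_sub, sub_eq_zero]
    exact neg_injective ((hρ 0).symm.trans (hρ' 0))
  · refine sub_eq_zero.1 (eq_zero_of_mul_eq_zero (phiM_injective hQ hz.le 0) ?_)
    rw [Matrix.mul_sub, sub_eq_zero]
    exact neg_injective ((hτ 0).symm.trans (hτ' 0))

end Discrete

end LaxScattering

end

open LaxScattering in
theorem mainTheorem2 (r : ℕ) (hr : 0 < r) (Q : ℝ → BMat r) (hQ : IsPotential Q) :
    -- the scattering matrix relates the two Jost solutions
    (∀ z : ℂ, z.im = 0 → ∀ x, phi Q z x = psi Q z x * scatT Q z) ∧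
    -- class A automorphisms preserve the block types
    (∀ C : BMat r, ClassA C → ∀ X : BMat r,
      (BlockUpper X → BlockUpper (aut C X)) ∧ (BlockLower X → BlockLower (aut C X)) ∧
      (BlockDiag X → BlockDiag (aut C X)) ∧
      (BlockUpper X ∧ UnitDiag X → BlockUpper (aut C X) ∧ UnitDiag (aut C X)) ∧
      (BlockLower X ∧ UnitDiag X → BlockLower (aut C X) ∧ UnitDiag (aut C X))) ∧
    -- class A, a)
    (∀ (C : BMat r) (κ : ℂ → ℂ), ClassA C → Reduction1 Q C κ →
      (∀ z, κ z = conj z) ∧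
      (∀ z : ℂ, z.im = 0 → aut C (scatT Q (conj z))ᴴ = (scatT Q z)⁻¹) ∧
      (∀ z, RealRegular Q z → aut C (gaussSP Q (conj z))ᴴ = (gaussSM Q z)⁻¹ ∧
        aut C (gaussTM Q (conj z))ᴴ = (gaussTP Q z)⁻¹) ∧
      (∀ z, LowerRegular Q z → aut C (gaussDP Q (conj z))ᴴ = (gaussDM Q z)⁻¹)) ∧
    -- class A, b)
    (∀ (C : BMat r) (κ : ℂ → ℂ), ClassA C → Reduction2 Q C κ →
      (∀ z, κ z = -z) ∧
      (∀ z : ℂ, z.im = 0 → aut C (scatT Q (-z))ᵀ = (scatT Q z)⁻¹) ∧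
      (∀ z, RealRegular Q z → aut C (gaussSP Q (-z))ᵀ = (gaussSM Q z)⁻¹ ∧
        aut C (gaussTM Q (-z))ᵀ = (gaussTP Q z)⁻¹) ∧
      (∀ z, LowerRegular Q z → aut C (gaussDP Q (-z))ᵀ = (gaussDM Q z)⁻¹)) ∧
    -- class A, c)
    (∀ (C : BMat r) (κ : ℂ → ℂ), ClassA C → Reduction3 Q C κ →
      (∀ z, κ z = -conj z) ∧
      (∀ z : ℂ, z.im = 0 → aut C (cc (scatT Q (-conj z))) = scatT Q z) ∧
      (∀ z, RealRegular Q z → aut C (cc (gaussSP Q (-conj z))) = gaussSP Q z ∧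
        aut C (cc (gaussSM Q (-conj z))) = gaussSM Q z ∧
        aut C (cc (gaussTP Q (-conj z))) = gaussTP Q z ∧
        aut C (cc (gaussTM Q (-conj z))) = gaussTM Q z) ∧
      (∀ z, UpperRegular Q z → aut C (cc (gaussDP Q (-conj z))) = gaussDP Q z) ∧
      (∀ z, LowerRegular Q z → aut C (cc (gaussDM Q (-conj z))) = gaussDM Q z)) ∧
    -- class A, d)
    (∀ (C : BMat r) (κ : ℂ → ℂ), ClassA C → Reduction4 Q C κ →
      (∀ z, κ z = z) ∧
      (∀ z : ℂ, z.im = 0 → aut C (scatT Q z) = scatT Q z) ∧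
      (∀ z, RealRegular Q z → aut C (gaussSP Q z) = gaussSP Q z ∧
        aut C (gaussSM Q z) = gaussSM Q z ∧
        aut C (gaussTP Q z) = gaussTP Q z ∧
        aut C (gaussTM Q z) = gaussTM Q z) ∧
      (∀ z, UpperRegular Q z → aut C (gaussDP Q z) = gaussDP Q z) ∧
      (∀ z, LowerRegular Q z → aut C (gaussDM Q z) = gaussDM Q z)) ∧
    -- class B automorphisms exchange the block types
    (∀ C : BMat r, ClassB C → ∀ X : BMat r,
      (BlockUpper X → BlockLower (aut C X)) ∧ (BlockLower X → BlockUpper (aut C X)) ∧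
      (BlockDiag X → BlockDiag (aut C X)) ∧
      (BlockUpper X ∧ UnitDiag X → BlockLower (aut C X) ∧ UnitDiag (aut C X)) ∧
      (BlockLower X ∧ UnitDiag X → BlockUpper (aut C X) ∧ UnitDiag (aut C X))) ∧
    -- class B, a)
    (∀ (C : BMat r) (κ : ℂ → ℂ), ClassB C → Reduction1 Q C κ →
      (∀ z, κ z = -conj z) ∧
      (∀ z : ℂ, z.im = 0 → aut C (scatT Q (-conj z))ᴴ = (scatT Q z)⁻¹) ∧
      (∀ z, RealRegular Q z → aut C (gaussSP Q (-conj z))ᴴ = (gaussSP Q z)⁻¹ ∧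
        aut C (gaussSM Q (-conj z))ᴴ = (gaussSM Q z)⁻¹ ∧
        aut C (gaussTP Q (-conj z))ᴴ = (gaussTP Q z)⁻¹ ∧
        aut C (gaussTM Q (-conj z))ᴴ = (gaussTM Q z)⁻¹) ∧
      (∀ z, UpperRegular Q z → aut C (gaussDP Q (-conj z))ᴴ = (gaussDP Q z)⁻¹) ∧
      (∀ z, LowerRegular Q z → aut C (gaussDM Q (-conj z))ᴴ = (gaussDM Q z)⁻¹)) ∧
    -- class B, b)
    (∀ (C : BMat r) (κ : ℂ → ℂ), ClassB C → Reduction2 Q C κ →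
      (∀ z, κ z = z) ∧
      (∀ z : ℂ, z.im = 0 → aut C (scatT Q z)ᵀ = (scatT Q z)⁻¹) ∧
      (∀ z, RealRegular Q z → aut C (gaussSP Q z)ᵀ = (gaussSP Q z)⁻¹ ∧
        aut C (gaussSM Q z)ᵀ = (gaussSM Q z)⁻¹ ∧
        aut C (gaussTP Q z)ᵀ = (gaussTP Q z)⁻¹ ∧
        aut C (gaussTM Q z)ᵀ = (gaussTM Q z)⁻¹) ∧
      (∀ z, UpperRegular Q z → aut C (gaussDP Q z)ᵀ = (gaussDP Q z)⁻¹) ∧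
      (∀ z, LowerRegular Q z → aut C (gaussDM Q z)ᵀ = (gaussDM Q z)⁻¹)) ∧
    -- class B, c)
    (∀ (C : BMat r) (κ : ℂ → ℂ), ClassB C → Reduction3 Q C κ →
      (∀ z, κ z = conj z) ∧
      (∀ z : ℂ, z.im = 0 → aut C (cc (scatT Q (conj z))) = scatT Q z) ∧
      (∀ z, RealRegular Q z → aut C (cc (gaussSP Q (conj z))) = gaussSM Q z ∧
        aut C (cc (gaussTM Q (conj z))) = gaussTP Q z) ∧
      (∀ z, LowerRegular Q z → aut C (cc (gaussDP Q (conj z))) = gaussDM Q z)) ∧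
    -- class B, d)
    (∀ (C : BMat r) (κ : ℂ → ℂ), ClassB C → Reduction4 Q C κ →
      (∀ z, κ z = -z) ∧
      (∀ z : ℂ, z.im = 0 → aut C (scatT Q (-z)) = scatT Q z) ∧
      (∀ z, RealRegular Q z → aut C (gaussSP Q (-z)) = gaussSM Q z ∧
        aut C (gaussTM Q (-z)) = gaussTP Q z) ∧
      (∀ z, LowerRegular Q z → aut C (gaussDP Q (-z)) = gaussDM Q z)) ∧
    -- reduction a) with `C = diag(B₊, B₋)` from the Cartan subgroup
    (∀ (Bp Bm : Blk r) (κ : ℂ → ℂ), Bp.IsDiag → Bm.IsDiag → Bp * Bp = 1 → Bm * Bm = 1 →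
      Reduction1 Q (Matrix.fromBlocks Bp 0 0 Bm) κ →
      (∀ z, RealRegular Q z → rhoM Q z = (Bm * rhoP Q z * Bp)ᴴ ∧
        tauM Q z = (Bp * tauP Q z * Bm)ᴴ) ∧
      specM Q = (fun z => conj z) '' specP Q ∧
      (∀ (z : ℂ) (ρ τ ρ' τ' : Blk r), IsDiscreteDatumP Q z ρ τ →
        (IsDiscreteDatumM Q (conj z) ρ' τ' ↔
          ρ' = (Bm * ρ * Bp)ᴴ ∧ τ' = (Bp * τ * Bm)ᴴ))) := by
  have hL := hQ.isL1Potential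
  refine ⟨fun z hz x => phi_eq_psi_mul_scatT hL hz x, fun C hC X => ?_, fun C κ hC h => ?_,
    fun C κ hC h => ?_, fun C κ hC h => ?_, fun C κ hC h => ?_, fun C hC X => ?_,
    fun C κ hC h => ?_, fun C κ hC h => ?_, fun C κ hC h => ?_, fun C κ hC h => ?_,
    fun Bp Bm κ hdp hdm hp hm h => ?_⟩
  · obtain ⟨hu, hl, h1⟩ := hC.aut_block X
    exact ⟨hu, hl, fun h => ⟨hu h.1, hl h.2⟩, fun h => ⟨hu h.1, h1 h.2⟩,
      fun h => ⟨hl h.1, h1 h.2⟩⟩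
  · obtain ⟨hκ, hg⟩ := Reduction1.split hr hQ hC.1 (Or.inl rfl) hC.aut_J h
    exact ⟨fun z => by simpa using hκ z, hC.scattering_dagger hL hg⟩
  · obtain ⟨hκ, hg⟩ := Reduction2.split hr hQ hC.1 (Or.inl rfl) hC.aut_J h
    exact ⟨fun z => by simpa using hκ z, hC.scattering_transpose hL hg⟩
  · obtain ⟨hκ, hg⟩ := Reduction3.split hr hQ hC.1 (Or.inl rfl) hC.aut_J h
    exact ⟨fun z => by simpa using hκ z, hC.scattering_conj hL hg⟩
  · obtain ⟨hκ, hg⟩ := Reduction4.split hr hQ hC.1 (Or.inl rfl) hC.aut_J h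
    exact ⟨fun z => by simpa using hκ z, hC.scattering_self hL hg⟩
  · obtain ⟨hu, hl, h1⟩ := hC.aut_block X
    exact ⟨hu, hl, fun h => ⟨hl h.2, hu h.1⟩, fun h => ⟨hu h.1, h1 h.2⟩,
      fun h => ⟨hl h.1, h1 h.2⟩⟩
  · obtain ⟨hκ, hg⟩ := Reduction1.split hr hQ hC.1 (Or.inr rfl) hC.aut_J h
    exact ⟨fun z => by simpa using hκ z, hC.scattering_dagger hL hg⟩
  · obtain ⟨hκ, hg⟩ := Reduction2.split hr hQ hC.1 (Or.inr rfl) hC.aut_J h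
    exact ⟨fun z => by simpa using hκ z, hC.scattering_transpose hL hg⟩
  · obtain ⟨hκ, hg⟩ := Reduction3.split hr hQ hC.1 (Or.inr rfl) hC.aut_J h
    exact ⟨fun z => by simpa using hκ z, hC.scattering_conj hL hg⟩
  · obtain ⟨hκ, hg⟩ := Reduction4.split hr hQ hC.1 (Or.inr rfl) hC.aut_J h
    exact ⟨fun z => by simpa using hκ z, hC.scattering_self hL hg⟩
  · have hA : IsUnit Bp.det := Matrix.isUnit_det_of_right_inverse hp
    have hB : IsUnit Bm.det := Matrix.isUnit_det_of_right_inverse hm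
    have hC := classA_fromBlocks hA hB
    obtain ⟨-, hg⟩ := Reduction1.split hr hQ hC.1 (Or.inl rfl) hC.aut_J h
    -- The blocks are self-adjoint and equal to their inverses, which turns the general formula for
    -- `C = diag(A, B)` into the symmetric one.
    have hρ : ∀ ρ : Blk r, (Bm * ρ * Bp)ᴴ = Bp⁻¹ * ρᴴ * Bm := fun ρ => by
      rw [Matrix.conjTranspose_mul, Matrix.conjTranspose_mul,
        conjTranspose_eq_self_of_sq_one hdp hp, conjTranspose_eq_self_of_sq_one hdm hm,
        inv_eq_self_of_sq_one hp, mul_assoc]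
    have hτ : ∀ τ : Blk r, (Bp * τ * Bm)ᴴ = Bm⁻¹ * τᴴ * Bp := fun τ => by
      rw [Matrix.conjTranspose_mul, Matrix.conjTranspose_mul,
        conjTranspose_eq_self_of_sq_one hdp hp, conjTranspose_eq_self_of_sq_one hdm hm,
        inv_eq_self_of_sq_one hm, mul_assoc]
    refine ⟨fun z hz => ?_, specM_eq_conj_image_specP hL hA hB hg, fun z ρ τ ρ' τ' hd => ?_⟩
    · rw [hρ, hτ]
      exact rhoM_tauM_dagger hL hA hB hg hz
    · have hM := IsDiscreteDatumP.dagger hL hA hB hg hd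
      rw [hρ, hτ]
      refine ⟨fun h' => IsDiscreteDatumM.unique hL h' hM, ?_⟩
      rintro ⟨rfl, rfl⟩
      exact hM
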